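/- Let $d\in\mathbb N$, $m_1,\dots,m_d\ge 0$, $\omega>0$, and let $\rho=(\rho_1,\dots,\rho_d):\mathbb R^3\to\mathbb R^d$ be a $C^\infty$ function with $\rho(-x)=\rho(x)$ and $\rho(x)=0$ for $|x|\ge R_\rho$ (condition A2). Put $\hat\rho_n(k)=\int e^{ik\cdot x}\rho_n(x)\,dx$ and assume that the matrix $\omega^2I-K_0$ is positive definite (condition A1'), where $K_0$ is the $3\times3$ matrix with the entries $$K_{0,ij}=\sum_{n=1}^d\frac1{(2\pi)^3}\int_{\mathbb R^3}\frac{k_ik_j|\hat\rho_n(k)|^2}{|k|^2+m_n^2}\,dk .$$ Let $\mathcal E=H^1_{loc}(\mathbb R^3;\mathbb R^d)\oplus L^2_{loc}(\mathbb R^3;\mathbb R^d)\oplus\mathbb R^3\oplus\mathbb R^3$ be the space of the states $Y=(\varphi,\pi,q,p)$ with the topology of the local energy seminorms $$\|Y\|_{\mathcal E,R}^2=\int_{|x|<R}\bigl(|\varphi(x)|^2+|\nabla\varphi(x)|^2+|\pi(x)|^2\bigr)dx+|q|^2+|p|^2,\qquad R>0$$ (for $R\le 0$ the integral is $0$). Consider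 the Cauchy problem with initial state $Y(0)=Y_0$ for $$\dot\varphi_n=\pi_n,\qquad \dot\pi_n=(\Delta-m_n^2)\varphi_n-q\cdot\nabla\rho_n\quad(n=1,\dots,d),$$ $$\dot q=p,\qquad \dot p=-\omega^2q-\sum_{n=1}^d\int_{\mathbb R^3}\varphi_n(x,t)\nabla\rho_n(x)\,dx,\qquad t\in\mathbb R,$$ where the first two equations are understood in the sense of distributions in $x$: for every $\psi\in C_0^\infty(\mathbb R^3)$ the functions $t\mapsto\langle\varphi_n(t),\psi\rangle$ and $t\mapsto\langle\pi_n(t),\psi\rangle$ are differentiable at every $t\in\mathbb R$, with the derivatives $\langle\pi_n(t),\psi\rangle$ and $\langle\varphi_n(t),(\Delta-m_n^2)\psi\rangle-\langle q(t)\cdot\nabla\rho_n,\psi\rangle$ respectively. Then: (i) For every $Y_0\in\mathcal E$ the Cauchy problem has a unique solution $Y\in C(\mathbb R,\mathcal E)$. (ii) For every $t\in\mathbb R$ the operator $U(t):Y_0\mapsto Y(t)$ is continuous on $\mathcal E$. Moreover, there is a function $T\mapsto C(T)$ (depending only on $d$, $m$, $\omega$, $\rho$, $R_\rho$, and not on $R$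 or $Y_0$) such that for all $R>R_\rho$, $T>0$ and $Y_0\in\mathcal E$ $$\sup_{|t|\le T}\|U(t)Y_0\|_{\mathcal E,R}^2\le C(T)\,\|Y_0\|_{\mathcal E,R+T}^2 .$$ -/

import Mathlib

noncomputable section

namespace FieldParticle

open MeasureTheory
open scoped ContDiff Gradient Laplacian

/-- Euclidean three-space. -/
abbrev R3 : Type := EuclideanSpace ℝ (Fin 3)

/-! ### Local Sobolev spaces -/

/-- `f` is square integrable on every ball centred at the origin. -/
def MemL2loc {F : Type*} [NormedAddCommGroup F] (f : R3 → F) : Prop :=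
  ∀ R : ℝ, MemLp f 2 (volume.restrict (Metric.ball (0 : R3) R))

/-- `g` is the gradient of the scalar function `u` in the sense of distributions. -/
def IsWeakGrad (u : R3 → ℝ) (g : R3 → R3) : Prop :=
  ∀ ψ : R3 → ℝ, ContDiff ℝ ∞ ψ → HasCompactSupport ψ →
    ∫ x, u x • ∇ ψ x = - ∫ x, ψ x • g x

theorem MemL2loc.congr {F : Type*} [NormedAddCommGroup F] {f g : R3 → F} (hf : MemL2loc f)
    (h : f =ᵐ[volume] g) : MemL2loc g :=
  fun R => (hf R).ae_eq (ae_restrict_of_ae h)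

theorem MemL2loc.locallyIntegrable {F : Type*} [NormedAddCommGroup F] {f : R3 → F}
    (hf : MemL2loc f) : LocallyIntegrable f volume := by
  intro x
  refine ⟨Metric.ball 0 (‖x‖ + 1), Metric.isOpen_ball.mem_nhds (by simp), ?_⟩
  have : IsFiniteMeasure (volume.restrict (Metric.ball (0 : R3) (‖x‖ + 1))) :=
    ⟨by simpa using measure_ball_lt_top (μ := (volume : Measure R3)) (x := 0)⟩
  exact (hf _).integrable (by norm_num)

theorem IsWeakGrad.congr {u v : R3 → ℝ} {g h : R3 → R3} (H : IsWeakGrad u g)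
    (huv : u =ᵐ[volume] v) (hgh : g =ᵐ[volume] h) : IsWeakGrad v h := by
  intro ψ h1 h2
  have e1 : ∫ x, u x • ∇ ψ x = ∫ x, v x • ∇ ψ x :=
    integral_congr_ae (huv.mono fun x hx => by simp only [hx])
  have e2 : ∫ x, ψ x • g x = ∫ x, ψ x • h x :=
    integral_congr_ae (hgh.mono fun x hx => by simp only [hx])
  rw [← e1, ← e2, H ψ h1 h2]

theorem integrable_smul_grad {u : R3 → ℝ} (hu : MemL2loc u) {ψ : R3 → ℝ} (h1 : ContDiff ℝ ∞ ψ)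
    (h2 : HasCompactSupport ψ) : Integrable (fun x => u x • ∇ ψ x) := by
  have hc : Continuous (∇ ψ) :=
    (InnerProductSpace.toDual ℝ R3).symm.continuous.comp (h1.continuous_fderiv (by simp))
  have hs : HasCompactSupport (∇ ψ) :=
    (h2.fderiv (𝕜 := ℝ)).comp_left (g := (InnerProductSpace.toDual ℝ R3).symm) (map_zero _)
  exact hu.locallyIntegrable.integrable_smul_right_of_hasCompactSupport hc hs

theorem integrable_smul_of_test {g : R3 → R3} (hg : MemL2loc g) {ψ : R3 → ℝ}
    (h1 : ContDiff ℝ ∞ ψ) (h2 : HasCompactSupport ψ) : Integrable (fun x => ψ x • g x) :=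
  hg.locallyIntegrable.integrable_smul_left_of_hasCompactSupport h1.continuous h2

theorem IsWeakGrad.add {u v : R3 → ℝ} {g h : R3 → R3} (hu : MemL2loc u) (hv : MemL2loc v)
    (hg : MemL2loc g) (hh : MemL2loc h) (H : IsWeakGrad u g) (K : IsWeakGrad v h) :
    IsWeakGrad (u + v) (g + h) := by
  intro ψ h1 h2
  simp only [Pi.add_apply, add_smul, smul_add]
  rw [integral_add (integrable_smul_grad hu h1 h2) (integrable_smul_grad hv h1 h2),
    integral_add (integrable_smul_of_test hg h1 h2) (integrable_smul_of_test hh h1 h2),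
    H ψ h1 h2, K ψ h1 h2, neg_add]

theorem IsWeakGrad.smul {u : R3 → ℝ} {g : R3 → R3} (c : ℝ) (H : IsWeakGrad u g) :
    IsWeakGrad (c • u) (c • g) := by
  intro ψ h1 h2
  simp only [Pi.smul_apply, smul_assoc, smul_comm _ c]
  rw [integral_smul, integral_smul, H ψ h1 h2, smul_neg]

theorem IsWeakGrad.zero : IsWeakGrad 0 0 := by
  intro ψ _ _
  simp

theorem IsWeakGrad.unique {u : R3 → ℝ} {g h : R3 → R3} (hg : MemL2loc g) (hh : MemL2loc h)
    (H : IsWeakGrad u g) (K : IsWeakGrad u h) : g =ᵐ[volume] h := by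
  refine (ae_eq_zero_of_integral_contDiff_smul_eq_zero
    (hg.locallyIntegrable.sub hh.locallyIntegrable) fun ψ h1 h2 => ?_).mono
      fun x hx => sub_eq_zero.1 hx
  simp only [Pi.sub_apply, smul_sub]
  rw [integral_sub (integrable_smul_of_test hg h1 h2) (integrable_smul_of_test hh h1 h2),
    ← neg_inj, neg_sub, neg_zero, sub_eq_zero]
  exact neg_injective ((K ψ h1 h2).symm.trans (H ψ h1 h2))

/-- `L²_loc(ℝ³)`: classes, modulo equality almost everywhere, of locally square integrable
real functions. -/
def L2loc : Submodule ℝ (R3 →ₘ[volume] ℝ) where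
  carrier := {f | MemL2loc f}
  zero_mem' _ := (MemLp.zero).ae_eq (ae_restrict_of_ae AEEqFun.coeFn_zero.symm)
  add_mem' {f g} hf hg R := ((hf R).add (hg R)).ae_eq
    (ae_restrict_of_ae (AEEqFun.coeFn_add f g).symm)
  smul_mem' c f hf R := ((hf R).const_smul c).ae_eq
    (ae_restrict_of_ae (AEEqFun.coeFn_smul c f).symm)

/-- `H¹_loc(ℝ³)`: classes of locally square integrable real functions whose distributional
gradient is a locally square integrable function. -/
def H1loc : Submodule ℝ (R3 →ₘ[volume] ℝ) where
  carrier := {f | MemL2loc f ∧ ∃ g : R3 →ₘ[volume] R3, MemL2loc g ∧ IsWeakGrad f g}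
  zero_mem' := ⟨L2loc.zero_mem, 0,
    fun R => (MemLp.zero).ae_eq (ae_restrict_of_ae AEEqFun.coeFn_zero.symm),
    IsWeakGrad.zero.congr AEEqFun.coeFn_zero.symm AEEqFun.coeFn_zero.symm⟩
  add_mem' := by
    rintro f f' ⟨hf, g, hg, H⟩ ⟨hf', g', hg', H'⟩
    exact ⟨L2loc.add_mem hf hf', g + g', fun R => ((hg R).add (hg' R)).ae_eq
      (ae_restrict_of_ae (AEEqFun.coeFn_add g g').symm),
      (H.add hf hf' hg hg' H').congr (AEEqFun.coeFn_add f f').symm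
        (AEEqFun.coeFn_add g g').symm⟩
  smul_mem' := by
    rintro c f ⟨hf, g, hg, H⟩
    exact ⟨L2loc.smul_mem c hf, c • g, fun R => ((hg R).const_smul c).ae_eq
      (ae_restrict_of_ae (AEEqFun.coeFn_smul c g).symm),
      (H.smul c).congr (AEEqFun.coeFn_smul c f).symm (AEEqFun.coeFn_smul c g).symm⟩

/-- The weak gradient of an element of `H¹_loc`. -/
def weakGrad (u : H1loc) : R3 →ₘ[volume] R3 := u.2.2.choose

theorem memL2loc_weakGrad (u : H1loc) : MemL2loc (weakGrad u) := u.2.2.choose_spec.1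

theorem isWeakGrad_weakGrad (u : H1loc) : IsWeakGrad u.1 (weakGrad u) := u.2.2.choose_spec.2

theorem weakGrad_eq {u : H1loc} {g : R3 → R3} (hg : MemL2loc g) (h : IsWeakGrad u.1 g) :
    weakGrad u =ᵐ[volume] g :=
  (isWeakGrad_weakGrad u).unique (memL2loc_weakGrad u) hg h

theorem weakGrad_add (u v : H1loc) :
    weakGrad (u + v) =ᵐ[volume] ⇑(weakGrad u) + ⇑(weakGrad v) :=
  weakGrad_eq (fun R => (memL2loc_weakGrad u R).add (memL2loc_weakGrad v R))
    (((isWeakGrad_weakGrad u).add u.2.1 v.2.1 (memL2loc_weakGrad u) (memL2loc_weakGrad v)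
      (isWeakGrad_weakGrad v)).congr (AEEqFun.coeFn_add u.1 v.1).symm Filter.EventuallyEq.rfl)

theorem weakGrad_smul (c : ℝ) (u : H1loc) :
    weakGrad (c • u) =ᵐ[volume] c • ⇑(weakGrad u) :=
  weakGrad_eq (fun R => (memL2loc_weakGrad u R).const_smul c)
    (((isWeakGrad_weakGrad u).smul c).congr (AEEqFun.coeFn_smul c u.1).symm
      Filter.EventuallyEq.rfl)

/-! ### The phase space -/

/-- The phase space: quadruples `(φ, π, q, p)` with `φ ∈ H¹_loc(ℝ³; ℝᵈ)`, `π ∈ L²_loc(ℝ³; ℝᵈ)` and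
`q, p ∈ ℝ³`. -/
def PhaseSpace (d : ℕ) : Type := (Fin d → H1loc) × (Fin d → L2loc) × R3 × R3

namespace PhaseSpace

variable {d : ℕ}

instance : AddCommGroup (PhaseSpace d) :=
  inferInstanceAs (AddCommGroup ((Fin d → H1loc) × (Fin d → L2loc) × R3 × R3))

instance : Module ℝ (PhaseSpace d) :=
  inferInstanceAs (Module ℝ ((Fin d → H1loc) × (Fin d → L2loc) × R3 × R3))

/-- The `n`-th component of the field. -/
def phi (Y : PhaseSpace d) (n : Fin d) : R3 → ℝ := (Y.1 n : R3 →ₘ[volume] ℝ)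

/-- The weak gradient of the `n`-th component of the field. -/
def gradPhi (Y : PhaseSpace d) (n : Fin d) : R3 → R3 := weakGrad (Y.1 n)

/-- The `n`-th component of the canonical momentum of the field. -/
def mom (Y : PhaseSpace d) (n : Fin d) : R3 → ℝ := (Y.2.1 n : R3 →ₘ[volume] ℝ)

/-- The position of the particle. -/
def pos (Y : PhaseSpace d) : R3 := Y.2.2.1

/-- The momentum of the particle. -/
def imp (Y : PhaseSpace d) : R3 := Y.2.2.2

/-- The squared local energy seminorm
`‖Y‖²_R = ∫_{|x|<R} (|φ(x)|² + |∇φ(x)|² + |π(x)|²) dx + |q|² + |p|²`. -/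
def localEnergy (R : ℝ) (Y : PhaseSpace d) : ℝ :=
  (∫ x in Metric.ball (0 : R3) R,
      ∑ n, (Y.phi n x ^ 2 + ‖Y.gradPhi n x‖ ^ 2 + Y.mom n x ^ 2)) +
    ‖Y.pos‖ ^ 2 + ‖Y.imp‖ ^ 2

/-- The symmetric bilinear form whose quadratic form is `localEnergy R`. -/
def localInner (R : ℝ) (Y Z : PhaseSpace d) : ℝ :=
  (∫ x in Metric.ball (0 : R3) R,
      ∑ n, (Y.phi n x * Z.phi n x + inner ℝ (Y.gradPhi n x) (Z.gradPhi n x) +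
        Y.mom n x * Z.mom n x)) +
    inner ℝ Y.pos Z.pos + inner ℝ Y.imp Z.imp

theorem localInner_self (R : ℝ) (Y : PhaseSpace d) : localInner R Y Y = localEnergy R Y := by
  simp only [localInner, localEnergy, real_inner_self_eq_norm_sq, pow_two]

theorem memL2loc_phi (Y : PhaseSpace d) (n : Fin d) : MemL2loc (Y.phi n) := (Y.1 n).2.1

theorem memL2loc_gradPhi (Y : PhaseSpace d) (n : Fin d) : MemL2loc (Y.gradPhi n) :=
  memL2loc_weakGrad _

theorem memL2loc_mom (Y : PhaseSpace d) (n : Fin d) : MemL2loc (Y.mom n) := (Y.2.1 n).2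

theorem integrable_inner_of_memLp {μ : Measure R3} {g h : R3 → R3} (hg : MemLp g 2 μ)
    (hh : MemLp h 2 μ) : Integrable (fun x => inner ℝ (g x) (h x)) μ :=
  (hg.norm.integrable_mul hh.norm).mono' (hg.1.inner hh.1)
    (Filter.Eventually.of_forall fun x => norm_inner_le_norm (g x) (h x))

theorem integrable_localInner (R : ℝ) (Y Z : PhaseSpace d) :
    Integrable (fun x => ∑ n, (Y.phi n x * Z.phi n x +
      inner ℝ (Y.gradPhi n x) (Z.gradPhi n x) + Y.mom n x * Z.mom n x))
      (volume.restrict (Metric.ball (0 : R3) R)) :=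
  integrable_finsetSum _ fun n _ =>
    (((Y.memL2loc_phi n R).integrable_mul (Z.memL2loc_phi n R)).add
      (integrable_inner_of_memLp (Y.memL2loc_gradPhi n R) (Z.memL2loc_gradPhi n R))).add
      ((Y.memL2loc_mom n R).integrable_mul (Z.memL2loc_mom n R))

theorem phi_add (Y Z : PhaseSpace d) (n : Fin d) :
    (Y + Z).phi n =ᵐ[volume] Y.phi n + Z.phi n := AEEqFun.coeFn_add _ _

theorem gradPhi_add (Y Z : PhaseSpace d) (n : Fin d) :
    (Y + Z).gradPhi n =ᵐ[volume] Y.gradPhi n + Z.gradPhi n := weakGrad_add _ _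

theorem mom_add (Y Z : PhaseSpace d) (n : Fin d) :
    (Y + Z).mom n =ᵐ[volume] Y.mom n + Z.mom n := AEEqFun.coeFn_add _ _

theorem phi_smul (c : ℝ) (Y : PhaseSpace d) (n : Fin d) :
    (c • Y).phi n =ᵐ[volume] c • Y.phi n := AEEqFun.coeFn_smul _ _

theorem gradPhi_smul (c : ℝ) (Y : PhaseSpace d) (n : Fin d) :
    (c • Y).gradPhi n =ᵐ[volume] c • Y.gradPhi n := weakGrad_smul _ _

theorem mom_smul (c : ℝ) (Y : PhaseSpace d) (n : Fin d) :
    (c • Y).mom n =ᵐ[volume] c • Y.mom n := AEEqFun.coeFn_smul _ _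

theorem pos_add (Y Z : PhaseSpace d) : (Y + Z).pos = Y.pos + Z.pos := rfl

theorem imp_add (Y Z : PhaseSpace d) : (Y + Z).imp = Y.imp + Z.imp := rfl

theorem pos_smul (c : ℝ) (Y : PhaseSpace d) : (c • Y).pos = c • Y.pos := rfl

theorem imp_smul (c : ℝ) (Y : PhaseSpace d) : (c • Y).imp = c • Y.imp := rfl

theorem localInner_add (R : ℝ) (X Y Z : PhaseSpace d) :
    localInner R (X + Y) Z = localInner R X Z + localInner R Y Z := by
  simp only [localInner, pos_add, imp_add, inner_add_left]
  have h : ∀ᵐ x ∂(volume.restrict (Metric.ball (0 : R3) R)),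
      ∑ n, ((X + Y).phi n x * Z.phi n x +
        inner ℝ ((X + Y).gradPhi n x) (Z.gradPhi n x) + (X + Y).mom n x * Z.mom n x) =
      ∑ n, (X.phi n x * Z.phi n x +
        inner ℝ (X.gradPhi n x) (Z.gradPhi n x) + X.mom n x * Z.mom n x) +
      ∑ n, (Y.phi n x * Z.phi n x +
        inner ℝ (Y.gradPhi n x) (Z.gradPhi n x) + Y.mom n x * Z.mom n x) := by
    apply ae_restrict_of_ae
    filter_upwards [ae_all_iff.2 (phi_add X Y), ae_all_iff.2 (gradPhi_add X Y),
      ae_all_iff.2 (mom_add X Y)] with x h1 h2 h3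
    rw [← Finset.sum_add_distrib]
    refine Finset.sum_congr rfl fun n _ => ?_
    rw [h1, h2, h3]
    simp only [Pi.add_apply, inner_add_left]
    ring
  rw [integral_congr_ae h,
    integral_add (integrable_localInner R X Z) (integrable_localInner R Y Z)]
  ring

theorem localInner_smul (R : ℝ) (c : ℝ) (Y Z : PhaseSpace d) :
    localInner R (c • Y) Z = c * localInner R Y Z := by
  simp only [localInner, pos_smul, imp_smul, real_inner_smul_left]
  have h : ∀ᵐ x ∂(volume.restrict (Metric.ball (0 : R3) R)),
      ∑ n, ((c • Y).phi n x * Z.phi n x +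
        inner ℝ ((c • Y).gradPhi n x) (Z.gradPhi n x) + (c • Y).mom n x * Z.mom n x) =
      c * ∑ n, (Y.phi n x * Z.phi n x +
        inner ℝ (Y.gradPhi n x) (Z.gradPhi n x) + Y.mom n x * Z.mom n x) := by
    apply ae_restrict_of_ae
    filter_upwards [ae_all_iff.2 (phi_smul c Y), ae_all_iff.2 (gradPhi_smul c Y),
      ae_all_iff.2 (mom_smul c Y)] with x h1 h2 h3
    rw [Finset.mul_sum]
    refine Finset.sum_congr rfl fun n _ => ?_
    rw [h1, h2, h3]
    simp only [Pi.smul_apply, real_inner_smul_left, smul_eq_mul]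
    ring
  rw [integral_congr_ae h, integral_const_mul]
  ring

theorem localEnergy_nonneg (R : ℝ) (Y : PhaseSpace d) : 0 ≤ localEnergy R Y := by
  unfold localEnergy
  have : 0 ≤ ∫ x in Metric.ball (0 : R3) R,
      ∑ n, (Y.phi n x ^ 2 + ‖Y.gradPhi n x‖ ^ 2 + Y.mom n x ^ 2) :=
    integral_nonneg fun x => Finset.sum_nonneg fun n _ => by positivity
  positivity

/-- `localInner R` as a (degenerate) inner product. -/
abbrev localCore (d : ℕ) (R : ℝ) : PreInnerProductSpace.Core ℝ (PhaseSpace d) where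
  inner := localInner R
  conj_inner_symm Y Z := by
    simp only [localInner, conj_trivial, mul_comm, real_inner_comm]
  re_inner_nonneg Y := by
    simpa [localInner_self] using localEnergy_nonneg R Y
  add_left := localInner_add R
  smul_left Y Z c := by simpa using localInner_smul R c Y Z

/-- The local energy seminorm `‖Y‖_R`. -/
def localSeminorm (d : ℕ) (R : ℝ) : Seminorm ℝ (PhaseSpace d) :=
  Seminorm.of (fun Y => √(localEnergy R Y))
    (fun Y Z => by
      let c := localCore d R
      let i := InnerProductSpace.Core.toSeminormedAddCommGroup (c := c)
      have h := norm_add_le Y Z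
      have hn : ∀ W : PhaseSpace d, ‖W‖ = √(localEnergy R W) := fun W => by
        rw [← localInner_self]
        rfl
      simpa only [hn] using h)
    (fun c Y => by
      have h : localEnergy R (c • Y) = c ^ 2 * localEnergy R Y := by
        have hs : localInner R Y (c • Y) = localInner R (c • Y) Y := by
          simp only [localInner, mul_comm, real_inner_comm]
        rw [← localInner_self, ← localInner_self, localInner_smul, hs, localInner_smul]
        ring
      rw [h, Real.sqrt_mul (sq_nonneg c), Real.sqrt_sq_eq_abs, Real.norm_eq_abs])

/-- The family of the local energy seminorms `‖·‖_R`, `R > 0`. -/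
def localSeminormFamily (d : ℕ) : SeminormFamily ℝ (PhaseSpace d) (Set.Ioi (0 : ℝ)) :=
  fun R => localSeminorm d R

/-- The phase space carries the locally convex topology of the local energy seminorms. -/
instance : TopologicalSpace (PhaseSpace d) := (localSeminormFamily d).moduleFilterBasis.topology

theorem withSeminorms (d : ℕ) : WithSeminorms (localSeminormFamily d) := ⟨rfl⟩

end PhaseSpace

/-! ### The coupled system -/

variable {d : ℕ}

/-- `Y` solves the coupled system
`φ̇ₙ = πₙ`, `π̇ₙ = (Δ - mₙ²) φₙ - q · ∇ρₙ`, `q̇ = p`, `ṗ = -ω₀² q - ∑ₙ ∫ φₙ ∇ρₙ dx` at all times.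
The field equations hold in the sense of distributions in `x`, that is, after pairing with an
arbitrary test function `ψ`. -/
structure IsSolution (m : Fin d → ℝ) (ω₀ : ℝ) (ρ : Fin d → R3 → ℝ) (Y : ℝ → PhaseSpace d) :
    Prop where
  phi_eq : ∀ (n : Fin d) (ψ : R3 → ℝ), ContDiff ℝ ∞ ψ → HasCompactSupport ψ → ∀ t : ℝ,
    HasDerivAt (fun s => ∫ x, (Y s).phi n x * ψ x) (∫ x, (Y t).mom n x * ψ x) t
  mom_eq : ∀ (n : Fin d) (ψ : R3 → ℝ), ContDiff ℝ ∞ ψ → HasCompactSupport ψ → ∀ t : ℝ,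
    HasDerivAt (fun s => ∫ x, (Y s).mom n x * ψ x)
      ((∫ x, (Y t).phi n x * (Δ ψ x - m n ^ 2 * ψ x)) -
        ∫ x, inner ℝ (Y t).pos (∇ (ρ n) x) * ψ x) t
  pos_eq : ∀ t : ℝ, HasDerivAt (fun s => (Y s).pos) (Y t).imp t
  imp_eq : ∀ t : ℝ, HasDerivAt (fun s => (Y s).imp)
    (-(ω₀ ^ 2) • (Y t).pos - ∑ n, ∫ x, (Y t).phi n x • ∇ (ρ n) x) t

/-- The Fourier transform `ρ̂(k) = ∫ e^{ik·x} ρ(x) dx`. -/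
def fourierHat (ρ : R3 → ℝ) (k : R3) : ℂ :=
  ∫ x, Complex.exp (Complex.I * (inner ℝ k x : ℝ)) * (ρ x : ℂ)

/-- The matrix `K₀` with the entries
`∑ₙ (2π)⁻³ ∫ kᵢ kⱼ |ρ̂ₙ(k)|² / (|k|² + mₙ²) dk`. -/
def couplingMatrix (m : Fin d → ℝ) (ρ : Fin d → R3 → ℝ) : Matrix (Fin 3) (Fin 3) ℝ :=
  Matrix.of fun i j => ∑ n, 1 / (2 * Real.pi) ^ 3 *
    ∫ k : R3, k i * k j * ‖fourierHat (ρ n) k‖ ^ 2 / (‖k‖ ^ 2 + m n ^ 2)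

/-- The stability condition: `ω₀² I - K₀` is positive definite. -/
def StabilityCondition (m : Fin d → ℝ) (ω₀ : ℝ) (ρ : Fin d → R3 → ℝ) : Prop :=
  (ω₀ ^ 2 • (1 : Matrix (Fin 3) (Fin 3) ℝ) - couplingMatrix m ρ).PosDef

/-- The coupling function is smooth, even and vanishes for `|x| ≥ Rρ`. -/
structure CouplingCondition (ρ : Fin d → R3 → ℝ) (Rρ : ℝ) : Prop where
  smooth : ∀ n, ContDiff ℝ ∞ (ρ n)
  even : ∀ n x, ρ n (-x) = ρ n x
  vanish : ∀ n x, Rρ ≤ ‖x‖ → ρ n x = 0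

end FieldParticle

end

noncomputable section

namespace FieldParticle

open MeasureTheory Filter Topology
open scoped ContDiff Gradient Laplacian ENNReal

/-! For a prescribed trajectory q every field component solves a Klein–Gordon equation with the
compactly supported source q·∇ρₙ, and the field acts back on the particle only through the vectors ∫
φₙ∇ρₙ. The Klein–Gordon equation propagates with speed one, so all estimates can be localized to
balls.

The central estimate is `IsKG.energy_le`: the field energy in |x| < R at time t ≥ 0 is at most
e^{(2+m²)t} times the sum of the initial energy in |x| < R + t and the time integral of a bound for
the squared L² norm of the source. For classical solutions one differentiates the energy weighted by
a smooth cutoff of the backward light cone. The cutoff decreases in time at least as fast as energy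
can flow outwards (`coneSlope_flux_le`), so only zeroth-order terms survive and Grönwall's argument
applies (`RegularSolution.coneEnergy_le`). Weak solutions become classical after mollification in x
(`IsKG.regular`), and the radii are adjusted in the limit. Negative times follow by time reversal.

Solutions of the forced field equation are explicit in Fourier space for test data (`IsMode.isKG`,
`isMode_forcedMode`). General data of finite local energy are approximated on growing balls; by the
energy inequality the approximate solutions are Cauchy on every ball, uniformly for bounded times
(`exists_isKG`).

Substituting the field generated by q into the particle equations leaves an equation ż = B z for z =
(q, p) in ℝ⁶. Here B z t depends in a Lipschitz way on z over [-|t|, |t|] (`norm_force_sub_le`), so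
Picard iteration converges for all times (`CausalLipschitz.exists_fixedPoint`, `exists_isCoupled`).

Finally, a Grönwall argument that couples the field inequality to the particle equations bounds the
full local energy (`IsCoupled.energy_le`). Applied to one solution this is the asserted bound;
applied to a difference of two solutions it gives uniqueness and the continuity of U(t). -/

section

/-! ### Local `L²` norms -/

/-- The norm of `L²` of the ball of radius `R`. -/
def l2norm (R : ℝ) (f : R3 → ℝ) : ℝ :=
  (eLpNorm f 2 (volume.restrict (Metric.ball (0 : R3) R))).toReal

theorem l2norm_nonneg (R : ℝ) (f : R3 → ℝ) : 0 ≤ l2norm R f := ENNReal.toReal_nonneg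

instance isFiniteMeasure_restrict_ball (R : ℝ) :
    IsFiniteMeasure (volume.restrict (Metric.ball (0 : R3) R)) :=
  ⟨by simpa using measure_ball_lt_top (μ := (volume : Measure R3)) (x := 0)⟩

theorem MemL2loc.add {f g : R3 → ℝ} (hf : MemL2loc f) (hg : MemL2loc g) :
    MemL2loc (fun x => f x + g x) := fun R => (hf R).add (hg R)

theorem MemL2loc.sub {f g : R3 → ℝ} (hf : MemL2loc f) (hg : MemL2loc g) :
    MemL2loc (fun x => f x - g x) := fun R => (hf R).sub (hg R)

theorem MemL2loc.const_mul {f : R3 → ℝ} (hf : MemL2loc f) (c : ℝ) :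
    MemL2loc (fun x => c * f x) := fun R => (hf R).const_mul c

theorem MemL2loc.zero : MemL2loc (fun _ : R3 => (0 : ℝ)) := fun _ => MemLp.zero'

theorem memL2loc_of_continuous {f : R3 → ℝ} (hf : Continuous f) : MemL2loc f := by
  intro R
  obtain ⟨C, hC⟩ := (isCompact_closedBall (0 : R3) R).exists_bound_of_continuousOn hf.continuousOn
  refine MemLp.of_bound hf.aestronglyMeasurable C ?_
  filter_upwards [ae_restrict_mem measurableSet_ball] with x hx
  exact hC x (Metric.ball_subset_closedBall hx)

theorem MemL2loc.integrableOn_sq {f : R3 → ℝ} (hf : MemL2loc f) (R : ℝ) :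
    IntegrableOn (fun x => f x ^ 2) (Metric.ball 0 R) := (hf R).integrable_sq

theorem l2norm_sq {f : R3 → ℝ} (hf : MemL2loc f) (R : ℝ) :
    l2norm R f ^ 2 = ∫ x in Metric.ball 0 R, f x ^ 2 := by
  rw [l2norm, (hf R).eLpNorm_eq_integral_rpow_norm (by simp) (by simp),
    ENNReal.toReal_ofReal (by positivity)]
  simp only [ENNReal.toReal_ofNat, Real.rpow_two, Real.norm_eq_abs, sq_abs]
  rw [← Real.rpow_natCast, ← Real.rpow_mul (integral_nonneg fun x => sq_nonneg _)]
  norm_num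

theorem l2norm_congr {f g : R3 → ℝ} (h : f =ᵐ[volume] g) (R : ℝ) : l2norm R f = l2norm R g := by
  rw [l2norm, l2norm, eLpNorm_congr_ae (ae_restrict_of_ae h)]

theorem l2norm_add_le {f g : R3 → ℝ} (hf : MemL2loc f) (hg : MemL2loc g) (R : ℝ) :
    l2norm R (fun x => f x + g x) ≤ l2norm R f + l2norm R g := by
  rw [l2norm, l2norm, l2norm, ← ENNReal.toReal_add (hf R).2.ne (hg R).2.ne]
  exact ENNReal.toReal_mono (ENNReal.add_ne_top.2 ⟨(hf R).2.ne, (hg R).2.ne⟩)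
    (eLpNorm_add_le (hf R).1 (hg R).1 (by norm_num))

theorem l2norm_neg (f : R3 → ℝ) (R : ℝ) : l2norm R (fun x => -f x) = l2norm R f := by
  rw [l2norm, l2norm, ← eLpNorm_neg]
  congr 2
  ext x; simp

theorem l2norm_sub_comm (f g : R3 → ℝ) (R : ℝ) :
    l2norm R (fun x => f x - g x) = l2norm R (fun x => g x - f x) := by
  rw [← l2norm_neg]; simp

theorem l2norm_const_mul (c : ℝ) (f : R3 → ℝ) (R : ℝ) :
    l2norm R (fun x => c * f x) = |c| * l2norm R f := by
  have : (fun x => c * f x) = c • f := rfl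
  rw [l2norm, l2norm, this, eLpNorm_const_smul, ENNReal.toReal_mul]
  simp

theorem l2norm_triangle {f g h : R3 → ℝ} (hf : MemL2loc f) (hg : MemL2loc g) (hh : MemL2loc h)
    (R : ℝ) : l2norm R (fun x => f x - h x) ≤
      l2norm R (fun x => f x - g x) + l2norm R (fun x => g x - h x) := by
  simpa using l2norm_add_le (hf.sub hg) (hg.sub hh) R

theorem abs_l2norm_sub_le {f g : R3 → ℝ} (hf : MemL2loc f) (hg : MemL2loc g) (R : ℝ) :
    |l2norm R f - l2norm R g| ≤ l2norm R (fun x => f x - g x) := by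
  rw [abs_sub_le_iff]
  constructor
  · have := l2norm_add_le (hf.sub hg) hg R
    simp only [sub_add_cancel] at this
    linarith
  · have := l2norm_add_le (hg.sub hf) hf R
    simp only [sub_add_cancel] at this
    rw [l2norm_sub_comm]
    linarith

theorem l2norm_mono {f : R3 → ℝ} (hf : MemL2loc f) {r R : ℝ} (h : r ≤ R) :
    l2norm r f ≤ l2norm R f :=
  ENNReal.toReal_mono (hf R).2.ne
    (eLpNorm_mono_measure _ (Measure.restrict_mono (Metric.ball_subset_ball h) le_rfl))

theorem l2norm_eq_zero_of_nonpos {R : ℝ} (hR : R ≤ 0) (f : R3 → ℝ) : l2norm R f = 0 := by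
  simp [l2norm, Metric.ball_eq_empty.2 hR]

theorem l2norm_zero (R : ℝ) : l2norm R (fun _ => 0) = 0 := by simp [l2norm]

theorem l2norm_congr_on {f g : R3 → ℝ} {R : ℝ} (h : ∀ x ∈ Metric.ball (0 : R3) R, f x = g x) :
    l2norm R f = l2norm R g := by
  rw [l2norm, l2norm, eLpNorm_congr_ae]
  filter_upwards [ae_restrict_mem measurableSet_ball] with x hx using h x hx

theorem l2norm_le_of_bound {f : R3 → ℝ} {R C : ℝ} (hC : 0 ≤ C)
    (h : ∀ x ∈ Metric.ball (0 : R3) R, |f x| ≤ C) :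
    l2norm R f ≤ C * √(volume.real (Metric.ball (0 : R3) R)) := by
  have : ∀ᵐ x ∂(volume.restrict (Metric.ball (0 : R3) R)), ‖f x‖ ≤ C := by
    filter_upwards [ae_restrict_mem measurableSet_ball] with x hx using h x hx
  have h1 := eLpNorm_le_of_ae_bound (p := 2) this
  have h2 := ENNReal.toReal_mono (ENNReal.mul_ne_top (ENNReal.rpow_ne_top_of_nonneg (by positivity)
    (measure_ne_top _ _)) ENNReal.ofReal_ne_top) h1
  rw [l2norm]
  refine h2.trans (le_of_eq ?_)
  rw [ENNReal.toReal_mul, ENNReal.toReal_ofReal hC, ← ENNReal.toReal_rpow,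
    Measure.restrict_apply_univ, Real.sqrt_eq_rpow, mul_comm, Measure.real]
  norm_num

/-- The Cauchy–Schwarz inequality on a ball that contains the support of one factor. -/
theorem abs_integral_mul_le {f ψ : R3 → ℝ} (hf : MemL2loc f) (hψ : MemL2loc ψ) {R : ℝ}
    (h : ∀ x, R ≤ ‖x‖ → ψ x = 0) : |∫ x, f x * ψ x| ≤ l2norm R f * l2norm R ψ := by
  have e : ∫ x, f x * ψ x = ∫ x in Metric.ball 0 R, f x * ψ x := by
    refine (setIntegral_eq_integral_of_forall_compl_eq_zero fun x hx => ?_).symm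
    rw [h x (by simpa using hx), mul_zero]
  rw [e]
  have hpq : (2 : ℝ).HolderConjugate 2 := Real.HolderConjugate.two_two
  have h0 : |∫ x in Metric.ball 0 R, f x * ψ x| ≤ ∫ x in Metric.ball 0 R, |f x| * |ψ x| := by
    simpa only [abs_mul] using abs_integral_le_integral_abs (f := fun x => f x * ψ x)
      (μ := volume.restrict (Metric.ball (0 : R3) R))
  have h1 := integral_mul_le_Lp_mul_Lq_of_nonneg hpq (μ := volume.restrict (Metric.ball (0 : R3) R))
    (f := fun x => |f x|) (g := fun x => |ψ x|) (Eventually.of_forall fun x => abs_nonneg _)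
    (Eventually.of_forall fun x => abs_nonneg _) (by simpa using (hf R).norm)
    (by simpa using (hψ R).norm)
  refine h0.trans (h1.trans (le_of_eq ?_))
  simp only [Real.rpow_two, sq_abs]
  rw [← l2norm_sq hf, ← l2norm_sq hψ, ← Real.sqrt_eq_rpow, ← Real.sqrt_eq_rpow,
    Real.sqrt_sq (l2norm_nonneg _ _), Real.sqrt_sq (l2norm_nonneg _ _)]

theorem exists_radius_of_hasCompactSupport {ψ : R3 → ℝ} (h : HasCompactSupport ψ) :
    ∃ R : ℝ, 0 < R ∧ ∀ x, R ≤ ‖x‖ → ψ x = 0 := by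
  obtain ⟨R, hR, h2⟩ := h.isCompact.isBounded.subset_ball_lt 0 (0 : R3)
  refine ⟨R, hR, fun x hx => ?_⟩
  by_contra hne
  have := h2 (subset_tsupport _ hne)
  simp at this
  linarith

theorem MemL2loc.integrable_mul {f ψ : R3 → ℝ} (hf : MemL2loc f) (hψ : Continuous ψ)
    (h : HasCompactSupport ψ) : Integrable (fun x => f x * ψ x) :=
  hf.locallyIntegrable.integrable_smul_right_of_hasCompactSupport hψ h

/-- Continuity of a curve with values in `L²_loc`. -/
structure L2Cont (f : ℝ → R3 → ℝ) : Prop where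
  mem : ∀ t, MemL2loc (f t)
  tendsto : ∀ t R, Tendsto (fun s => l2norm R (fun x => f s x - f t x)) (𝓝 t) (𝓝 0)

/-! ### Operations on continuous curves in `L²_loc`. -/

namespace L2Cont

variable {f g : ℝ → R3 → ℝ}

theorem const {a : R3 → ℝ} (ha : MemL2loc a) : L2Cont (fun _ => a) :=
  ⟨fun _ => ha, fun _ R => by simp [l2norm_zero]⟩

theorem add (hf : L2Cont f) (hg : L2Cont g) : L2Cont (fun t x => f t x + g t x) := by
  refine ⟨fun t => (hf.mem t).add (hg.mem t), fun t R => ?_⟩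
  refine squeeze_zero (fun s => l2norm_nonneg _ _) (fun s => ?_)
    (by simpa using (hf.tendsto t R).add (hg.tendsto t R))
  have := l2norm_add_le ((hf.mem s).sub (hf.mem t)) ((hg.mem s).sub (hg.mem t)) R
  refine le_trans (le_of_eq ?_) this
  congr 1; ext x; ring

theorem smul (hf : L2Cont f) {c : ℝ → ℝ} (hc : Continuous c) :
    L2Cont (fun t x => c t * f t x) := by
  refine ⟨fun t => (hf.mem t).const_mul _, fun t R => ?_⟩
  -- Based on c(s) f(s) - c(t) f(t) = c(s) (f(s) - f(t)) + (c(s) - c(t)) f(t).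
  have h1 : Tendsto (fun s => |c s| * l2norm R (fun x => f s x - f t x) +
      |c s - c t| * l2norm R (f t)) (𝓝 t) (𝓝 0) := by
    have a1 := (hc.abs.tendsto t).mul (hf.tendsto t R)
    have a2 := (((hc.sub continuous_const).abs.tendsto t).mul_const (l2norm R (f t)) :
      Tendsto (fun s => |c s - c t| * _) _ _)
    simpa using a1.add a2
  refine squeeze_zero (fun s => l2norm_nonneg _ _) (fun s => ?_) h1
  rw [← l2norm_const_mul, ← l2norm_const_mul]
  refine le_trans (le_of_eq ?_) (l2norm_add_le (((hf.mem s).sub (hf.mem t)).const_mul (c s))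
    ((hf.mem t).const_mul (c s - c t)) R)
  congr 1; ext x; ring

theorem comp (hf : L2Cont f) {c : ℝ → ℝ} (hc : Continuous c) : L2Cont (fun t => f (c t)) :=
  ⟨fun _ => hf.mem _, fun t R => (hf.tendsto (c t) R).comp (hc.tendsto t)⟩

end L2Cont

/-! ### Test functions -/

/-- `ψ` is smooth with compact support. -/
structure IsTest (ψ : R3 → ℝ) : Prop where
  smooth : ContDiff ℝ ∞ ψ
  supp : HasCompactSupport ψ

/-- The `i`-th partial derivative. -/
def pd (i : Fin 3) (ψ : R3 → ℝ) (x : R3) : ℝ := fderiv ℝ ψ x (EuclideanSpace.single i 1)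

theorem IsTest.pd {ψ : R3 → ℝ} (h : IsTest ψ) (i : Fin 3) : IsTest (pd i ψ) := by
  refine ⟨?_, h.supp.fderiv_apply (𝕜 := ℝ) _⟩
  exact (h.smooth.fderiv_right (m := ∞) (by simp)).clm_apply contDiff_const

theorem IsTest.continuous {ψ : R3 → ℝ} (h : IsTest ψ) : Continuous ψ := h.smooth.continuous

theorem IsTest.memL2loc {ψ : R3 → ℝ} (h : IsTest ψ) : MemL2loc ψ :=
  memL2loc_of_continuous h.continuous

theorem gradient_apply (ψ : R3 → ℝ) (x : R3) (i : Fin 3) : (∇ ψ x) i = pd i ψ x := by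
  have : (∇ ψ x) i = inner ℝ (∇ ψ x) (EuclideanSpace.single i (1 : ℝ)) := by
    rw [EuclideanSpace.inner_single_right, one_mul]
    rfl
  rw [this, inner_gradient_left, pd]

theorem laplacian_eq_sum {ψ : R3 → ℝ} (h : IsTest ψ) (x : R3) :
    Δ ψ x = ∑ i, pd i (pd i ψ) x := by
  rw [InnerProductSpace.laplacian_eq_iteratedFDeriv_orthonormalBasis ψ
    (EuclideanSpace.basisFun (Fin 3) ℝ)]
  refine Finset.sum_congr rfl fun i _ => ?_
  rw [iteratedFDeriv_two_apply]
  simp only [EuclideanSpace.basisFun_apply, Matrix.cons_val_zero, Matrix.cons_val_one]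
  unfold FieldParticle.pd
  have hd : DifferentiableAt ℝ (fderiv ℝ ψ) x :=
    ((h.smooth.fderiv_right (m := ∞) (by simp)).differentiable (by simp)).differentiableAt
  rw [fderiv_clm_apply hd (differentiableAt_const _)]
  simp

theorem IsTest.laplacian {ψ : R3 → ℝ} (h : IsTest ψ) : IsTest (Δ ψ) := by
  have e : Δ ψ = fun x => ∑ i, FieldParticle.pd i (FieldParticle.pd i ψ) x :=
    funext (laplacian_eq_sum h)
  rw [e]
  refine ⟨ContDiff.sum fun i _ => ((h.pd i).pd i).smooth, ?_⟩
  simp only [Fin.sum_univ_three]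
  exact (((h.pd 0).pd 0).supp.add ((h.pd 1).pd 1).supp).add ((h.pd 2).pd 2).supp

theorem IsTest.reflect {η : R3 → ℝ} (h : IsTest η) (x : R3) : IsTest (fun y => η (x - y)) :=
  ⟨h.smooth.comp (contDiff_const.sub contDiff_id),
    h.supp.comp_homeomorph (Homeomorph.subLeft x)⟩

theorem pd_reflect {η : R3 → ℝ} (h : IsTest η) (x : R3) (i : Fin 3) :
    pd i (fun y => η (x - y)) = fun y => -pd i η (x - y) := by
  ext y
  have h1 : HasFDerivAt (fun y => η (x - y)) ((fderiv ℝ η (x - y)).comp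
      (-ContinuousLinearMap.id ℝ R3)) y :=
    ((h.smooth.differentiable (by simp)).differentiableAt.hasFDerivAt).comp y
      ((hasFDerivAt_id y).const_sub x)
  rw [pd, h1.fderiv]
  simp [pd]

/-- Two sign changes cancel. This is what turns a weak equation tested against `η (x - ·)` into a
pointwise equation for the convolution with `η`. -/
theorem laplacian_reflect {η : R3 → ℝ} (h : IsTest η) (x : R3) :
    Δ (fun y => η (x - y)) = fun y => ∑ i, pd i (pd i η) (x - y) := by
  ext y
  rw [laplacian_eq_sum (h.reflect x)]
  refine Finset.sum_congr rfl fun i _ => ?_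
  rw [pd_reflect h]
  have := pd_reflect (h.pd i) x i
  have e2 : pd i (fun y => -pd i η (x - y)) y = - pd i (fun y => pd i η (x - y)) y := by
    unfold pd
    rw [fderiv_fun_neg]
    rfl
  rw [e2, this]
  simp

end

section

/-! ### Mollification -/

/-- The convolution `f * η`. -/
def conv (f η : R3 → ℝ) (x : R3) : ℝ := ∫ y, f y * η (x - y)

theorem conv_eq_convolution (f η : R3 → ℝ) :
    conv f η = convolution f η (ContinuousLinearMap.mul ℝ ℝ) volume := rfl

theorem contDiff_conv {f η : R3 → ℝ} (hf : MemL2loc f) (hη : IsTest η) :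
    ContDiff ℝ ∞ (conv f η) := by
  rw [conv_eq_convolution]
  exact hη.supp.contDiff_convolution_right _ hf.locallyIntegrable hη.smooth

theorem pd_conv {f η : R3 → ℝ} (hf : MemL2loc f) (hη : IsTest η) (i : Fin 3) :
    pd i (conv f η) = conv f (pd i η) := by
  ext x
  have h := hη.supp.hasFDerivAt_convolution_right (ContinuousLinearMap.mul ℝ ℝ)
    hf.locallyIntegrable (hη.smooth.of_le (by simp)) x
  rw [pd, conv_eq_convolution, h.fderiv, convolution_precompR_apply _ hf.locallyIntegrable
    (hη.supp.fderiv (𝕜 := ℝ)) (hη.smooth.continuous_fderiv (by simp))]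
  rfl

theorem conv_sub {f g η : R3 → ℝ} (hf : MemL2loc f) (hg : MemL2loc g) (hη : IsTest η) (x : R3) :
    conv (fun y => f y - g y) η x = conv f η x - conv g η x := by
  have h := hη.reflect x
  simp only [conv, sub_mul]
  exact integral_sub (hf.integrable_mul h.continuous h.supp)
    (hg.integrable_mul h.continuous h.supp)

theorem IsTest.exists_bound {η : R3 → ℝ} (hη : IsTest η) : ∃ C, 0 ≤ C ∧ ∀ x, |η x| ≤ C := by
  obtain ⟨C, hC⟩ := hη.supp.exists_bound_of_continuous hη.continuous
  exact ⟨C, (norm_nonneg _).trans (hC 0), hC⟩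

theorem L2Cont.continuous_conv {f : ℝ → R3 → ℝ} (hf : L2Cont f) {η : R3 → ℝ} (hη : IsTest η) :
    Continuous fun p : ℝ × R3 => conv (f p.1) η p.2 := by
  obtain ⟨r, hr, h0⟩ := exists_radius_of_hasCompactSupport hη.supp
  obtain ⟨C, hC, hb⟩ := hη.exists_bound
  rw [continuous_iff_continuousAt]
  rintro ⟨t, y⟩
  -- This ball contains the supports of all `η (z - ·)` with z at distance less than one from y. The
  -- Cauchy–Schwarz bound for the change in time is therefore uniform in z, and only the spatial
  -- continuity of `conv (f t) η` remains.
  set R := ‖y‖ + 1 + r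
  set K := C * √(volume.real (Metric.ball (0 : R3) R))
  have h1 : Tendsto (fun p : ℝ × R3 => l2norm R (fun z => f p.1 z - f t z) * K +
      |conv (f t) η p.2 - conv (f t) η y|) (𝓝 (t, y)) (𝓝 0) := by
    have a1 := ((hf.tendsto t R).mul_const K).comp (continuous_fst.tendsto (t, y))
    have a2 := ((((contDiff_conv (hf.mem t) hη).continuous.comp continuous_snd).sub
      (continuous_const (y := conv (f t) η y))).abs).tendsto (t, y)
    simpa using a1.add a2
  refine tendsto_iff_dist_tendsto_zero.2
    (squeeze_zero' (Eventually.of_forall fun _ => dist_nonneg) ?_ h1)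
  have hU : ∀ᶠ p : ℝ × R3 in 𝓝 (t, y), p.2 ∈ Metric.ball y 1 :=
    (continuous_snd.tendsto (t, y)).eventually (Metric.ball_mem_nhds _ one_pos)
  filter_upwards [hU] with p hp
  have hp' : ‖p.2‖ ≤ ‖y‖ + 1 := by
    have h2 := norm_le_norm_add_norm_sub' p.2 y
    rw [mem_ball_iff_norm] at hp
    linarith
  have e : |conv (f p.1) η p.2 - conv (f t) η p.2| ≤ l2norm R (fun z => f p.1 z - f t z) * K := by
    rw [← conv_sub (hf.mem _) (hf.mem _) hη]
    refine (abs_integral_mul_le (R := R) ((hf.mem _).sub (hf.mem _))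
      (hη.reflect p.2).memL2loc fun x hx => h0 _ ?_).trans ?_
    · have := norm_sub_norm_le x p.2
      rw [norm_sub_rev] at this
      linarith
    · exact mul_le_mul_of_nonneg_left (l2norm_le_of_bound hC fun x _ => hb _) (l2norm_nonneg _ _)
  rw [Real.dist_eq]
  exact (abs_sub_le _ (conv (f t) η p.2) _).trans (by gcongr)

/-- `η` is a nonnegative smooth function of integral one, supported in the ball of radius `ε`. -/
structure IsMollifier (ε : ℝ) (η : R3 → ℝ) : Prop where
  test : IsTest η
  nonneg : ∀ x, 0 ≤ η x
  integral : ∫ x, η x = 1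
  vanish : ∀ x, ε ≤ ‖x‖ → η x = 0

theorem exists_isMollifier {ε : ℝ} (hε : 0 < ε) : ∃ η, IsMollifier ε η := by
  let φ : ContDiffBump (0 : R3) := ⟨ε / 2, ε, by positivity, by linarith⟩
  refine ⟨φ.normed volume, ⟨φ.contDiff_normed, φ.hasCompactSupport_normed⟩,
    φ.nonneg_normed, φ.integral_normed, fun x hx => ?_⟩
  have : x ∉ Function.support (φ.normed volume) := by
    rw [φ.support_normed_eq]
    simpa using hx
  simpa using this

theorem IsMollifier.integral_reflect {ε : ℝ} {η : R3 → ℝ} (hη : IsMollifier ε η) (x : R3) :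
    ∫ y, η (x - y) = 1 := by
  rw [integral_sub_left_eq_self (μ := volume) η x, hη.integral]

theorem IsMollifier.integrable_reflect {ε : ℝ} {η : R3 → ℝ} (hη : IsMollifier ε η) (x : R3) :
    Integrable fun y => η (x - y) :=
  (hη.test.reflect x).continuous.integrable_of_hasCompactSupport (hη.test.reflect x).supp

theorem MemL2loc.locallyIntegrable_sq {f : R3 → ℝ} (hf : MemL2loc f) :
    LocallyIntegrable (fun x => f x ^ 2) volume := fun x =>
  ⟨Metric.ball 0 (‖x‖ + 1), Metric.isOpen_ball.mem_nhds (by simp), hf.integrableOn_sq _⟩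

/-- Jensen's inequality for the probability density `η (x - ·)`, obtained by expanding the
nonnegative variance of `f` around its mean `c`. -/
theorem sq_conv_le {f η : R3 → ℝ} {ε : ℝ} (hf : MemL2loc f) (hη : IsMollifier ε η) (x : R3) :
    conv f η x ^ 2 ≤ conv (fun y => f y ^ 2) η x := by
  have ht := hη.test.reflect x
  set c := conv f η x with hc
  have i1 : Integrable fun y => f y ^ 2 * η (x - y) :=
    hf.locallyIntegrable_sq.integrable_smul_right_of_hasCompactSupport ht.continuous ht.supp
  have i2 : Integrable fun y => f y * η (x - y) := hf.integrable_mul ht.continuous ht.supp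
  have i3 := hη.integrable_reflect x
  have h0 : 0 ≤ ∫ y, (f y - c) ^ 2 * η (x - y) :=
    integral_nonneg fun y => mul_nonneg (sq_nonneg _) (hη.nonneg _)
  have e : ∫ y, (f y - c) ^ 2 * η (x - y) =
      (∫ y, f y ^ 2 * η (x - y)) - 2 * c * (∫ y, f y * η (x - y)) + c ^ 2 * ∫ y, η (x - y) := by
    rw [← integral_const_mul, ← integral_const_mul, ← integral_sub i1 (i2.const_mul _),
      ← integral_add (f := fun y => f y ^ 2 * η (x - y) - 2 * c * (f y * η (x - y)))
        (i1.sub (i2.const_mul _)) (i3.const_mul _)]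
    congr 1; ext y; ring
  rw [e, hη.integral_reflect] at h0
  have h1 : (∫ y, f y * η (x - y)) = c := rfl
  rw [h1] at h0
  have h2 : (∫ y, f y ^ 2 * η (x - y)) = conv (fun y => f y ^ 2) η x := rfl
  rw [h2] at h0
  nlinarith

/-- Mollification does not increase local `L²` norms, up to a small increase of the radius. -/
theorem l2norm_conv_le {f η : R3 → ℝ} {ε : ℝ} (hf : MemL2loc f) (hη : IsMollifier ε η) (R : ℝ) :
    l2norm R (conv f η) ≤ l2norm (R + ε) f := by
  have hmem : MemL2loc (conv f η) := memL2loc_of_continuous (contDiff_conv hf hη.test).continuous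
  refine le_of_sq_le_sq ?_ (l2norm_nonneg _ _)
  rw [l2norm_sq hmem, l2norm_sq hf]
  -- The values of `conv f η` in the ball of radius R involve `f` only in the ball of radius R + ε,
  -- so `f ^ 2` may be cut off there. The truncation is integrable, and its convolution with `η` has
  -- the same total integral because `η` has mass one.
  set h : R3 → ℝ := (Metric.ball (0 : R3) (R + ε)).indicator fun y => f y ^ 2 with hh
  have ih : Integrable h := (hf.integrableOn_sq (R + ε)).integrable_indicator measurableSet_ball
  have iη : Integrable η := hη.test.continuous.integrable_of_hasCompactSupport hη.test.supp
  have ic : Integrable (conv h η) := by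
    rw [conv_eq_convolution]
    exact ih.integrable_convolution _ iη
  have h0 : ∀ y, 0 ≤ h y := fun y => Set.indicator_nonneg (fun _ _ => sq_nonneg _) y
  have e1 : ∀ x ∈ Metric.ball (0 : R3) R, conv (fun y => f y ^ 2) η x = conv h η x := by
    intro x hx
    refine integral_congr_ae (Eventually.of_forall fun y => ?_)
    by_cases hy : y ∈ Metric.ball (0 : R3) (R + ε)
    · simp [hh, Set.indicator_of_mem hy]
    · have : η (x - y) = 0 := by
        refine hη.vanish _ ?_
        have h3 := norm_sub_norm_le y x
        rw [norm_sub_rev] at h3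
        simp at hx hy
        linarith
      simp [this]
  calc ∫ x in Metric.ball 0 R, conv f η x ^ 2 ≤ ∫ x in Metric.ball 0 R, conv h η x := by
        refine setIntegral_mono_on (hmem.integrableOn_sq R) ic.integrableOn measurableSet_ball
          fun x hx => ?_
        rw [← e1 x hx]
        exact sq_conv_le hf hη x
    _ ≤ ∫ x, conv h η x := by
        refine setIntegral_le_integral ic (Eventually.of_forall fun x => ?_)
        exact integral_nonneg fun y => mul_nonneg (h0 y) (hη.nonneg _)
    _ = ∫ x in Metric.ball 0 (R + ε), f x ^ 2 := by
        rw [conv_eq_convolution, integral_convolution _ ih iη, hη.integral,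
          ← integral_indicator measurableSet_ball]
        simp [hh]

/-- Mollifications converge in `L²_loc`. -/
theorem exists_l2norm_conv_sub_le {f : R3 → ℝ} (hf : MemL2loc f) (R : ℝ) {δ : ℝ} (hδ : 0 < δ) :
    ∃ ε₀ > 0, ∀ ε ≤ ε₀, ∀ η, IsMollifier ε η → l2norm R (fun x => conv f η x - f x) ≤ δ := by
  -- A three-thirds argument with a continuous compactly supported `g`. Closeness of `f` and `g` on
  -- the ball of radius R + 1 suffices, since only mollifiers of radius at most one are used.
  set f₁ : R3 → ℝ := (Metric.ball (0 : R3) (R + 1)).indicator f with hf₁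
  have m₁ : MemLp f₁ 2 volume :=
    (memLp_indicator_iff_restrict measurableSet_ball).2 (hf (R + 1))
  obtain ⟨g, gs, hg, gc, gm⟩ := m₁.exists_hasCompactSupport_eLpNorm_sub_le (by simp)
    (ε := ENNReal.ofReal (δ / 3)) (by simpa using hδ)
  have hgl : MemL2loc g := memL2loc_of_continuous gc
  have hfg : l2norm (R + 1) (fun x => f x - g x) ≤ δ / 3 := by
    have : l2norm (R + 1) (fun x => f x - g x) = l2norm (R + 1) (fun x => f₁ x - g x) :=
      l2norm_congr_on fun x hx => by rw [hf₁, Set.indicator_of_mem hx]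
    rw [this, l2norm]
    refine ENNReal.toReal_le_of_le_ofReal (by positivity) (le_trans ?_ hg)
    exact eLpNorm_mono_measure _ Measure.restrict_le_self
  set S := √(volume.real (Metric.ball (0 : R3) R))
  have hS : 0 ≤ S := Real.sqrt_nonneg _
  -- A pointwise error κ costs at most κ S ≤ δ / 3 in the norm; the summand 1 keeps the denominator
  -- positive when the ball is empty.
  set κ := δ / (3 * (S + 1)) with hκ
  have hκ0 : 0 < κ := by positivity
  obtain ⟨ε₁, hε₁, hu⟩ := Metric.uniformContinuous_iff.1 (gs.uniformContinuous_of_continuous gc)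
    κ hκ0
  refine ⟨min ε₁ 1, by positivity, fun ε hε η hη => ?_⟩
  have hcg : MemL2loc (conv g η) := memL2loc_of_continuous (contDiff_conv hgl hη.test).continuous
  have hcf : MemL2loc (conv f η) := memL2loc_of_continuous (contDiff_conv hf hη.test).continuous
  have t1 : l2norm R (fun x => conv f η x - conv g η x) ≤ δ / 3 := by
    have : (fun x => conv f η x - conv g η x) = conv (fun y => f y - g y) η :=
      funext fun x => (conv_sub hf hgl hη.test x).symm
    rw [this]
    refine (l2norm_conv_le (hf.sub hgl) hη R).trans (le_trans ?_ hfg)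
    exact l2norm_mono (hf.sub hgl) (by linarith [min_le_right ε₁ 1])
  have t2 : l2norm R (fun x => conv g η x - g x) ≤ δ / 3 := by
    refine (l2norm_le_of_bound hκ0.le fun x _ => ?_).trans ?_
    · have it := hη.test.reflect x
      have i1 := hgl.integrable_mul it.continuous it.supp
      have i3 := hη.integrable_reflect x
      have e : conv g η x - g x = ∫ y, (g y - g x) * η (x - y) := by
        simp only [sub_mul]
        rw [integral_sub i1 (i3.const_mul _), integral_const_mul, hη.integral_reflect, mul_one]
        rfl
      rw [e, ← Real.norm_eq_abs]
      refine (norm_integral_le_of_norm_le (i3.const_mul κ)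
        (Eventually.of_forall fun y => ?_)).trans (le_of_eq ?_)
      · rw [norm_mul, Real.norm_of_nonneg (hη.nonneg _)]
        by_cases hy : ε ≤ ‖x - y‖
        · simp [hη.vanish _ hy]
        · refine mul_le_mul_of_nonneg_right ?_ (hη.nonneg _)
          have := hu (a := y) (b := x) (by
            rw [dist_eq_norm, norm_sub_rev]; linarith [min_le_left ε₁ 1])
          rw [dist_eq_norm] at this
          exact this.le
      · rw [integral_const_mul, hη.integral_reflect, mul_one]
    · rw [hκ, div_mul_eq_mul_div, div_le_div_iff₀ (by positivity) (by norm_num)]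
      nlinarith
  have t3 : l2norm R (fun x => g x - f x) ≤ δ / 3 := by
    rw [l2norm_sub_comm]
    exact (l2norm_mono (hf.sub hgl) (by linarith)).trans hfg
  have h1 := l2norm_triangle hcf hcg hf R
  have h2 := l2norm_triangle hcg hgl hf R
  linarith

end

section

/-! ### The weighted energy identity for regular solutions -/

/-- A smooth approximation of the indicator of the cone `‖x‖ < b - s`. -/
def coneWeight (N b s : ℝ) (x : R3) : ℝ := Real.smoothTransition (N * ((b - s) ^ 2 - ‖x‖ ^ 2))

/-- The derivative of the profile of `coneWeight`. -/
def coneSlope (N b s : ℝ) (x : R3) : ℝ :=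
  N * deriv Real.smoothTransition (N * ((b - s) ^ 2 - ‖x‖ ^ 2))

theorem differentiable_smoothTransition : Differentiable ℝ Real.smoothTransition :=
  (Real.smoothTransition.contDiff (n := 1)).differentiable (by simp)

theorem deriv_smoothTransition_nonneg (y : ℝ) : 0 ≤ deriv Real.smoothTransition y :=
  Real.smoothTransition.monotone.deriv_nonneg

/-- Such a point is a global minimum, including the endpoint 0, so no one-sided limit is needed. -/
theorem deriv_smoothTransition_of_nonpos {y : ℝ} (hy : y ≤ 0) :
    deriv Real.smoothTransition y = 0 := by
  refine IsLocalMin.deriv_eq_zero (Eventually.of_forall fun z => ?_)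
  rw [Real.smoothTransition.zero_of_nonpos hy]
  exact Real.smoothTransition.nonneg z

theorem coneWeight_nonneg (N b s : ℝ) (x : R3) : 0 ≤ coneWeight N b s x :=
  Real.smoothTransition.nonneg _

theorem coneWeight_le_one (N b s : ℝ) (x : R3) : coneWeight N b s x ≤ 1 :=
  Real.smoothTransition.le_one _

theorem coneSlope_nonneg {N : ℝ} (hN : 0 ≤ N) (b s : ℝ) (x : R3) : 0 ≤ coneSlope N b s x :=
  mul_nonneg hN (deriv_smoothTransition_nonneg _)

theorem sq_sub_sq_nonpos {b s : ℝ} {x : R3} (hx : |b - s| ≤ ‖x‖) :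
    (b - s) ^ 2 - ‖x‖ ^ 2 ≤ 0 := by
  have := sq_le_sq₀ (abs_nonneg (b - s)) (norm_nonneg x) |>.2 hx
  rw [sq_abs] at this
  linarith

theorem coneWeight_eq_zero {N b s : ℝ} (hN : 0 ≤ N) {x : R3} (hx : |b - s| ≤ ‖x‖) :
    coneWeight N b s x = 0 :=
  Real.smoothTransition.zero_of_nonpos (mul_nonpos_of_nonneg_of_nonpos hN (sq_sub_sq_nonpos hx))

theorem coneSlope_eq_zero {N b s : ℝ} (hN : 0 ≤ N) {x : R3} (hx : |b - s| ≤ ‖x‖) :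
    coneSlope N b s x = 0 := by
  rw [coneSlope, deriv_smoothTransition_of_nonpos
    (mul_nonpos_of_nonneg_of_nonpos hN (sq_sub_sq_nonpos hx)), mul_zero]

theorem continuous_coneWeight (N b : ℝ) :
    Continuous fun p : ℝ × R3 => coneWeight N b p.1 p.2 :=
  Real.smoothTransition.continuous.comp (by fun_prop)

theorem continuous_coneSlope (N b : ℝ) :
    Continuous fun p : ℝ × R3 => coneSlope N b p.1 p.2 := by
  have h : Continuous (deriv Real.smoothTransition) :=
    (Real.smoothTransition.contDiff (n := 1)).continuous_deriv le_rfl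
  exact continuous_const.mul (h.comp (by fun_prop))

theorem hasDerivAt_coneWeight (N b s : ℝ) (x : R3) :
    HasDerivAt (fun s => coneWeight N b s x) (-(2 * (b - s)) * coneSlope N b s x) s := by
  have h0 : HasDerivAt (fun s => (b - s) ^ 2) (-(2 * (b - s))) s := by
    simpa using ((hasDerivAt_id s).const_sub b).fun_pow 2
  have h2 := (differentiable_smoothTransition (N * ((b - s) ^ 2 - ‖x‖ ^ 2))).hasDerivAt.comp s
    ((h0.sub_const (‖x‖ ^ 2)).const_mul N)
  exact h2.congr_deriv (by rw [coneSlope]; ring)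

theorem contDiff_coneWeight (N b s : ℝ) : ContDiff ℝ 1 (coneWeight N b s) :=
  Real.smoothTransition.contDiff.comp
    (contDiff_const.mul (contDiff_const.sub (contDiff_norm_sq ℝ)))

theorem pd_coneWeight (N b s : ℝ) (x : R3) (i : Fin 3) :
    pd i (coneWeight N b s) x = -(2 * x i) * coneSlope N b s x := by
  have h1 : HasFDerivAt (fun x : R3 => N * ((b - s) ^ 2 - ‖x‖ ^ 2))
      (N • -(2 • innerSL ℝ x : R3 →L[ℝ] ℝ)) x :=
    ((hasStrictFDerivAt_norm_sq x).hasFDerivAt.const_sub _).const_mul N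
  have h2 := (differentiable_smoothTransition (N * ((b - s) ^ 2 - ‖x‖ ^ 2))).hasDerivAt.comp_hasFDerivAt
    x h1
  have h3 : coneWeight N b s = Real.smoothTransition ∘ fun x : R3 => N * ((b - s) ^ 2 - ‖x‖ ^ 2) :=
    rfl
  rw [pd, h3, h2.fderiv, coneSlope]
  simp [EuclideanSpace.inner_single_right]
  ring

/-- Differentiation under the integral sign. The common spatial support for times near `s₀` makes
the maximum of `P'` over a compact set of times and points an integrable majorant. -/
theorem hasDerivAt_integral_of_vanish {P P' : ℝ → R3 → ℝ}
    (hP : Continuous fun p : ℝ × R3 => P p.1 p.2) (hP' : Continuous fun p : ℝ × R3 => P' p.1 p.2)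
    (hd : ∀ s x, HasDerivAt (fun s => P s x) (P' s x) s) {r s₀ δ : ℝ} (hδ : 0 < δ)
    (h0 : ∀ s, |s - s₀| ≤ δ → ∀ x, r ≤ ‖x‖ → P s x = 0)
    (h0' : ∀ s, |s - s₀| ≤ δ → ∀ x, r ≤ ‖x‖ → P' s x = 0) :
    Integrable (P' s₀) ∧ HasDerivAt (fun s => ∫ x, P s x) (∫ x, P' s₀ x) s₀ := by
  have hK : IsCompact (Metric.closedBall s₀ δ ×ˢ Metric.closedBall (0 : R3) r) :=
    (isCompact_closedBall _ _).prod (isCompact_closedBall _ _)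
  obtain ⟨C, hC⟩ := hK.exists_bound_of_continuousOn hP'.continuousOn
  have hcont : ∀ s, Continuous (P s) := fun s =>
    hP.comp (continuous_const.prodMk continuous_id)
  have hcont' : ∀ s, Continuous (P' s) := fun s =>
    hP'.comp (continuous_const.prodMk continuous_id)
  have hint : Integrable (P s₀) := by
    refine (hcont s₀).integrable_of_hasCompactSupport
      (HasCompactSupport.of_support_subset_isCompact (isCompact_closedBall (0 : R3) r) ?_)
    intro x hx
    by_contra hxr
    refine hx (h0 s₀ (by simpa using hδ.le) x ?_)
    simp at hxr
    exact hxr.le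
  refine hasDerivAt_integral_of_dominated_loc_of_deriv_le
    (s := Metric.closedBall s₀ δ) (bound := (Metric.closedBall (0 : R3) r).indicator fun _ => C)
    (Metric.closedBall_mem_nhds _ hδ)
    (Eventually.of_forall fun s => (hcont s).aestronglyMeasurable) hint
    (hcont' s₀).aestronglyMeasurable (Eventually.of_forall fun x s hs => ?_) ?_
    (Eventually.of_forall fun x s _ => hd s x)
  · by_cases hx : x ∈ Metric.closedBall (0 : R3) r
    · rw [Set.indicator_of_mem hx]
      exact hC (s, x) ⟨hs, hx⟩
    · rw [Set.indicator_of_notMem hx]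
      have : P' s x = 0 := h0' s (by simpa [Real.dist_eq] using hs) x (by simp at hx; exact hx.le)
      simp [this]
  · rw [integrable_indicator_iff measurableSet_closedBall]
    exact integrableOn_const (isCompact_closedBall (0 : R3) r).measure_lt_top.ne

/-- The energy density. -/
def density (U V : R3 → ℝ) (G : Fin 3 → R3 → ℝ) (x : R3) : ℝ :=
  U x ^ 2 + ∑ i, G i x ^ 2 + V x ^ 2

theorem density_nonneg (U V : R3 → ℝ) (G : Fin 3 → R3 → ℝ) (x : R3) : 0 ≤ density U V G x := by
  unfold density
  have : 0 ≤ ∑ i, G i x ^ 2 := Finset.sum_nonneg fun i _ => sq_nonneg _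
  positivity

/-- A classical solution of the Klein–Gordon equation `Ü = ΔU - m²U - F` together with the partial
derivatives that enter the energy balance. -/
structure RegularSolution (m : ℝ) (U V F : ℝ → R3 → ℝ) (G D H : Fin 3 → ℝ → R3 → ℝ) : Prop where
  cU : Continuous fun p : ℝ × R3 => U p.1 p.2
  cV : Continuous fun p : ℝ × R3 => V p.1 p.2
  cF : Continuous fun p : ℝ × R3 => F p.1 p.2
  cG : ∀ i, Continuous fun p : ℝ × R3 => G i p.1 p.2
  cD : ∀ i, Continuous fun p : ℝ × R3 => D i p.1 p.2
  cH : ∀ i, Continuous fun p : ℝ × R3 => H i p.1 p.2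
  dU : ∀ s x, HasDerivAt (fun s => U s x) (V s x) s
  dV : ∀ s x, HasDerivAt (fun s => V s x) ((∑ i, H i s x) - m ^ 2 * U s x - F s x) s
  dG : ∀ i s x, HasDerivAt (fun s => G i s x) (D i s x) s
  diffV : ∀ s, Differentiable ℝ (V s)
  diffG : ∀ i s, Differentiable ℝ (G i s)
  pdV : ∀ i s x, pd i (V s) x = D i s x
  pdG : ∀ i s x, pd i (G i s) x = H i s x

/-- This inequality expresses that the speed of propagation is at most one. The weight decreases in
time at the rate 2(b - s) times its slope, whereas the flux through its spatial gradient is at most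
2‖x‖ times the slope times the density, by Cauchy–Schwarz and 2|V||G| ≤ V² + |G|². Where the slope
does not vanish, ‖x‖ < b - s. -/
theorem coneSlope_flux_le {N b s : ℝ} (hN : 0 ≤ N) (hs : s ≤ b) (U V : R3 → ℝ)
    (G : Fin 3 → R3 → ℝ) (x : R3) :
    -(2 * (b - s)) * coneSlope N b s x * density U V G x
      - 2 * ∑ i, -(2 * x i) * coneSlope N b s x * (V x * G i x) ≤ 0 := by
  by_cases hx : |b - s| ≤ ‖x‖
  · simp [coneSlope_eq_zero hN hx]
  · rw [abs_of_nonneg (by linarith), not_le] at hx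
    have e : ∑ i, -(2 * x i) * coneSlope N b s x * (V x * G i x) =
        -(2 * coneSlope N b s x * V x) * ∑ i, x i * G i x := by
      rw [Finset.mul_sum]
      exact Finset.sum_congr rfl fun i _ => by ring
    rw [e]
    have hcs := Finset.sum_mul_sq_le_sq_mul_sq Finset.univ (fun i => x i) (fun i => G i x)
    have hn : ∑ i, x i ^ 2 = ‖x‖ ^ 2 := by
      rw [EuclideanSpace.norm_sq_eq]
      simp
    rw [hn] at hcs
    set S := ∑ i, x i * G i x
    set Q := ∑ i, G i x ^ 2 with hQ
    have hQ0 : 0 ≤ Q := Finset.sum_nonneg fun i _ => sq_nonneg _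
    have hk := coneSlope_nonneg hN b s x
    have h1 : 2 * (V x * S) ≤ (b - s) * density U V G x := by
      have h2 : |S| ≤ ‖x‖ * √Q := by
        refine abs_le_of_sq_le_sq ?_ (by positivity)
        rw [mul_pow, Real.sq_sqrt hQ0]
        exact hcs
      have h3 : V x * S ≤ |V x| * (‖x‖ * √Q) := by
        refine (le_abs_self _).trans ?_
        rw [abs_mul]
        gcongr
      have h4 : 2 * (|V x| * √Q) ≤ V x ^ 2 + Q := by
        have := two_mul_le_add_sq (|V x|) (√Q)
        rw [Real.sq_sqrt hQ0, sq_abs] at this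
        linarith
      have h5 : V x ^ 2 + Q ≤ density U V G x := by
        unfold density
        nlinarith [sq_nonneg (U x)]
      calc 2 * (V x * S) ≤ ‖x‖ * (2 * (|V x| * √Q)) := by linarith
        _ ≤ ‖x‖ * density U V G x := by gcongr; linarith
        _ ≤ (b - s) * density U V G x :=
          mul_le_mul_of_nonneg_right hx.le (density_nonneg _ _ _ _)
    nlinarith

end

/-! ### The energy balance in a truncated light cone. -/

section

namespace RegularSolution

variable {m : ℝ} {U V F : ℝ → R3 → ℝ} {G D H : Fin 3 → ℝ → R3 → ℝ}

/-- The time derivative of the energy density. -/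
def densityRate (m : ℝ) (U V F : ℝ → R3 → ℝ) (G D H : Fin 3 → ℝ → R3 → ℝ) (s : ℝ) (x : R3) : ℝ :=
  2 * (1 - m ^ 2) * (U s x * V s x) - 2 * (V s x * F s x) +
    2 * ∑ i, (D i s x * G i s x + V s x * H i s x)

theorem continuous_density (h : RegularSolution m U V F G D H) :
    Continuous fun p : ℝ × R3 => density (U p.1) (V p.1) (fun i => G i p.1) p.2 :=
  ((h.cU.pow 2).add (continuous_finsetSum _ fun i _ => (h.cG i).pow 2)).add (h.cV.pow 2)

theorem continuous_densityRate (h : RegularSolution m U V F G D H) :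
    Continuous fun p : ℝ × R3 => densityRate m U V F G D H p.1 p.2 :=
  ((continuous_const.mul (h.cU.mul h.cV)).sub (continuous_const.mul (h.cV.mul h.cF))).add
    (continuous_const.mul (continuous_finsetSum _ fun i _ =>
      ((h.cD i).mul (h.cG i)).add (h.cV.mul (h.cH i))))

theorem hasDerivAt_density (h : RegularSolution m U V F G D H) (s : ℝ) (x : R3) :
    HasDerivAt (fun s => density (U s) (V s) (fun i => G i s) x)
      (densityRate m U V F G D H s x) s := by
  have h1 := (h.dU s x).fun_pow 2
  have h2 := HasDerivAt.fun_sum (u := Finset.univ) fun i _ => (h.dG i s x).fun_pow 2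
  have h3 := (h.dV s x).fun_pow 2
  refine ((h1.add h2).add h3).congr_deriv ?_
  simp only [densityRate, Fin.sum_univ_three]
  push_cast
  ring

/-- The bracket is the partial derivative of V Gᵢ, because D and H are the spatial derivatives of V
and G; the divergence part of the energy balance is thus moved onto the weight by an integration by
parts. -/
theorem integral_weight_mul_div (h : RegularSolution m U V F G D H) {w : R3 → ℝ}
    (hw : ContDiff ℝ 1 w) (hs : HasCompactSupport w) (s : ℝ) (i : Fin 3) :
    Integrable (fun x => w x * (D i s x * G i s x + V s x * H i s x)) ∧
    Integrable (fun x => pd i w x * (V s x * G i s x)) ∧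
    ∫ x, w x * (D i s x * G i s x + V s x * H i s x) = -∫ x, pd i w x * (V s x * G i s x) := by
  have slice : ∀ {f : ℝ → R3 → ℝ}, (Continuous fun p : ℝ × R3 => f p.1 p.2) → Continuous (f s) :=
    fun hf => hf.comp (continuous_const.prodMk continuous_id)
  have hd : ∀ x, fderiv ℝ (fun x => V s x * G i s x) x (EuclideanSpace.single i 1) =
      D i s x * G i s x + V s x * H i s x := by
    intro x
    have h1 := ((h.diffV s x).hasFDerivAt.mul (h.diffG i s x).hasFDerivAt).fderiv
    have h2 : (fun x => V s x * G i s x) = V s * G i s := rfl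
    rw [h2, h1]
    have h3 := h.pdV i s x
    have h4 := h.pdG i s x
    rw [pd] at h3 h4
    simp only [add_apply, smul_apply, h3, h4, smul_eq_mul]
    ring
  have cVG : Continuous fun x => V s x * G i s x := (slice h.cV).mul (slice (h.cG i))
  have i1 : Integrable (fun x => w x * (D i s x * G i s x + V s x * H i s x)) :=
    (hw.continuous.mul (((slice (h.cD i)).mul (slice (h.cG i))).add
      ((slice h.cV).mul (slice (h.cH i))))).integrable_of_hasCompactSupport hs.mul_right
  have i2 : Integrable (fun x => pd i w x * (V s x * G i s x)) :=
    (((hw.continuous_fderiv (by simp)).clm_apply continuous_const).mul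
      cVG).integrable_of_hasCompactSupport (hs.fderiv_apply (𝕜 := ℝ) _).mul_right
  refine ⟨i1, i2, ?_⟩
  have := integral_mul_fderiv_eq_neg_fderiv_mul_of_integrable (μ := (volume : Measure R3))
    (f := w) (g := fun x => V s x * G i s x) (v := EuclideanSpace.single i (1 : ℝ)) i2
    (by simpa only [hd] using i1)
    ((hw.continuous.mul cVG).integrable_of_hasCompactSupport hs.mul_right)
    (fun x _ => (hw.differentiable (by simp)) x)
    (fun x _ => (h.diffV s x).mul (h.diffG i s x))
  simpa only [hd, pd] using this

theorem hasCompactSupport_coneWeight {N : ℝ} (hN : 0 ≤ N) (b s : ℝ) :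
    HasCompactSupport (coneWeight N b s) :=
  HasCompactSupport.of_support_subset_isCompact (isCompact_closedBall (0 : R3) |b - s|) fun x hx => by
    by_contra hxr
    refine hx (coneWeight_eq_zero hN ?_)
    simp at hxr
    exact hxr.le

/-- After integration by parts the loss from the shrinking weight absorbs the flux, and what is left
of the derivative contains no derivatives of V or G. -/
theorem hasDerivAt_coneEnergy (h : RegularSolution m U V F G D H) {N b : ℝ} (hN : 0 ≤ N)
    {s : ℝ} (hs : s ≤ b) :
    ∃ E' : ℝ, HasDerivAt (fun s => ∫ x, coneWeight N b s x *
        density (U s) (V s) (fun i => G i s) x) E' s ∧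
      E' ≤ (2 + m ^ 2) * (∫ x, coneWeight N b s x * density (U s) (V s) (fun i => G i s) x) +
        ∫ x in Metric.ball 0 (|b - s| + 1), F s x ^ 2 := by
  have slice : ∀ {f : ℝ → R3 → ℝ}, (Continuous fun p : ℝ × R3 => f p.1 p.2) → Continuous (f s) :=
    fun hf => hf.comp (continuous_const.prodMk continuous_id)
  have hcs := hasCompactSupport_coneWeight hN b s
  have cw : Continuous (coneWeight N b s) := slice (continuous_coneWeight N b)
  -- During the time interval of radius one around s the cone stays inside the ball of radius |b -
  -- s| + 1.
  obtain ⟨-, hder⟩ := hasDerivAt_integral_of_vanish (r := |b - s| + 1) (s₀ := s)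
    ((continuous_coneWeight N b).mul h.continuous_density)
    ((((show Continuous fun p : ℝ × R3 => -(2 * (b - p.1)) by fun_prop).mul
      (continuous_coneSlope N b)).mul h.continuous_density).add
      ((continuous_coneWeight N b).mul h.continuous_densityRate))
    (fun s x => (hasDerivAt_coneWeight N b s x).fun_mul (h.hasDerivAt_density s x)) one_pos
    (fun t ht x hx => by
      have h1 : |b - t| ≤ |b - s| + |t - s| := by
        have := abs_sub_le b s t
        rwa [abs_sub_comm s t] at this
      rw [coneWeight_eq_zero hN (by linarith), zero_mul])
    (fun t ht x hx => by
      have h1 : |b - t| ≤ |b - s| + |t - s| := by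
        have := abs_sub_le b s t
        rwa [abs_sub_comm s t] at this
      rw [coneWeight_eq_zero hN (by linarith), coneSlope_eq_zero hN (by linarith)]
      simp)
  refine ⟨_, hder, ?_⟩
  have hB := fun i => h.integral_weight_mul_div (contDiff_coneWeight N b s) hcs s i
  have cden : Continuous (density (U s) (V s) fun i => G i s) := slice (f := fun s x =>
    density (U s) (V s) (fun i => G i s) x) h.continuous_density
  have iden : Integrable fun x => coneWeight N b s x * density (U s) (V s) (fun i => G i s) x :=
    (cw.mul cden).integrable_of_hasCompactSupport hcs.mul_right
  have iUV : Integrable fun x => coneWeight N b s x * (U s x * V s x) :=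
    (cw.mul ((slice h.cU).mul (slice h.cV))).integrable_of_hasCompactSupport hcs.mul_right
  have iVF : Integrable fun x => coneWeight N b s x * (V s x * F s x) :=
    (cw.mul ((slice h.cV).mul (slice h.cF))).integrable_of_hasCompactSupport hcs.mul_right
  have iFF : Integrable fun x => coneWeight N b s x * F s x ^ 2 :=
    (cw.mul ((slice h.cF).pow 2)).integrable_of_hasCompactSupport hcs.mul_right
  have csl : HasCompactSupport (coneSlope N b s) :=
    HasCompactSupport.of_support_subset_isCompact (isCompact_closedBall (0 : R3) |b - s|)
      fun x hx => by
        by_contra hxr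
        refine hx (coneSlope_eq_zero hN ?_)
        simp at hxr
        exact hxr.le
  have isl : Integrable fun x => -(2 * (b - s)) * coneSlope N b s x *
      density (U s) (V s) (fun i => G i s) x :=
    ((continuous_const.mul (slice (continuous_coneSlope N b))).mul
      cden).integrable_of_hasCompactSupport csl.mul_left.mul_right
  have iB : Integrable fun x => ∑ i, coneWeight N b s x * (D i s x * G i s x + V s x * H i s x) :=
    integrable_finsetSum _ fun i _ => (hB i).1
  have iC : Integrable fun x => ∑ i, pd i (coneWeight N b s) x * (V s x * G i s x) :=
    integrable_finsetSum _ fun i _ => (hB i).2.1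
  have eBC : ∫ x, ∑ i, coneWeight N b s x * (D i s x * G i s x + V s x * H i s x) =
      -∫ x, ∑ i, pd i (coneWeight N b s) x * (V s x * G i s x) := by
    rw [integral_finsetSum _ fun i _ => (hB i).1, integral_finsetSum _ fun i _ => (hB i).2.1,
      ← Finset.sum_neg_distrib]
    exact Finset.sum_congr rfl fun i _ => (hB i).2.2
  -- The first integral on the right collects the slope and flux terms, which have a sign; the rest
  -- is of order zero.
  have e : ∫ x, (-(2 * (b - s)) * coneSlope N b s x * density (U s) (V s) (fun i => G i s) x +
      coneWeight N b s x * densityRate m U V F G D H s x) =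
      (∫ x, (-(2 * (b - s)) * coneSlope N b s x * density (U s) (V s) (fun i => G i s) x -
        2 * ∑ i, pd i (coneWeight N b s) x * (V s x * G i s x))) +
      ((2 * (1 - m ^ 2)) * (∫ x, coneWeight N b s x * (U s x * V s x)) -
        2 * ∫ x, coneWeight N b s x * (V s x * F s x)) := by
    rw [integral_sub isl (iC.const_mul 2), integral_const_mul]
    have e1 : ∀ x, -(2 * (b - s)) * coneSlope N b s x * density (U s) (V s) (fun i => G i s) x +
        coneWeight N b s x * densityRate m U V F G D H s x =
        (-(2 * (b - s)) * coneSlope N b s x * density (U s) (V s) (fun i => G i s) x +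
        2 * ∑ i, coneWeight N b s x * (D i s x * G i s x + V s x * H i s x)) +
        ((2 * (1 - m ^ 2)) * (coneWeight N b s x * (U s x * V s x)) -
        2 * (coneWeight N b s x * (V s x * F s x))) := fun x => by
      rw [densityRate, ← Finset.mul_sum]
      ring
    simp_rw [e1]
    have j1 : Integrable fun x =>
        -(2 * (b - s)) * coneSlope N b s x * density (U s) (V s) (fun i => G i s) x +
        2 * ∑ i, coneWeight N b s x * (D i s x * G i s x + V s x * H i s x) :=
      isl.add (iB.const_mul 2)
    have j2 : Integrable fun x => (2 * (1 - m ^ 2)) * (coneWeight N b s x * (U s x * V s x)) -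
        2 * (coneWeight N b s x * (V s x * F s x)) := (iUV.const_mul _).sub (iVF.const_mul 2)
    rw [integral_add j1 j2, integral_add isl (iB.const_mul 2), integral_sub (iUV.const_mul _) (iVF.const_mul 2),
      integral_const_mul, integral_const_mul, integral_const_mul, eBC]
    ring
  rw [e]
  have n1 : ∫ x, (-(2 * (b - s)) * coneSlope N b s x * density (U s) (V s) (fun i => G i s) x -
        2 * ∑ i, pd i (coneWeight N b s) x * (V s x * G i s x)) ≤ 0 := by
    refine integral_nonpos fun x => ?_
    simp only [pd_coneWeight]
    exact coneSlope_flux_le hN hs _ _ _ _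
  have n2 : (2 * (1 - m ^ 2)) * (∫ x, coneWeight N b s x * (U s x * V s x)) -
        2 * (∫ x, coneWeight N b s x * (V s x * F s x)) ≤
      (2 + m ^ 2) * (∫ x, coneWeight N b s x * density (U s) (V s) (fun i => G i s) x) +
        ∫ x, coneWeight N b s x * F s x ^ 2 := by
    rw [← integral_const_mul, ← integral_const_mul, ← integral_const_mul,
      ← integral_sub (iUV.const_mul _) (iVF.const_mul 2), ← integral_add (iden.const_mul _) iFF]
    refine integral_mono ((iUV.const_mul _).sub (iVF.const_mul 2)) ((iden.const_mul _).add iFF)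
      fun x => ?_
    have hw := coneWeight_nonneg N b s x
    -- The constant arises from 2UV ≤ U² + V², -2m²UV ≤ m²(U² + V²) and -2VF ≤ V² + F²; the
    -- coefficient of V² is the largest, namely 2 + m².
    have h1 : 2 * (1 - m ^ 2) * (U s x * V s x) - 2 * (V s x * F s x) ≤
        (2 + m ^ 2) * density (U s) (V s) (fun i => G i s) x + F s x ^ 2 := by
      unfold density
      have hQ : 0 ≤ ∑ i, G i s x ^ 2 := Finset.sum_nonneg fun i _ => sq_nonneg _
      have hm : 0 ≤ m ^ 2 := sq_nonneg m
      nlinarith [sq_nonneg (U s x - V s x), sq_nonneg (V s x + F s x),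
        mul_nonneg hm (sq_nonneg (U s x + V s x)), mul_nonneg hm hQ]
    have := mul_le_mul_of_nonneg_left h1 hw
    simp only
    linarith
  have n3 : ∫ x, coneWeight N b s x * F s x ^ 2 ≤
      ∫ x in Metric.ball 0 (|b - s| + 1), F s x ^ 2 := by
    have hF : MemL2loc (F s) := memL2loc_of_continuous (slice h.cF)
    rw [← integral_indicator measurableSet_ball]
    refine integral_mono iFF ((hF.integrableOn_sq _).integrable_indicator measurableSet_ball)
      fun x => ?_
    by_cases hx : x ∈ Metric.ball (0 : R3) (|b - s| + 1)
    · simp only [Set.indicator_of_mem hx]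
      exact mul_le_of_le_one_left (sq_nonneg _) (coneWeight_le_one _ _ _ _)
    · simp only [Set.indicator_of_notMem hx]
      simp at hx
      rw [coneWeight_eq_zero hN (by linarith), zero_mul]
  linarith

/-- The energy inequality in a truncated light cone. -/
theorem coneEnergy_le (h : RegularSolution m U V F G D H) {N b : ℝ} (hN : 0 ≤ N) {t : ℝ}
    (ht : 0 ≤ t) (htb : t ≤ b) {β : ℝ → ℝ} (hβ : Continuous β)
    (hFβ : ∀ s ∈ Set.Icc 0 t, ∫ x in Metric.ball 0 (b + 1), F s x ^ 2 ≤ β s) :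
    ∫ x, coneWeight N b t x * density (U t) (V t) (fun i => G i t) x ≤
      Real.exp ((2 + m ^ 2) * t) *
        ((∫ x, coneWeight N b 0 x * density (U 0) (V 0) (fun i => G i 0) x) + ∫ s in 0..t, β s) := by
  set c := 2 + m ^ 2 with hc
  have hc0 : 0 ≤ c := by positivity
  set E : ℝ → ℝ := fun s => ∫ x, coneWeight N b s x * density (U s) (V s) (fun i => G i s) x with hE
  choose! E' hE1 hE2 using fun s (hs : s ≤ b) => h.hasDerivAt_coneEnergy hN hs
  -- Grönwall's argument: with c = 2 + m², the function e^{-cs} E(s) - ∫₀ˢ β is shown to be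
  -- nonincreasing on [0, t].
  have hd : ∀ s ≤ b, HasDerivAt (fun s => Real.exp (-(c * s)) * E s - ∫ r in 0..s, β r)
      (-c * Real.exp (-(c * s)) * E s + Real.exp (-(c * s)) * E' s - β s) s := by
    intro s hs
    have h1 : HasDerivAt (fun s => Real.exp (-(c * s))) (-c * Real.exp (-(c * s))) s := by
      have := ((hasDerivAt_id s).const_mul c).neg.exp
      refine this.congr_deriv ?_
      simp
      ring
    exact (h1.mul (hE1 s hs)).sub
      (intervalIntegral.integral_hasDerivAt_right (hβ.intervalIntegrable _ _)
        hβ.aestronglyMeasurable.stronglyMeasurableAtFilter hβ.continuousAt)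
  have hanti : AntitoneOn (fun s => Real.exp (-(c * s)) * E s - ∫ r in 0..s, β r) (Set.Icc 0 t) := by
    refine antitoneOn_of_deriv_nonpos (convex_Icc 0 t)
      (fun s hs => (hd s (hs.2.trans htb)).continuousAt.continuousWithinAt)
      (fun s hs => ?_) (fun s hs => ?_)
    · rw [interior_Icc] at hs
      exact (hd s (hs.2.le.trans htb)).differentiableAt.differentiableWithinAt
    · rw [interior_Icc] at hs
      rw [(hd s (hs.2.le.trans htb)).deriv]
      have k1 := hE2 s (hs.2.le.trans htb)
      have k2 := hFβ s ⟨hs.1.le, hs.2.le⟩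
      have hF : MemL2loc (F s) :=
        memL2loc_of_continuous (h.cF.comp (continuous_const.prodMk continuous_id))
      have k3 : ∫ x in Metric.ball 0 (|b - s| + 1), F s x ^ 2 ≤
          ∫ x in Metric.ball 0 (b + 1), F s x ^ 2 := by
        refine setIntegral_mono_set (hF.integrableOn_sq _)
          (Eventually.of_forall fun x => sq_nonneg _) ?_
        refine (Metric.ball_subset_ball ?_).eventuallyLE
        rw [abs_of_nonneg (by linarith [hs.2])]
        linarith [hs.1]
      have k4 : E' s ≤ c * E s + β s := k1.trans (by gcongr; exact k3.trans k2)
      -- Together with β ≥ 0 this allows the weight in e^{-cs} β(s) to be dropped, so that the plain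
      -- integral of β appears.
      have k5 : Real.exp (-(c * s)) ≤ 1 := Real.exp_le_one_iff.2 (by nlinarith [hs.1])
      have k6 : 0 ≤ β s := (integral_nonneg fun x => sq_nonneg _).trans k2
      have k7 := Real.exp_pos (-(c * s))
      nlinarith
  have key := hanti (Set.left_mem_Icc.2 ht) (Set.right_mem_Icc.2 ht) ht
  simp only [mul_zero, neg_zero, Real.exp_zero, one_mul, intervalIntegral.integral_same,
    sub_zero] at key
  have k8 : Real.exp (-(c * t)) * E t ≤ E 0 + ∫ s in 0..t, β s := by linarith
  have k9 : E t = Real.exp (c * t) * (Real.exp (-(c * t)) * E t) := by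
    rw [← mul_assoc, ← Real.exp_add]
    simp
  change E t ≤ _
  rw [k9]
  gcongr

end RegularSolution

end

section

/-! ### Weak solutions of the forced Klein–Gordon equation -/

/-- `g` is the `i`-th weak partial derivative of `u`. -/
def IsWeakPd (i : Fin 3) (u g : R3 → ℝ) : Prop :=
  ∀ ψ, IsTest ψ → ∫ x, u x * pd i ψ x = -∫ x, g x * ψ x

/-- The definition of the weak derivative is tested against `η (x - ·)`; the minus sign of the
definition cancels the one from the reflection. -/
theorem conv_pd_of_isWeakPd {i : Fin 3} {u g : R3 → ℝ} (h : IsWeakPd i u g) {η : R3 → ℝ}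
    (hη : IsTest η) : conv u (pd i η) = conv g η := by
  ext x
  have := h _ (hη.reflect x)
  rw [pd_reflect hη] at this
  simpa [conv, integral_neg] using this

/-- `(u, v)` is a weak solution of `u̇ = v`, `v̇ = Δu - m²u - F`, continuous in time with values
in `H¹_loc ⊕ L²_loc`, and `g` is the weak gradient of `u`. -/
structure IsKG (m : ℝ) (F u v : ℝ → R3 → ℝ) (g : Fin 3 → ℝ → R3 → ℝ) : Prop where
  cF : L2Cont F
  cu : L2Cont u
  cv : L2Cont v
  cg : ∀ i, L2Cont (g i)
  grad : ∀ i t, IsWeakPd i (u t) (g i t)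
  du : ∀ ψ, IsTest ψ → ∀ t, HasDerivAt (fun s => ∫ x, u s x * ψ x) (∫ x, v t x * ψ x) t
  dv : ∀ ψ, IsTest ψ → ∀ t, HasDerivAt (fun s => ∫ x, v s x * ψ x)
    ((∫ x, u t x * (Δ ψ x - m ^ 2 * ψ x)) - ∫ x, F t x * ψ x) t

theorem IsTest.const_mul {ψ : R3 → ℝ} (h : IsTest ψ) (c : ℝ) : IsTest (fun x => c * ψ x) :=
  ⟨contDiff_const.mul h.smooth, h.supp.mul_left⟩

theorem IsTest.add {ψ φ : R3 → ℝ} (h : IsTest ψ) (h' : IsTest φ) : IsTest (fun x => ψ x + φ x) :=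
  ⟨h.smooth.add h'.smooth, h.supp.add h'.supp⟩

theorem IsTest.sub {ψ φ : R3 → ℝ} (h : IsTest ψ) (h' : IsTest φ) : IsTest (fun x => ψ x - φ x) := by
  simpa [sub_eq_add_neg] using h.add (h'.const_mul (-1))

theorem IsTest.klein_gordon {ψ : R3 → ℝ} (h : IsTest ψ) (m : ℝ) :
    IsTest (fun x => Δ ψ x - m ^ 2 * ψ x) := h.laplacian.sub (h.const_mul _)

theorem MemL2loc.integrable_mul_test {f ψ : R3 → ℝ} (hf : MemL2loc f) (hψ : IsTest ψ) :
    Integrable (fun x => f x * ψ x) := hf.integrable_mul hψ.continuous hψ.supp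

namespace IsKG

variable {m : ℝ} {F F' u u' v v' : ℝ → R3 → ℝ} {g g' : Fin 3 → ℝ → R3 → ℝ}

theorem add (h : IsKG m F u v g) (h' : IsKG m F' u' v' g') :
    IsKG m (fun t x => F t x + F' t x) (fun t x => u t x + u' t x) (fun t x => v t x + v' t x)
      (fun i t x => g i t x + g' i t x) := by
  have key : ∀ {a b : ℝ → R3 → ℝ} {ψ : R3 → ℝ}, L2Cont a → L2Cont b → IsTest ψ → ∀ t,
      ∫ x, (a t x + b t x) * ψ x = (∫ x, a t x * ψ x) + ∫ x, b t x * ψ x := by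
    intro a b ψ ha hb hψ t
    simp only [add_mul]
    exact integral_add ((ha.mem t).integrable_mul_test hψ) ((hb.mem t).integrable_mul_test hψ)
  refine ⟨h.cF.add h'.cF, h.cu.add h'.cu, h.cv.add h'.cv, fun i => (h.cg i).add (h'.cg i),
    fun i t ψ hψ => ?_, fun ψ hψ t => ?_, fun ψ hψ t => ?_⟩
  · rw [key h.cu h'.cu (hψ.pd i), key (h.cg i) (h'.cg i) hψ, h.grad i t ψ hψ, h'.grad i t ψ hψ]
    ring
  · simp only [key h.cu h'.cu hψ, key h.cv h'.cv hψ]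
    exact (h.du ψ hψ t).add (h'.du ψ hψ t)
  · simp only [key h.cv h'.cv hψ, key h.cF h'.cF hψ, key h.cu h'.cu (hψ.klein_gordon m)]
    exact ((h.dv ψ hψ t).add (h'.dv ψ hψ t)).congr_deriv (by ring)

theorem smul (h : IsKG m F u v g) (c : ℝ) :
    IsKG m (fun t x => c * F t x) (fun t x => c * u t x) (fun t x => c * v t x)
      (fun i t x => c * g i t x) := by
  refine ⟨h.cF.smul continuous_const, h.cu.smul continuous_const, h.cv.smul continuous_const,
    fun i => (h.cg i).smul continuous_const,
    fun i t ψ hψ => ?_, fun ψ hψ t => ?_, fun ψ hψ t => ?_⟩ <;>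
    simp only [mul_assoc, integral_const_mul]
  · rw [h.grad i t ψ hψ]
    ring
  · exact (h.du ψ hψ t).const_mul c
  · exact ((h.dv ψ hψ t).const_mul c).congr_deriv (by ring)

theorem sub (h : IsKG m F u v g) (h' : IsKG m F' u' v' g') :
    IsKG m (fun t x => F t x - F' t x) (fun t x => u t x - u' t x) (fun t x => v t x - v' t x)
      (fun i t x => g i t x - g' i t x) := by
  simpa [sub_eq_add_neg] using h.add (h'.smul (-1))

/-- The equation is of second order in time, so it is invariant under t ↦ -t when the velocity
changes sign. Estimates for t ≥ 0 thereby extend to all times. -/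
theorem reverse (h : IsKG m F u v g) :
    IsKG m (fun t => F (-t)) (fun t => u (-t)) (fun t x => -v (-t) x) (fun i t => g i (-t)) := by
  have key : ∀ {f : ℝ → ℝ} {f' t : ℝ}, HasDerivAt f f' (-t) → HasDerivAt (fun s => f (-s)) (-f') t := by
    intro f f' t hf
    exact (hf.comp t (hasDerivAt_neg t)).congr_deriv (by simp)
  refine ⟨h.cF.comp continuous_neg, h.cu.comp continuous_neg, ?_,
    fun i => (h.cg i).comp continuous_neg, fun i t => h.grad i (-t),
    fun ψ hψ t => ?_, fun ψ hψ t => ?_⟩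
  · simpa using (h.cv.comp continuous_neg).smul (c := fun _ => -1) continuous_const
  · simpa [integral_neg] using key (h.du ψ hψ (-t))
  · have := (key (h.dv ψ hψ (-t))).fun_neg
    simpa [integral_neg] using this

theorem conv_pd (h : IsKG m F u v g) {η : R3 → ℝ} (hη : IsTest η) (i : Fin 3) (t : ℝ) :
    conv (u t) (pd i η) = conv (g i t) η := conv_pd_of_isWeakPd (h.grad i t) hη

/-- Mollifications of weak solutions are classical solutions. -/
theorem regular (h : IsKG m F u v g) {η : R3 → ℝ} (hη : IsTest η) :
    RegularSolution m (fun t => conv (u t) η) (fun t => conv (v t) η) (fun t => conv (F t) η)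
      (fun i t => conv (g i t) η) (fun i t => conv (v t) (pd i η))
      (fun i t => conv (g i t) (pd i η)) where
  cU := h.cu.continuous_conv hη
  cV := h.cv.continuous_conv hη
  cF := h.cF.continuous_conv hη
  cG i := (h.cg i).continuous_conv hη
  cD i := h.cv.continuous_conv (hη.pd i)
  cH i := (h.cg i).continuous_conv (hη.pd i)
  dU s x := h.du _ (hη.reflect x) s
  dV s x := by
    refine (h.dv _ (hη.reflect x) s).congr_deriv ?_
    congr 1
    rw [laplacian_reflect hη]
    have i1 : ∀ i, Integrable fun y => u s y * pd i (pd i η) (x - y) := fun i =>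
      (h.cu.mem s).integrable_mul_test (((hη.pd i).pd i).reflect x)
    have i2 : Integrable fun y => m ^ 2 * (u s y * η (x - y)) :=
      ((h.cu.mem s).integrable_mul_test (hη.reflect x)).const_mul _
    have e : ∀ y, u s y * (∑ i, pd i (pd i η) (x - y) - m ^ 2 * η (x - y)) =
        ∑ i, u s y * pd i (pd i η) (x - y) - m ^ 2 * (u s y * η (x - y)) := fun y => by
      rw [← Finset.mul_sum]
      ring
    simp_rw [e]
    rw [integral_sub (integrable_finsetSum _ fun i _ => i1 i) i2,
      integral_finsetSum _ fun i _ => i1 i, integral_const_mul]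
    congr 1
    refine Finset.sum_congr rfl fun i _ => ?_
    -- One of the two derivatives on `η` is moved onto `u`, which replaces `u` by its weak
    -- derivative `g i`.
    exact congrFun (h.conv_pd (hη.pd i) i s) x
  dG i s x := by
    -- No equation for the time derivative of `g` is available, so the gradient is first written
    -- through `u`.
    have e : (fun s => conv (g i s) η x) = fun s => conv (u s) (pd i η) x := by
      ext s
      rw [h.conv_pd hη]
    rw [e]
    exact h.du _ ((hη.pd i).reflect x) s
  diffV s := (contDiff_conv (h.cv.mem s) hη).differentiable (by simp)
  diffG i s := (contDiff_conv ((h.cg i).mem s) hη).differentiable (by simp)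
  pdV i s x := by rw [pd_conv (h.cv.mem s) hη]
  pdG i s x := by rw [pd_conv ((h.cg i).mem s) hη]

end IsKG

/-- The local energy of a field. -/
def energy (R : ℝ) (u v : R3 → ℝ) (g : Fin 3 → R3 → ℝ) : ℝ :=
  l2norm R u ^ 2 + ∑ i, l2norm R (g i) ^ 2 + l2norm R v ^ 2

theorem energy_nonneg (R : ℝ) (u v : R3 → ℝ) (g : Fin 3 → R3 → ℝ) : 0 ≤ energy R u v g := by
  unfold energy
  have : 0 ≤ ∑ i, l2norm R (g i) ^ 2 := Finset.sum_nonneg fun i _ => sq_nonneg _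
  positivity

section energy

variable {u v : R3 → ℝ} {g : Fin 3 → R3 → ℝ}

theorem integrableOn_density (hu : MemL2loc u) (hv : MemL2loc v) (hg : ∀ i, MemL2loc (g i))
    (R : ℝ) : IntegrableOn (density u v g) (Metric.ball 0 R) :=
  ((hu.integrableOn_sq R).add (integrable_finsetSum _ fun i _ => (hg i).integrableOn_sq R)).add
    (hv.integrableOn_sq R)

theorem energy_eq_integral (hu : MemL2loc u) (hv : MemL2loc v) (hg : ∀ i, MemL2loc (g i))
    (R : ℝ) : energy R u v g = ∫ x in Metric.ball 0 R, density u v g x := by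
  simp only [energy, l2norm_sq hu, l2norm_sq hv, l2norm_sq (hg _), density]
  have i1 := hu.integrableOn_sq R
  have i2 := fun i => (hg i).integrableOn_sq R
  have i3 : IntegrableOn (fun x => ∑ i, g i x ^ 2) (Metric.ball 0 R) :=
    integrable_finsetSum _ fun i _ => i2 i
  have i4 : IntegrableOn (fun x => u x ^ 2 + ∑ i, g i x ^ 2) (Metric.ball 0 R) := i1.add i3
  rw [integral_add i4 (hv.integrableOn_sq R), integral_add i1 i3,
    integral_finsetSum _ fun i _ => i2 i]

theorem energy_mono (hu : MemL2loc u) (hv : MemL2loc v) (hg : ∀ i, MemL2loc (g i))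
    {r R : ℝ} (h : r ≤ R) : energy r u v g ≤ energy R u v g := by
  unfold energy
  have := l2norm_nonneg
  gcongr
  · exact l2norm_nonneg _ _
  · exact l2norm_mono hu h
  · exact l2norm_nonneg _ _
  · exact l2norm_mono (hg _) h
  · exact l2norm_nonneg _ _
  · exact l2norm_mono hv h

theorem energy_conv_le (hu : MemL2loc u) (hv : MemL2loc v) (hg : ∀ i, MemL2loc (g i))
    {ε : ℝ} {η : R3 → ℝ} (hη : IsMollifier ε η) (R : ℝ) :
    energy R (conv u η) (conv v η) (fun i => conv (g i) η) ≤ energy (R + ε) u v g := by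
  unfold energy
  gcongr
  · exact l2norm_nonneg _ _
  · exact l2norm_conv_le hu hη R
  · exact l2norm_nonneg _ _
  · exact l2norm_conv_le (hg _) hη R
  · exact l2norm_nonneg _ _
  · exact l2norm_conv_le hv hη R

theorem energy_eq_zero_of_nonpos {R : ℝ} (hR : R ≤ 0) : energy R u v g = 0 := by
  simp [energy, l2norm_eq_zero_of_nonpos hR]

end energy

/-- The open ball is the increasing union of smaller balls. This makes room for the transition zone
of the cone weight and for the radius of the mollifier. -/
theorem setIntegral_ball_le_of_forall_lt {f : R3 → ℝ} {R K : ℝ}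
    (hf : IntegrableOn f (Metric.ball 0 R))
    (h : ∀ r < R, ∫ x in Metric.ball 0 r, f x ≤ K) : ∫ x in Metric.ball 0 R, f x ≤ K := by
  have hmono : Monotone fun n : ℕ => Metric.ball (0 : R3) (R - 1 / (n + 1)) := by
    intro n k hnk
    refine Metric.ball_subset_ball ?_
    have : (1 : ℝ) / (k + 1) ≤ 1 / (n + 1) := one_div_le_one_div_of_le (by positivity)
      (by exact_mod_cast Nat.succ_le_succ hnk)
    linarith
  have hU : ⋃ n : ℕ, Metric.ball (0 : R3) (R - 1 / (n + 1)) = Metric.ball 0 R := by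
    ext x
    simp only [Set.mem_iUnion, mem_ball_zero_iff]
    constructor
    · rintro ⟨n, hn⟩
      have : (0 : ℝ) < 1 / (n + 1) := by positivity
      linarith
    · intro hx
      obtain ⟨n, hn⟩ := exists_nat_one_div_lt (sub_pos.2 hx)
      exact ⟨n, by linarith⟩
  have ht := tendsto_setIntegral_of_monotone (μ := volume) (f := f)
    (fun n : ℕ => measurableSet_ball (x := (0 : R3)) (ε := R - 1 / (n + 1))) hmono (by rwa [hU])
  rw [hU] at ht
  refine le_of_tendsto ht (Eventually.of_forall fun n => h _ ?_)
  have : (0 : ℝ) < 1 / (n + 1) := by positivity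
  linarith

/-- A sequence of mollifiers concentrating at the origin. -/
theorem exists_mollifiers : ∃ η : ℕ → R3 → ℝ, (∀ n : ℕ, IsMollifier (1 / ((n : ℝ) + 1)) (η n)) ∧
    ∀ f, MemL2loc f → ∀ R, Tendsto (fun n => l2norm R (fun x => conv f (η n) x - f x)) atTop (𝓝 0) := by
  choose η hη using fun n : ℕ => exists_isMollifier (ε := 1 / ((n : ℝ) + 1)) (by positivity)
  refine ⟨η, hη, fun f hf R => ?_⟩
  rw [Metric.tendsto_atTop]
  intro δ hδ
  obtain ⟨ε₀, hε₀, h⟩ := exists_l2norm_conv_sub_le hf R (half_pos hδ)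
  obtain ⟨N, hN⟩ := exists_nat_one_div_lt hε₀
  refine ⟨N, fun n hn => ?_⟩
  have h1 : (1 : ℝ) / (n + 1) ≤ 1 / (N + 1) := one_div_le_one_div_of_le (by positivity)
      (by exact_mod_cast Nat.succ_le_succ hn)
  have := h _ (h1.trans hN.le) _ (hη n)
  rw [Real.dist_eq, sub_zero, abs_of_nonneg (l2norm_nonneg _ _)]
  linarith

theorem tendsto_l2norm_of_sub {f : ℕ → R3 → ℝ} {f₀ : R3 → ℝ} (hf : ∀ n, MemL2loc (f n))
    (hf₀ : MemL2loc f₀) {R : ℝ}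
    (h : Tendsto (fun n => l2norm R (fun x => f n x - f₀ x)) atTop (𝓝 0)) :
    Tendsto (fun n => l2norm R (f n)) atTop (𝓝 (l2norm R f₀)) :=
  tendsto_iff_dist_tendsto_zero.2 (squeeze_zero (fun _ => dist_nonneg)
    (fun n => abs_l2norm_sub_le (hf n) hf₀ R) h)

/-! ### The local energy inequality for weak solutions. -/

namespace IsKG

variable {m : ℝ} {F u v : ℝ → R3 → ℝ} {g : Fin 3 → ℝ → R3 → ℝ}

theorem memL2loc_conv {f η : R3 → ℝ} (hf : MemL2loc f) (hη : IsTest η) : MemL2loc (conv f η) :=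
  memL2loc_of_continuous (contDiff_conv hf hη).continuous

/-- The cone with b = R₀ + t is used. Its weight equals one on |x| < r at time t and vanishes
outside |x| < R₀ + t at time 0, while mollification enlarges the initial ball by ε ≤ R - R₀. All
losses fit between r and R. -/
theorem energy_conv_le_of_lt (h : IsKG m F u v g) {t : ℝ} (ht : 0 ≤ t) {β : ℝ → ℝ}
    (hβ : Continuous β) (hFβ : ∀ s ∈ Set.Icc 0 t, ∀ r, l2norm r (F s) ^ 2 ≤ β s)
    {r R₀ R : ℝ} (hr : 0 < r) (h1 : r < R₀) {ε : ℝ} (hε : ε ≤ R - R₀)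
    {η : R3 → ℝ} (hη : IsMollifier ε η) :
    energy r (conv (u t) η) (conv (v t) η) (fun i => conv (g i t) η) ≤
      Real.exp ((2 + m ^ 2) * t) *
        (energy (R + t) (u 0) (v 0) (fun i => g i 0) + ∫ s in 0..t, β s) := by
  have hreg := h.regular hη.test
  have hpos : 0 < R₀ ^ 2 - r ^ 2 := by nlinarith
  -- The steepness for which the argument of the smooth transition reaches 1 exactly at ‖x‖ = r at
  -- the final time.
  set N := (R₀ ^ 2 - r ^ 2)⁻¹ with hNdef
  have hN : 0 < N := inv_pos.2 hpos
  have mem : ∀ {f : ℝ → R3 → ℝ}, L2Cont f → ∀ s, MemL2loc (conv (f s) η) := fun hf s =>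
    memL2loc_conv (hf.mem s) hη.test
  have key := hreg.coneEnergy_le hN.le (b := R₀ + t) ht (by linarith) hβ (fun s hs => by
    rw [← l2norm_sq (mem h.cF s)]
    -- The bound on the source holds on balls of every radius, so the enlargement by 1 and by ε
    -- costs nothing.
    refine le_trans ?_ (hFβ s hs (R₀ + t + 1 + ε))
    have := l2norm_nonneg (R₀ + t + 1) (conv (F s) η)
    gcongr
    exact l2norm_conv_le (h.cF.mem s) hη _)
  have cw : ∀ s, Continuous (coneWeight N (R₀ + t) s) := fun s =>
    (continuous_coneWeight N (R₀ + t)).comp (continuous_const.prodMk continuous_id)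
  have cd : ∀ s, Continuous (density (conv (u s) η) (conv (v s) η) fun i => conv (g i s) η) :=
    fun s => hreg.continuous_density.comp (continuous_const.prodMk continuous_id)
  have iw : ∀ s, Integrable fun x => coneWeight N (R₀ + t) s x *
      density (conv (u s) η) (conv (v s) η) (fun i => conv (g i s) η) x := fun s =>
    ((cw s).mul (cd s)).integrable_of_hasCompactSupport
      (RegularSolution.hasCompactSupport_coneWeight hN.le _ s).mul_right
  have iden : ∀ s R, IntegrableOn (density (conv (u s) η) (conv (v s) η)
      fun i => conv (g i s) η) (Metric.ball 0 R) := fun s R =>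
    integrableOn_density (mem h.cu s) (mem h.cv s) (fun i => mem (h.cg i) s) R
  have lower : energy r (conv (u t) η) (conv (v t) η) (fun i => conv (g i t) η) ≤
      ∫ x, coneWeight N (R₀ + t) t x *
        density (conv (u t) η) (conv (v t) η) (fun i => conv (g i t) η) x := by
    rw [energy_eq_integral (mem h.cu t) (mem h.cv t) (fun i => mem (h.cg i) t),
      ← integral_indicator measurableSet_ball]
    refine integral_mono ((iden t r).integrable_indicator measurableSet_ball) (iw t) fun x => ?_
    by_cases hx : x ∈ Metric.ball (0 : R3) r
    · have : coneWeight N (R₀ + t) t x = 1 := by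
        refine Real.smoothTransition.one_of_one_le ?_
        rw [mem_ball_zero_iff] at hx
        have h3 : R₀ ^ 2 - r ^ 2 ≤ (R₀ + t - t) ^ 2 - ‖x‖ ^ 2 := by
          nlinarith [norm_nonneg x]
        calc (1 : ℝ) = N * (R₀ ^ 2 - r ^ 2) := (inv_mul_cancel₀ hpos.ne').symm
          _ ≤ _ := by gcongr
      simp [Set.indicator_of_mem hx, this]
    · rw [Set.indicator_of_notMem hx]
      exact mul_nonneg (coneWeight_nonneg _ _ _ _) (density_nonneg _ _ _ _)
  have upper : ∫ x, coneWeight N (R₀ + t) 0 x *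
        density (conv (u 0) η) (conv (v 0) η) (fun i => conv (g i 0) η) x ≤
      energy (R + t) (u 0) (v 0) (fun i => g i 0) := by
    refine le_trans ?_ (energy_mono (r := R₀ + t + ε) (h.cu.mem 0) (h.cv.mem 0)
      (fun i => (h.cg i).mem 0) (by linarith))
    refine le_trans ?_ (energy_conv_le (h.cu.mem 0) (h.cv.mem 0) (fun i => (h.cg i).mem 0) hη _)
    rw [energy_eq_integral (mem h.cu 0) (mem h.cv 0) (fun i => mem (h.cg i) 0),
      ← integral_indicator measurableSet_ball]
    refine integral_mono (iw 0) ((iden 0 _).integrable_indicator measurableSet_ball) fun x => ?_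
    by_cases hx : x ∈ Metric.ball (0 : R3) (R₀ + t)
    · simp only [Set.indicator_of_mem hx]
      exact mul_le_of_le_one_left (density_nonneg _ _ _ _) (coneWeight_le_one _ _ _ _)
    · simp only [Set.indicator_of_notMem hx]
      rw [coneWeight_eq_zero hN.le, zero_mul]
      rw [mem_ball_zero_iff, not_lt] at hx
      rwa [sub_zero, abs_of_nonneg (by linarith)]
  exact lower.trans (key.trans (by gcongr))

/-- The local energy inequality for weak solutions. -/
theorem energy_le (h : IsKG m F u v g) {t : ℝ} (ht : 0 ≤ t) {β : ℝ → ℝ}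
    (hβ : Continuous β) (hFβ : ∀ s ∈ Set.Icc 0 t, ∀ r, l2norm r (F s) ^ 2 ≤ β s) (R : ℝ) :
    energy R (u t) (v t) (fun i => g i t) ≤ Real.exp ((2 + m ^ 2) * t) *
        (energy (R + t) (u 0) (v 0) (fun i => g i 0) + ∫ s in 0..t, β s) := by
  obtain ⟨η, hη, hlim⟩ := exists_mollifiers
  have hI : 0 ≤ ∫ s in 0..t, β s := intervalIntegral.integral_nonneg ht fun s hs =>
    (sq_nonneg _).trans (hFβ s hs 0)
  have hE := energy_nonneg (R + t) (u 0) (v 0) (fun i => g i 0)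
  rw [energy_eq_integral (h.cu.mem t) (h.cv.mem t) fun i => (h.cg i).mem t]
  refine setIntegral_ball_le_of_forall_lt (integrableOn_density (h.cu.mem t) (h.cv.mem t)
    (fun i => (h.cg i).mem t) R) fun r hr => ?_
  rw [← energy_eq_integral (h.cu.mem t) (h.cv.mem t) fun i => (h.cg i).mem t]
  rcases le_or_gt r 0 with h0 | h0
  · rw [energy_eq_zero_of_nonpos h0]
    positivity
  have lim : ∀ {f : ℝ → R3 → ℝ}, L2Cont f →
      Tendsto (fun n => l2norm r (conv (f t) (η n)) ^ 2) atTop (𝓝 (l2norm r (f t) ^ 2)) :=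
    fun hf => (tendsto_l2norm_of_sub (fun n => memL2loc_conv (hf.mem t) (hη n).test) (hf.mem t)
      (hlim _ (hf.mem t) r)).pow 2
  have lim' : Tendsto (fun n => energy r (conv (u t) (η n)) (conv (v t) (η n))
      fun i => conv (g i t) (η n)) atTop (𝓝 (energy r (u t) (v t) fun i => g i t)) := by
    unfold energy
    exact ((lim h.cu).add (tendsto_finsetSum Finset.univ fun i _ => lim (h.cg i))).add (lim h.cv)
  refine le_of_tendsto lim' ?_
  -- Half of the gap between r and R serves the transition zone of the weight, the other half the
  -- mollification.
  have hgap : 0 < (R - r) / 2 := by linarith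
  obtain ⟨N, hN⟩ := exists_nat_one_div_lt hgap
  filter_upwards [eventually_ge_atTop N] with n hn
  have h1 : (1 : ℝ) / (n + 1) ≤ 1 / (N + 1) := one_div_le_one_div_of_le (by positivity)
      (by exact_mod_cast Nat.succ_le_succ hn)
  exact h.energy_conv_le_of_lt ht hβ hFβ h0 (R₀ := (r + R) / 2) (by linarith) (by linarith)
    (hη n)

theorem energy_le_of_bound (h : IsKG m F u v g) {t B : ℝ}
    (hF : ∀ s, |s| ≤ |t| → ∀ r, l2norm r (F s) ^ 2 ≤ B) (R : ℝ) :
    energy R (u t) (v t) (fun i => g i t) ≤ Real.exp ((2 + m ^ 2) * |t|) *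
        (energy (R + |t|) (u 0) (v 0) (fun i => g i 0) + |t| * B) := by
  rcases le_total 0 t with ht | ht
  · rw [abs_of_nonneg ht] at hF ⊢
    have := h.energy_le ht (β := fun _ => B) continuous_const (fun s hs r => hF s
      (by rw [abs_of_nonneg hs.1]; exact hs.2) r) R
    simpa using this
  · rw [abs_of_nonpos ht] at hF ⊢
    have := h.reverse.energy_le (t := -t) (by linarith) (β := fun _ => B) continuous_const
      (fun s hs r => hF (-s) (by rw [abs_neg, abs_of_nonneg hs.1]; exact hs.2) r) R
    simpa [energy, l2norm_neg] using this

end IsKG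

end

section

/-! ### Fourier multipliers acting on test functions -/

open scoped FourierTransform LineDeriv SchwartzMap

/-- A test function as a complex Schwartz function. -/
def IsTest.toSchwartz {a : R3 → ℝ} (h : IsTest a) : 𝓢(R3, ℂ) :=
  HasCompactSupport.toSchwartzMap (f := fun x => (a x : ℂ))
    (h.supp.comp_left (g := fun r : ℝ => (r : ℂ)) Complex.ofReal_zero)
    (Complex.ofRealCLM.contDiff.comp h.smooth)

theorem IsTest.toSchwartz_apply {a : R3 → ℝ} (h : IsTest a) (x : R3) : h.toSchwartz x = a x := rfl

/-- The Fourier transform of a real function. -/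
def hat (a : R3 → ℝ) : R3 → ℂ := 𝓕 (fun x => (a x : ℂ))

/-- The inverse Fourier transform of a real function. -/
def chk (a : R3 → ℝ) : R3 → ℂ := 𝓕⁻ (fun x => (a x : ℂ))

theorem IsTest.hat_eq {a : R3 → ℝ} (h : IsTest a) : hat a = ⇑(𝓕 h.toSchwartz : 𝓢(R3, ℂ)) := rfl

theorem IsTest.chk_eq {a : R3 → ℝ} (h : IsTest a) : chk a = ⇑(𝓕⁻ h.toSchwartz : 𝓢(R3, ℂ)) := by
  rw [SchwartzMap.fourierInv_coe]
  rfl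

theorem IsTest.lineDeriv_toSchwartz {a : R3 → ℝ} (h : IsTest a) (i : Fin 3) :
    ∂_{EuclideanSpace.single i (1 : ℝ)} h.toSchwartz = (h.pd i).toSchwartz := by
  ext x
  rw [SchwartzMap.lineDerivOp_apply_eq_fderiv, IsTest.toSchwartz_apply]
  have h1 : HasFDerivAt (⇑h.toSchwartz) (Complex.ofRealCLM.comp (fderiv ℝ a x)) x :=
    Complex.ofRealCLM.hasFDerivAt.comp x
      (h.smooth.differentiable (by simp)).differentiableAt.hasFDerivAt
  rw [h1.fderiv]
  rfl

theorem inner_single_eq (k : R3) (i : Fin 3) :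
    inner ℝ k (EuclideanSpace.single i (1 : ℝ)) = k i := by
  rw [EuclideanSpace.inner_single_right, one_mul]
  rfl

theorem hasTemperateGrowth_inner (m : R3) :
    Function.HasTemperateGrowth (fun k : R3 => inner ℝ k m) :=
  ((innerSL ℝ).flip m).hasTemperateGrowth

theorem IsTest.hat_pd {a : R3 → ℝ} (h : IsTest a) (i : Fin 3) (k : R3) :
    hat (FieldParticle.pd i a) k = 2 * Real.pi * Complex.I * k i * hat a k := by
  rw [(h.pd i).hat_eq, h.hat_eq, ← h.lineDeriv_toSchwartz, SchwartzMap.fourier_lineDerivOp_eq,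
    smul_apply, SchwartzMap.smulLeftCLM_apply_apply (hasTemperateGrowth_inner _),
    inner_single_eq]
  simp [mul_assoc]

theorem IsTest.chk_pd {a : R3 → ℝ} (h : IsTest a) (i : Fin 3) (k : R3) :
    chk (FieldParticle.pd i a) k = -(2 * Real.pi * Complex.I) * k i * chk a k := by
  rw [(h.pd i).chk_eq, h.chk_eq, ← h.lineDeriv_toSchwartz, SchwartzMap.fourierInv_lineDerivOp_eq,
    smul_apply, SchwartzMap.smulLeftCLM_apply_apply (hasTemperateGrowth_inner _),
    inner_single_eq]
  simp [mul_assoc]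

theorem IsTest.chk_laplacian {a : R3 → ℝ} (h : IsTest a) (k : R3) :
    chk (Δ a) k = -((2 * Real.pi * ‖k‖) ^ 2 : ℝ) * chk a k := by
  have e : h.laplacian.toSchwartz = ∑ i, ((h.pd i).pd i).toSchwartz := by
    ext x
    rw [sum_apply]
    simp only [IsTest.toSchwartz_apply]
    rw [FieldParticle.laplacian_eq_sum h]
    push_cast
    rfl
  rw [h.laplacian.chk_eq, e, FourierTransform.fourierInv_sum, sum_apply]
  have e2 : ∀ i, (𝓕⁻ ((h.pd i).pd i).toSchwartz : 𝓢(R3, ℂ)) k = -((2 * Real.pi) ^ 2 * k i ^ 2 : ℝ) * chk a k := by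
    intro i
    rw [← ((h.pd i).pd i).chk_eq, (h.pd i).chk_pd, h.chk_pd]
    push_cast
    ring_nf
    rw [Complex.I_sq]
    ring
  simp only [e2]
  rw [← Finset.sum_mul, Finset.sum_neg_distrib, ← Complex.ofReal_sum, ← Finset.mul_sum]
  congr 3
  rw [mul_pow _ ‖k‖, EuclideanSpace.norm_sq_eq, mul_pow]
  simp

theorem IsTest.continuous_hat {a : R3 → ℝ} (h : IsTest a) : Continuous (hat a) := by
  rw [h.hat_eq]
  exact SchwartzMap.continuous _

theorem IsTest.continuous_chk {a : R3 → ℝ} (h : IsTest a) : Continuous (chk a) := by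
  rw [h.chk_eq]
  exact SchwartzMap.continuous _

theorem IsTest.integrable_weight_hat {a : R3 → ℝ} (h : IsTest a) :
    Integrable (fun k => (1 + ‖k‖ ^ 2) ^ 2 * ‖hat a k‖) := by
  rw [h.hat_eq]
  have i0 := (𝓕 h.toSchwartz : 𝓢(R3, ℂ)).integrable_pow_mul volume 0
  have i2 := (𝓕 h.toSchwartz : 𝓢(R3, ℂ)).integrable_pow_mul volume 2
  have i4 := (𝓕 h.toSchwartz : 𝓢(R3, ℂ)).integrable_pow_mul volume 4
  refine ((i0.add (i2.const_mul 2)).add i4).congr (Eventually.of_forall fun k => ?_)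
  simp only [Pi.add_apply]
  ring

theorem IsTest.exists_chk_bound {a : R3 → ℝ} (h : IsTest a) : ∃ C, ∀ k, ‖chk a k‖ ≤ C := by
  rw [h.chk_eq]
  exact ⟨_, SchwartzMap.norm_le_seminorm ℝ _⟩

/-- The Fourier multiplier with symbol `c`, applied to the real function `a`. -/
def mult (c : R3 → ℝ) (a : R3 → ℝ) (x : R3) : ℝ := (𝓕⁻ (fun k => (c k : ℂ) * hat a k) x).re

/-- The symbol `c` is continuous and grows at most like `‖k‖ ^ 4`. -/
structure IsSymbol (c : R3 → ℝ) : Prop where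
  cont : Continuous c
  bound : ∃ C, ∀ k, |c k| ≤ C * (1 + ‖k‖ ^ 2) ^ 2

theorem IsSymbol.integrable {c a : R3 → ℝ} (hc : IsSymbol c) (ha : IsTest a) :
    Integrable (fun k => (c k : ℂ) * hat a k) := by
  obtain ⟨C, hC⟩ := hc.bound
  refine (ha.integrable_weight_hat.const_mul C).mono'
    ((Complex.continuous_ofReal.comp hc.cont).mul ha.continuous_hat).aestronglyMeasurable
    (Eventually.of_forall fun k => ?_)
  rw [norm_mul, Complex.norm_real, Real.norm_eq_abs, ← mul_assoc]
  gcongr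
  exact hC k

theorem continuous_fourierInv {f : R3 → ℂ} (hf : Integrable f) : Continuous (𝓕⁻ f) :=
  VectorFourier.fourierIntegral_continuous Real.continuous_fourierChar
    (by simp only [LinearMap.neg_apply, innerₗ_apply_apply]; fun_prop) hf

theorem continuous_mult {c a : R3 → ℝ} (hc : IsSymbol c) (ha : IsTest a) :
    Continuous (mult c a) :=
  Complex.continuous_re.comp (continuous_fourierInv (hc.integrable ha))

/-- An inverse Fourier transform is bounded, uniformly in x, by the L¹ norm of the function
transformed. -/
theorem abs_mult_sub_le {c c' a : R3 → ℝ} (hc : IsSymbol c) (hc' : IsSymbol c') (ha : IsTest a)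
    (x : R3) : |mult c a x - mult c' a x| ≤ ∫ k, |c k - c' k| * ‖hat a k‖ := by
  have conv : ∀ {f : R3 → ℂ}, Integrable f →
      Integrable fun k => Real.fourierChar (inner ℝ k x) • f k := fun {f} hf => by
    have := (VectorFourier.fourierIntegral_convergent_iff (L := -innerₗ R3) (μ := volume) (f := f)
      Real.continuous_fourierChar (by
        simp only [LinearMap.neg_apply, innerₗ_apply_apply]; fun_prop) x).2 hf
    simpa using this
  rw [mult, mult, ← Complex.sub_re, Real.fourierInv_eq, Real.fourierInv_eq,
    ← integral_sub (conv (hc.integrable ha)) (conv (hc'.integrable ha))]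
  refine (Complex.abs_re_le_norm _).trans ((norm_integral_le_integral_norm _).trans (le_of_eq ?_))
  congr 1
  ext k
  rw [← smul_sub, Circle.norm_smul, ← sub_mul, ← Complex.ofReal_sub, norm_mul, Complex.norm_real,
    Real.norm_eq_abs]

theorem mult_one {a : R3 → ℝ} (ha : IsTest a) : mult (fun _ => 1) a = a := by
  ext x
  have : (fun k => ((1 : ℝ) : ℂ) * hat a k) = hat a := by ext; simp
  rw [mult, this, ha.hat_eq, ← SchwartzMap.fourierInv_coe, FourierTransform.fourierInv_fourier_eq,
    ha.toSchwartz_apply, Complex.ofReal_re]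

theorem mult_zero (a : R3 → ℝ) : mult (fun _ => 0) a = fun _ => 0 := by
  ext x
  simp [mult, Real.fourierInv_eq]

/-- The real density that represents the pairing of `a` and `ψ` in Fourier space. -/
def fourierPairing (a ψ : R3 → ℝ) (k : R3) : ℝ := (hat a k * chk ψ k).re

/-- Fubini moves the inverse Fourier transform, whose kernel is symmetric, from the first factor to
`ψ`. Weak statements about `mult c a` thereby become integrals in which only the symbol depends on
time. -/
theorem integral_mult_mul {c a ψ : R3 → ℝ} (hc : IsSymbol c) (ha : IsTest a) (hψ : IsTest ψ) :
    ∫ x, mult c a x * ψ x = ∫ k, c k * fourierPairing a ψ k := by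
  have hf := hc.integrable ha
  have hg : Integrable fun x => (ψ x : ℂ) := hψ.toSchwartz.integrable
  have key : ∫ x, 𝓕⁻ (fun k => (c k : ℂ) * hat a k) x * (ψ x : ℂ) =
      ∫ k, ((c k : ℂ) * hat a k) * chk ψ k := by
    have := VectorFourier.integral_bilin_fourierIntegral_eq_flip (ContinuousLinearMap.mul ℂ ℂ)
      (L := -innerₗ R3) (μ := volume) (ν := volume) Real.continuous_fourierChar
      (by simp only [LinearMap.neg_apply, innerₗ_apply_apply]; fun_prop) hf hg
    have hflip : (-innerₗ R3).flip = -innerₗ R3 := by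
      ext x y
      simp [real_inner_comm]
    rw [hflip] at this
    exact this
  have hl : Integrable fun x => 𝓕⁻ (fun k => (c k : ℂ) * hat a k) x * (ψ x : ℂ) :=
    ((continuous_fourierInv hf).mul (Complex.continuous_ofReal.comp
      hψ.continuous)).integrable_of_hasCompactSupport
      (hψ.supp.comp_left (g := fun r : ℝ => (r : ℂ)) Complex.ofReal_zero).mul_left
  obtain ⟨C, hC⟩ := hψ.exists_chk_bound
  have hr : Integrable fun k => ((c k : ℂ) * hat a k) * chk ψ k := by
    refine (hf.bdd_mul hψ.continuous_chk.aestronglyMeasurable (Eventually.of_forall hC)).congr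
      (Eventually.of_forall fun k => mul_comm _ _)
  have e := congrArg Complex.re key
  rw [← RCLike.re_eq_complex_re, ← integral_re hl, ← integral_re hr] at e
  simp only [RCLike.re_eq_complex_re] at e
  have l : (fun x => mult c a x * ψ x) =
      fun x => (𝓕⁻ (fun k => (c k : ℂ) * hat a k) x * (ψ x : ℂ)).re := by
    ext x
    rw [Complex.re_mul_ofReal]
    rfl
  have r : (fun k => c k * fourierPairing a ψ k) =
      fun k => (((c k : ℂ) * hat a k) * chk ψ k).re := by
    ext k
    rw [mul_assoc, Complex.re_ofReal_mul]
    rfl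
  rw [l, r]
  exact e

theorem fourierPairing_pd {a ψ : R3 → ℝ} (ha : IsTest a) (hψ : IsTest ψ) (i : Fin 3) (k : R3) :
    fourierPairing a (pd i ψ) k = -fourierPairing (pd i a) ψ k := by
  rw [fourierPairing, fourierPairing, hψ.chk_pd, ha.hat_pd, ← Complex.neg_re]
  congr 1
  ring

theorem fourierPairing_laplacian {a ψ : R3 → ℝ} (hψ : IsTest ψ) (k : R3) :
    fourierPairing a (Δ ψ) k = -(2 * Real.pi * ‖k‖) ^ 2 * fourierPairing a ψ k := by
  rw [fourierPairing, fourierPairing, hψ.chk_laplacian, ← Complex.re_ofReal_mul]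
  congr 1
  push_cast
  ring

theorem continuous_fourierPairing {a ψ : R3 → ℝ} (ha : IsTest a) (hψ : IsTest ψ) :
    Continuous (fourierPairing a ψ) :=
  Complex.continuous_re.comp (ha.continuous_hat.mul hψ.continuous_chk)

theorem integrable_weight_fourierPairing {a ψ : R3 → ℝ} (ha : IsTest a) (hψ : IsTest ψ) :
    Integrable (fun k => (1 + ‖k‖ ^ 2) ^ 2 * |fourierPairing a ψ k|) := by
  obtain ⟨C, hC⟩ := hψ.exists_chk_bound
  refine (ha.integrable_weight_hat.const_mul C).mono'
    ((by fun_prop : Continuous fun k : R3 => (1 + ‖k‖ ^ 2) ^ 2).mul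
      (continuous_fourierPairing ha hψ).abs).aestronglyMeasurable
    (Eventually.of_forall fun k => ?_)
  rw [Real.norm_of_nonneg (by positivity)]
  calc (1 + ‖k‖ ^ 2) ^ 2 * |fourierPairing a ψ k|
      ≤ (1 + ‖k‖ ^ 2) ^ 2 * (‖hat a k‖ * ‖chk ψ k‖) := by
        gcongr
        rw [← norm_mul]
        exact Complex.abs_re_le_norm _
    _ ≤ (1 + ‖k‖ ^ 2) ^ 2 * (‖hat a k‖ * C) := by
        gcongr
        exact hC k
    _ = _ := by ring

theorem integrable_symbol_fourierPairing {c a ψ : R3 → ℝ} (hc : IsSymbol c) (ha : IsTest a)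
    (hψ : IsTest ψ) : Integrable (fun k => c k * fourierPairing a ψ k) := by
  obtain ⟨C, hC⟩ := hc.bound
  refine ((integrable_weight_fourierPairing ha hψ).const_mul C).mono'
    (hc.cont.mul (continuous_fourierPairing ha hψ)).aestronglyMeasurable
    (Eventually.of_forall fun k => ?_)
  rw [norm_mul, Real.norm_eq_abs, Real.norm_eq_abs, ← mul_assoc]
  gcongr
  exact hC k

/-- A continuous curve of symbols, locally uniformly of polynomial growth. -/
structure IsSymbolCurve (c : ℝ → R3 → ℝ) : Prop where
  cont : Continuous fun p : ℝ × R3 => c p.1 p.2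
  bound : ∀ T, ∃ C, ∀ t, |t| ≤ T → ∀ k, |c t k| ≤ C * (1 + ‖k‖ ^ 2) ^ 2

theorem IsSymbolCurve.symbol {c : ℝ → R3 → ℝ} (h : IsSymbolCurve c) (t : ℝ) : IsSymbol (c t) :=
  ⟨h.cont.comp (continuous_const.prodMk continuous_id), by
    obtain ⟨C, hC⟩ := h.bound |t|
    exact ⟨C, hC t le_rfl⟩⟩

/-- The symbols converge pointwise with a common polynomial bound and `hat a` decays rapidly.
Dominated convergence therefore gives convergence uniformly in x, hence in L² of every ball. -/
theorem l2Cont_mult {c : ℝ → R3 → ℝ} (hc : IsSymbolCurve c) {a : R3 → ℝ} (ha : IsTest a) :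
    L2Cont fun t => mult (c t) a := by
  refine ⟨fun t => memL2loc_of_continuous (continuous_mult (hc.symbol t) ha), fun t R => ?_⟩
  set δ : ℝ → ℝ := fun s => ∫ k, |c s k - c t k| * ‖hat a k‖ with hδ
  have hδ0 : ∀ s, 0 ≤ δ s := fun s => integral_nonneg fun k => by positivity
  have hlim : Tendsto δ (𝓝 t) (𝓝 0) := by
    obtain ⟨C, hC⟩ := hc.bound (|t| + 1)
    have h0 : (0 : ℝ) = ∫ k, |c t k - c t k| * ‖hat a k‖ := by simp
    rw [h0]
    refine tendsto_integral_filter_of_dominated_convergence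
      (fun k => 2 * C * ((1 + ‖k‖ ^ 2) ^ 2 * ‖hat a k‖)) (Eventually.of_forall fun s =>
        (((hc.symbol s).cont.sub (hc.symbol t).cont).abs.mul
          ha.continuous_hat.norm).aestronglyMeasurable) ?_
      (ha.integrable_weight_hat.const_mul _) (Eventually.of_forall fun k => ?_)
    · filter_upwards [Metric.ball_mem_nhds t one_pos] with s hs
      refine Eventually.of_forall fun k => ?_
      rw [Real.norm_of_nonneg (by positivity)]
      have hs' : |s| ≤ |t| + 1 := by
        rw [Metric.mem_ball, Real.dist_eq] at hs
        linarith [abs_sub_abs_le_abs_sub s t]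
      have h1 := hC s hs' k
      have h2 := hC t (by linarith) k
      have h3 := abs_sub (c s k) (c t k)
      rw [← mul_assoc]
      gcongr
      linarith
    · have : Continuous fun s => |c s k - c t k| * ‖hat a k‖ :=
        (((hc.cont.comp (continuous_id.prodMk continuous_const)).sub continuous_const).abs).mul
          continuous_const
      exact this.tendsto t
  refine squeeze_zero (fun _ => l2norm_nonneg _ _) (fun s => ?_)
    (by simpa using hlim.mul_const (√(volume.real (Metric.ball (0 : R3) R))))
  exact l2norm_le_of_bound (hδ0 s) fun x _ => abs_mult_sub_le (hc.symbol s) (hc.symbol t) ha x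

theorem hasDerivAt_integral_symbol {c c' : ℝ → R3 → ℝ} (hc : IsSymbolCurve c)
    (hc' : IsSymbolCurve c') (hd : ∀ t k, HasDerivAt (fun s => c s k) (c' t k) t)
    {a ψ : R3 → ℝ} (ha : IsTest a) (hψ : IsTest ψ) (t : ℝ) :
    HasDerivAt (fun s => ∫ k, c s k * fourierPairing a ψ k)
      (∫ k, c' t k * fourierPairing a ψ k) t := by
  obtain ⟨C, hC⟩ := hc'.bound (|t| + 1)
  refine (hasDerivAt_integral_of_dominated_loc_of_deriv_le (s := Metric.ball t 1)
    (bound := fun k => C * ((1 + ‖k‖ ^ 2) ^ 2 * |fourierPairing a ψ k|))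
    (Metric.ball_mem_nhds t one_pos)
    (Eventually.of_forall fun s =>
      (integrable_symbol_fourierPairing (hc.symbol s) ha hψ).aestronglyMeasurable)
    (integrable_symbol_fourierPairing (hc.symbol t) ha hψ)
    (integrable_symbol_fourierPairing (hc'.symbol t) ha hψ).aestronglyMeasurable
    (Eventually.of_forall fun k s hs => ?_)
    ((integrable_weight_fourierPairing ha hψ).const_mul C)
    (Eventually.of_forall fun k s _ => (hd s k).mul_const _)).2
  rw [norm_mul, Real.norm_eq_abs, Real.norm_eq_abs, ← mul_assoc]
  have hs' : |s| ≤ |t| + 1 := by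
    rw [Metric.mem_ball, Real.dist_eq] at hs
    linarith [abs_sub_abs_le_abs_sub s t]
  gcongr
  exact hC s hs' k

/-- The squared dispersion relation. -/
def disp (m : ℝ) (k : R3) : ℝ := (2 * Real.pi * ‖k‖) ^ 2 + m ^ 2

/-- `c` solves the oscillator equation `c̈ = -disp m · c - h` for each wave vector. -/
structure IsMode (m : ℝ) (h : ℝ → ℝ) (c c' : ℝ → R3 → ℝ) : Prop where
  source : Continuous h
  cont : Continuous fun p : ℝ × R3 => c p.1 p.2
  cont' : Continuous fun p : ℝ × R3 => c' p.1 p.2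
  deriv : ∀ t k, HasDerivAt (fun s => c s k) (c' t k) t
  deriv' : ∀ t k, HasDerivAt (fun s => c' s k) (-disp m k * c t k - h t) t
  bound : ∀ T, ∃ C, ∀ t, |t| ≤ T → ∀ k, |c t k| ≤ C * (1 + ‖k‖ ^ 2)
  bound' : ∀ T, ∃ C, ∀ t, |t| ≤ T → ∀ k, |c' t k| ≤ C * (1 + ‖k‖ ^ 2)

theorem one_le_weight (k : R3) : 1 ≤ 1 + ‖k‖ ^ 2 := by nlinarith [sq_nonneg ‖k‖]

theorem isSymbolCurve_of_bound {c : ℝ → R3 → ℝ} (hc : Continuous fun p : ℝ × R3 => c p.1 p.2)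
    (h : ∀ T, ∃ C, ∀ t, |t| ≤ T → ∀ k, |c t k| ≤ C * (1 + ‖k‖ ^ 2)) : IsSymbolCurve c := by
  refine ⟨hc, fun T => ?_⟩
  obtain ⟨C, hC⟩ := h T
  refine ⟨|C|, fun t ht k => (hC t ht k).trans ?_⟩
  have := one_le_weight k
  gcongr
  · exact le_abs_self C
  · nlinarith

theorem disp_nonneg (m : ℝ) (k : R3) : 0 ≤ disp m k := by unfold disp; positivity

theorem disp_le (m : ℝ) (k : R3) : disp m k ≤ ((2 * Real.pi) ^ 2 + m ^ 2) * (1 + ‖k‖ ^ 2) := by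
  unfold disp
  have h1 : 0 ≤ m ^ 2 * ‖k‖ ^ 2 := by positivity
  have h2 : 0 ≤ (2 * Real.pi) ^ 2 := by positivity
  rw [mul_pow]
  nlinarith

theorem continuous_disp (m : ℝ) : Continuous (disp m) := by unfold disp; fun_prop

/-- Solutions of the forced Klein–Gordon equation from solutions of the oscillator equation. -/
theorem IsMode.isKG {m : ℝ} {h : ℝ → ℝ} {c c' : ℝ → R3 → ℝ} (hc : IsMode m h c c') {a : R3 → ℝ}
    (ha : IsTest a) :
    IsKG m (fun t x => h t * a x) (fun t => mult (c t) a) (fun t => mult (c' t) a)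
      (fun i t => mult (c t) (pd i a)) := by
  have sc := isSymbolCurve_of_bound hc.cont hc.bound
  have sc' := isSymbolCurve_of_bound hc.cont' hc.bound'
  -- The acceleration of the mode multiplies a quadratically growing symbol by the quadratic
  -- dispersion relation; this is why symbols are allowed fourth-order growth.
  have sc'' : IsSymbolCurve fun t k => -disp m k * c t k - h t := by
    refine ⟨((((continuous_disp m).comp continuous_snd).neg).mul hc.cont).sub
      (hc.source.comp continuous_fst), fun T => ?_⟩
    obtain ⟨C, hC⟩ := hc.bound T
    obtain ⟨B, hB⟩ := (isCompact_Icc (a := -T) (b := T)).exists_bound_of_continuousOn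
      hc.source.continuousOn
    refine ⟨((2 * Real.pi) ^ 2 + m ^ 2) * |C| + |B|, fun t ht k => ?_⟩
    have h1 : |c t k| ≤ |C| * (1 + ‖k‖ ^ 2) := (hC t ht k).trans (by
      have := one_le_weight k
      gcongr
      exact le_abs_self C)
    have h2 : |h t| ≤ |B| := (hB t (abs_le.1 ht)).trans (le_abs_self B)
    have h3 := disp_le m k
    have h4 := disp_nonneg m k
    have h5 := one_le_weight k
    calc |-disp m k * c t k - h t| ≤ |-disp m k * c t k| + |h t| := abs_sub _ _
      _ = disp m k * |c t k| + |h t| := by rw [abs_mul, abs_neg, abs_of_nonneg h4]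
      _ ≤ (((2 * Real.pi) ^ 2 + m ^ 2) * (1 + ‖k‖ ^ 2)) * (|C| * (1 + ‖k‖ ^ 2)) + |B| := by gcongr
      _ ≤ (((2 * Real.pi) ^ 2 + m ^ 2) * (1 + ‖k‖ ^ 2)) * (|C| * (1 + ‖k‖ ^ 2)) +
          |B| * (1 + ‖k‖ ^ 2) ^ 2 := by
        gcongr
        exact le_mul_of_one_le_right (abs_nonneg _) (one_le_pow₀ h5)
      _ = _ := by ring
  refine ⟨(L2Cont.const ha.memL2loc).smul hc.source, l2Cont_mult sc ha, l2Cont_mult sc' ha,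
    fun i => l2Cont_mult sc (ha.pd i), fun i t ψ hψ => ?_, fun ψ hψ t => ?_, fun ψ hψ t => ?_⟩
  · rw [integral_mult_mul (sc.symbol t) ha (hψ.pd i),
      integral_mult_mul (sc.symbol t) (ha.pd i) hψ, ← integral_neg]
    simp only [fourierPairing_pd ha hψ, mul_neg]
  · simp only [fun s => integral_mult_mul (sc.symbol s) ha hψ,
      fun s => integral_mult_mul (sc'.symbol s) ha hψ]
    exact hasDerivAt_integral_symbol sc sc' hc.deriv ha hψ t
  · simp only [fun s => integral_mult_mul (sc'.symbol s) ha hψ]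
    refine (hasDerivAt_integral_symbol sc' sc'' hc.deriv' ha hψ t).congr_deriv ?_
    have one : IsSymbol fun _ : R3 => (1 : ℝ) :=
      ⟨continuous_const, 1, fun k => by
        have := one_le_pow₀ (n := 2) (one_le_weight k)
        simpa using this⟩
    -- Multiplication by the symbol 1 is the identity, so the source can be paired in Fourier space
    -- as well.
    have e1 : ∫ x, a x * ψ x = ∫ k, fourierPairing a ψ k := by
      have := integral_mult_mul one ha hψ
      rw [mult_one ha] at this
      simpa using this
    have mem := (l2Cont_mult sc ha).mem t
    have e2 : ∫ x, mult (c t) a x * (Δ ψ x - m ^ 2 * ψ x) =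
        ∫ k, c t k * (-disp m k * fourierPairing a ψ k) := by
      have j1 := integral_mult_mul (sc.symbol t) ha hψ.laplacian
      have j2 := integral_mult_mul (sc.symbol t) ha hψ
      have e3 : ∀ x, mult (c t) a x * (Δ ψ x - m ^ 2 * ψ x) =
          mult (c t) a x * Δ ψ x - m ^ 2 * (mult (c t) a x * ψ x) := fun x => by ring
      simp_rw [e3]
      rw [integral_sub (mem.integrable_mul_test hψ.laplacian)
        ((mem.integrable_mul_test hψ).const_mul _), integral_const_mul, j1, j2,
        ← integral_const_mul, ← integral_sub
          (integrable_symbol_fourierPairing (sc.symbol t) ha hψ.laplacian)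
          ((integrable_symbol_fourierPairing (sc.symbol t) ha hψ).const_mul _)]
      congr 1
      ext k
      rw [fourierPairing_laplacian hψ, disp]
      ring
    have e4 : ∫ x, h t * a x * ψ x = h t * ∫ k, fourierPairing a ψ k := by
      rw [← e1, ← integral_const_mul]
      simp only [mul_assoc]
    have i1 : Integrable (fourierPairing a ψ) := by
      simpa using integrable_symbol_fourierPairing one ha hψ
    have i2 : Integrable fun k => c t k * (-disp m k * fourierPairing a ψ k) := by
      refine ((integrable_symbol_fourierPairing (sc''.symbol t) ha hψ).add
        (i1.const_mul (h t))).congr (Eventually.of_forall fun k => ?_)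
      simp only [Pi.add_apply]
      ring
    rw [e2, e4, ← integral_const_mul, ← integral_sub i2 (i1.const_mul _)]
    congr 1
    ext k
    ring

end

section

/-! ### The fundamental modes -/

/-- The mode with value one and velocity zero at time zero. -/
def cosMode (m : ℝ) (t : ℝ) (k : R3) : ℝ := Real.cos (√(disp m k) * t)

/-- The mode with value zero and velocity one at time zero. -/
def sinMode (m : ℝ) (t : ℝ) (k : R3) : ℝ := t * Real.sinc (√(disp m k) * t)

theorem continuous_cosMode (m : ℝ) : Continuous fun p : ℝ × R3 => cosMode m p.1 p.2 := by
  have := continuous_disp m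
  unfold cosMode
  fun_prop

theorem continuous_sinMode (m : ℝ) : Continuous fun p : ℝ × R3 => sinMode m p.1 p.2 := by
  have := continuous_disp m
  have h : Continuous fun p : ℝ × R3 => √(disp m p.2) * p.1 := by fun_prop
  exact continuous_fst.mul (Real.continuous_sinc.comp h)

/-- The form t sinc(λt) stands for sin(λt)/λ with λ = √(disp m k). It stays continuous at λ = 0,
which occurs at k = 0 for a massless field. -/
theorem sqrt_disp_mul_sinMode (m t : ℝ) (k : R3) :
    √(disp m k) * sinMode m t k = Real.sin (√(disp m k) * t) := by
  unfold sinMode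
  by_cases h : √(disp m k) * t = 0
  · rw [← mul_assoc, h]
    simp
  · rw [Real.sinc_of_ne_zero h, ← mul_assoc, mul_comm, div_mul_cancel₀ _ h]

theorem disp_mul_sinMode (m t : ℝ) (k : R3) :
    disp m k * sinMode m t k = √(disp m k) * Real.sin (√(disp m k) * t) := by
  rw [← sqrt_disp_mul_sinMode, ← mul_assoc, Real.mul_self_sqrt (disp_nonneg m k)]

theorem cosMode_sq_add (m t : ℝ) (k : R3) :
    cosMode m t k ^ 2 + disp m k * sinMode m t k ^ 2 = 1 := by
  have h : disp m k * sinMode m t k ^ 2 = Real.sin (√(disp m k) * t) ^ 2 := by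
    rw [← sqrt_disp_mul_sinMode, mul_pow, Real.sq_sqrt (disp_nonneg m k)]
  rw [h, cosMode, Real.cos_sq_add_sin_sq]

theorem hasDerivAt_cosMode (m t : ℝ) (k : R3) :
    HasDerivAt (fun s => cosMode m s k) (-(disp m k * sinMode m t k)) t := by
  have h1 : HasDerivAt (fun s => √(disp m k) * s) (√(disp m k)) t := by
    simpa using (hasDerivAt_id t).const_mul (√(disp m k))
  exact h1.cos.congr_deriv (by rw [disp_mul_sinMode]; ring)

theorem hasDerivAt_sinMode (m t : ℝ) (k : R3) :
    HasDerivAt (fun s => sinMode m s k) (cosMode m t k) t := by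
  -- At frequency zero the mode is simply t, with velocity one.
  by_cases h : √(disp m k) = 0
  · simp only [sinMode, cosMode, h, zero_mul, Real.sinc_zero, mul_one, Real.cos_zero]
    exact hasDerivAt_id t
  · have h1 : HasDerivAt (fun s => √(disp m k) * s) (√(disp m k)) t := by
      simpa using (hasDerivAt_id t).const_mul (√(disp m k))
    have e : (fun s => sinMode m s k) = fun s => Real.sin (√(disp m k) * s) / √(disp m k) := by
      ext s
      rw [← sqrt_disp_mul_sinMode, mul_div_cancel_left₀ _ h]
    rw [e]
    exact (h1.sin.div_const _).congr_deriv (by rw [cosMode]; field_simp)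

theorem abs_cosMode_le (m t : ℝ) (k : R3) : |cosMode m t k| ≤ 1 := Real.abs_cos_le_one _

theorem abs_sinMode_le (m t : ℝ) (k : R3) : |sinMode m t k| ≤ |t| := by
  rw [sinMode, abs_mul]
  exact mul_le_of_le_one_right (abs_nonneg t) (Real.abs_sinc_le_one _)

theorem abs_disp_mul_sinMode_le {m T t : ℝ} (ht : |t| ≤ T) (k : R3) :
    |disp m k * sinMode m t k| ≤ ((2 * Real.pi) ^ 2 + m ^ 2) * T * (1 + ‖k‖ ^ 2) := by
  rw [abs_mul, abs_of_nonneg (disp_nonneg m k)]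
  calc disp m k * |sinMode m t k| ≤ (((2 * Real.pi) ^ 2 + m ^ 2) * (1 + ‖k‖ ^ 2)) * T := by
        have := disp_nonneg m k
        gcongr
        · exact disp_le m k
        · exact (abs_sinMode_le m t k).trans ht
    _ = _ := by ring

theorem le_mul_weight {x C : ℝ} (hC : 0 ≤ C) (h : x ≤ C) (k : R3) : x ≤ C * (1 + ‖k‖ ^ 2) :=
  h.trans (le_mul_of_one_le_right hC (one_le_weight k))

theorem isMode_cosMode (m : ℝ) :
    IsMode m (fun _ => 0) (cosMode m) (fun t k => -(disp m k * sinMode m t k)) where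
  source := continuous_const
  cont := continuous_cosMode m
  cont' := (((continuous_disp m).comp continuous_snd).mul (continuous_sinMode m)).neg
  deriv := hasDerivAt_cosMode m
  deriv' t k := ((hasDerivAt_sinMode m t k).const_mul (disp m k)).fun_neg.congr_deriv (by ring)
  bound _ := ⟨1, fun t _ k => le_mul_weight zero_le_one (abs_cosMode_le m t k) k⟩
  bound' T := ⟨((2 * Real.pi) ^ 2 + m ^ 2) * T, fun t ht k => by
    rw [abs_neg]
    exact abs_disp_mul_sinMode_le ht k⟩

theorem isMode_sinMode (m : ℝ) : IsMode m (fun _ => 0) (sinMode m) (cosMode m) where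
  source := continuous_const
  cont := continuous_sinMode m
  cont' := continuous_cosMode m
  deriv := hasDerivAt_sinMode m
  deriv' t k := (hasDerivAt_cosMode m t k).congr_deriv (by ring)
  bound T := ⟨|T|, fun t ht k => le_mul_weight (abs_nonneg T)
    ((abs_sinMode_le m t k).trans (ht.trans (le_abs_self T))) k⟩
  bound' _ := ⟨1, fun t _ k => le_mul_weight zero_le_one (abs_cosMode_le m t k) k⟩

/-! ### The variation of constants formula. -/

section Duhamel

variable (m : ℝ) (h : ℝ → ℝ)

/-- The cosine coefficient of the variation of constants formula. -/
def cosCoeff (t : ℝ) (k : R3) : ℝ := ∫ s in 0..t, cosMode m s k * h s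

/-- The sine coefficient of the variation of constants formula. -/
def sinCoeff (t : ℝ) (k : R3) : ℝ := ∫ s in 0..t, sinMode m s k * h s

/-- The mode generated by the source `h` from vanishing initial data. -/
def forcedMode (t : ℝ) (k : R3) : ℝ :=
  cosMode m t k * sinCoeff m h t k - sinMode m t k * cosCoeff m h t k

/-- The velocity of `forcedMode`. -/
def forcedMode' (t : ℝ) (k : R3) : ℝ :=
  -(cosMode m t k * cosCoeff m h t k + disp m k * sinMode m t k * sinCoeff m h t k)

variable {h}

theorem continuous_parametric {f : ℝ → R3 → ℝ} (hf : Continuous fun p : ℝ × R3 => f p.1 p.2)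
    (hh : Continuous h) :
    Continuous fun p : ℝ × R3 => ∫ s in 0..p.1, f s p.2 * h s :=
  intervalIntegral.continuous_parametric_intervalIntegral_of_continuous
    (f := fun (p : ℝ × R3) s => f s p.2 * h s)
    ((hf.comp (continuous_snd.prodMk (continuous_snd.comp continuous_fst))).mul
      (hh.comp continuous_snd)) continuous_fst

theorem hasDerivAt_coeff {f : ℝ → R3 → ℝ} (hf : Continuous fun p : ℝ × R3 => f p.1 p.2)
    (hh : Continuous h) (t : ℝ) (k : R3) :
    HasDerivAt (fun t => ∫ s in 0..t, f s k * h s) (f t k * h t) t := by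
  have hc : Continuous fun s => f s k * h s :=
    (hf.comp (continuous_id.prodMk continuous_const)).mul hh
  exact intervalIntegral.integral_hasDerivAt_right (hc.intervalIntegrable _ _)
    hc.aestronglyMeasurable.stronglyMeasurableAtFilter hc.continuousAt

theorem abs_coeff_le {f : ℝ → R3 → ℝ} {T D B : ℝ} (hD : ∀ t, |t| ≤ T → ∀ k, |f t k| ≤ D)
    (hB : ∀ t, |t| ≤ T → |h t| ≤ B) {t : ℝ} (ht : |t| ≤ T) (k : R3) :
    |∫ s in 0..t, f s k * h s| ≤ D * B * T := by
  have hD0 : 0 ≤ D := (abs_nonneg _).trans (hD t ht k)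
  have hB0 : 0 ≤ B := (abs_nonneg _).trans (hB t ht)
  have := intervalIntegral.norm_integral_le_of_norm_le_const (a := 0) (b := t)
    (f := fun s => f s k * h s) (C := D * B) fun s hs => by
      have hs' : |s| ≤ T := by
        refine le_trans ?_ ht
        rw [Set.mem_uIoc] at hs
        rcases hs with hs | hs
        · rw [abs_of_pos hs.1, abs_of_pos (hs.1.trans_le hs.2)]
          exact hs.2
        · rw [abs_of_nonpos hs.2, abs_of_neg (hs.1.trans_le hs.2)]
          linarith
      rw [norm_mul]
      exact mul_le_mul (hD s hs' k) (hB s hs') (norm_nonneg _) hD0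
  refine this.trans ?_
  rw [sub_zero]
  gcongr

/-- Duhamel's solution is -∫₀ᵗ S(t - s) h(s) ds with S the sine mode. The addition formula S(t - s)
= S(t)C(s) - C(t)S(s) removes t from the integrands, so the fundamental theorem of calculus gives
both derivatives. In the first one the two terms containing h(t) cancel. -/
theorem isMode_forcedMode (hh : Continuous h) :
    IsMode m h (forcedMode m h) (forcedMode' m h) := by
  have cA : Continuous fun p : ℝ × R3 => cosCoeff m h p.1 p.2 :=
    continuous_parametric (continuous_cosMode m) hh
  have cB : Continuous fun p : ℝ × R3 => sinCoeff m h p.1 p.2 :=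
    continuous_parametric (continuous_sinMode m) hh
  have dA := hasDerivAt_coeff (continuous_cosMode m) hh
  have dB := hasDerivAt_coeff (continuous_sinMode m) hh
  have coeffBound : ∀ T, ∃ D, 0 ≤ D ∧ ∀ t, |t| ≤ T → ∀ k,
      |cosCoeff m h t k| ≤ D ∧ |sinCoeff m h t k| ≤ D := by
    intro T
    obtain ⟨B, hB⟩ := (isCompact_Icc (a := -T) (b := T)).exists_bound_of_continuousOn
      hh.continuousOn
    refine ⟨max 0 (max (1 * B * T) (T * B * T)), le_max_left _ _, fun t ht k => ⟨?_, ?_⟩⟩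
    · exact (abs_coeff_le (fun t _ k => abs_cosMode_le m t k) (fun t ht => hB t (abs_le.1 ht))
        ht k).trans ((le_max_left _ _).trans (le_max_right _ _))
    · exact (abs_coeff_le (fun t ht k => (abs_sinMode_le m t k).trans ht)
        (fun t ht => hB t (abs_le.1 ht)) ht k).trans ((le_max_right _ _).trans (le_max_right _ _))
  refine ⟨hh, ((continuous_cosMode m).mul cB).sub ((continuous_sinMode m).mul cA),
    (((continuous_cosMode m).mul cA).add ((((continuous_disp m).comp continuous_snd).mul
      (continuous_sinMode m)).mul cB)).neg, fun t k => ?_, fun t k => ?_, fun T => ?_, fun T => ?_⟩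
  · refine (((hasDerivAt_cosMode m t k).mul (dB t k)).sub
      ((hasDerivAt_sinMode m t k).mul (dA t k))).congr_deriv ?_
    simp only [forcedMode', cosCoeff, sinCoeff]
    ring
  · refine (((hasDerivAt_cosMode m t k).mul (dA t k)).add
      (((hasDerivAt_sinMode m t k).const_mul (disp m k)).mul (dB t k))).neg.congr_deriv ?_
    simp only [forcedMode, cosCoeff, sinCoeff]
    -- The terms containing h(t) add up to -h(t) (C² + disp · S²) = -h(t).
    linear_combination -h t * cosMode_sq_add m t k
  · obtain ⟨D, hD, hb⟩ := coeffBound T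
    refine ⟨1 * D + |T| * D, fun t ht k => le_mul_weight (by positivity) ?_ k⟩
    refine (abs_sub _ _).trans ?_
    rw [abs_mul, abs_mul]
    have h1 := abs_cosMode_le m t k
    have h2 := (abs_sinMode_le m t k).trans (ht.trans (le_abs_self T))
    obtain ⟨h3, h4⟩ := hb t ht k
    gcongr
  · obtain ⟨D, hD, hb⟩ := coeffBound T
    refine ⟨1 * D + ((2 * Real.pi) ^ 2 + m ^ 2) * T * D, fun t ht k => ?_⟩
    rw [forcedMode', abs_neg]
    refine (abs_add_le _ _).trans ?_
    rw [abs_mul, abs_mul _ (sinCoeff m h t k)]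
    have h1 := abs_cosMode_le m t k
    have h2 := abs_disp_mul_sinMode_le (m := m) ht k
    obtain ⟨h3, h4⟩ := hb t ht k
    have hT : 0 ≤ T := (abs_nonneg t).trans ht
    have h5 : |cosMode m t k| * |cosCoeff m h t k| ≤ 1 * D := by gcongr
    have h6 : |disp m k * sinMode m t k| * |sinCoeff m h t k| ≤
        ((2 * Real.pi) ^ 2 + m ^ 2) * T * (1 + ‖k‖ ^ 2) * D := by
      gcongr
    have h7 := le_mul_weight (by positivity : 0 ≤ 1 * D) h5 k
    linarith

end Duhamel

theorem cosMode_zero (m : ℝ) : cosMode m 0 = fun _ => 1 := by ext; simp [cosMode]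

theorem sinMode_zero (m : ℝ) : sinMode m 0 = fun _ => 0 := by ext; simp [sinMode]

theorem forcedMode_zero (m : ℝ) (h : ℝ → ℝ) : forcedMode m h 0 = fun _ => 0 := by
  ext; simp [forcedMode, cosCoeff, sinCoeff]

theorem forcedMode'_zero (m : ℝ) (h : ℝ → ℝ) : forcedMode' m h 0 = fun _ => 0 := by
  ext; simp [forcedMode', cosCoeff, sinCoeff]

/-- The forced Klein–Gordon equation is solvable for test functions as initial data. -/
theorem exists_isKG_of_isTest (m : ℝ) {f g : R3 → ℝ} (hf : IsTest f) (hg : IsTest g)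
    {h : Fin 3 → ℝ → ℝ} (hh : ∀ i, Continuous (h i)) {a : Fin 3 → R3 → ℝ}
    (ha : ∀ i, IsTest (a i)) :
    ∃ u v gr, IsKG m (fun t x => ∑ i, h i t * a i x) u v gr ∧ u 0 = f ∧ v 0 = g := by
  have k1 := (isMode_cosMode m).isKG hf
  have k2 := (isMode_sinMode m).isKG hg
  have k3 := fun i => (isMode_forcedMode m (hh i)).isKG (ha i)
  -- Superposition: the cosine mode carries the initial value, the sine mode the initial velocity,
  -- and the three forced modes the source.
  have k := (k1.add k2).add (((k3 0).add (k3 1)).add (k3 2))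
  have e : (fun t x => 0 * f x + 0 * g x + (h 0 t * a 0 x + h 1 t * a 1 x + h 2 t * a 2 x)) =
      fun t x => ∑ i, h i t * a i x := by
    ext t x
    simp [Fin.sum_univ_three]
  rw [e] at k
  refine ⟨_, _, _, k, ?_, ?_⟩
  · ext x
    simp [cosMode_zero, sinMode_zero, forcedMode_zero, mult_zero, mult_one hf]
  · ext x
    simp [cosMode_zero, sinMode_zero, forcedMode'_zero, mult_zero, mult_one hg]

end

section

/-! ### Completeness of `L²_loc` -/

theorem eLpNorm_eq_ofReal_l2norm {f : R3 → ℝ} (hf : MemL2loc f) (R : ℝ) :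
    eLpNorm f 2 (volume.restrict (Metric.ball (0 : R3) R)) = ENNReal.ofReal (l2norm R f) :=
  (ENNReal.ofReal_toReal (hf R).2.ne).symm

theorem MemL2loc.aestronglyMeasurable {f : R3 → ℝ} (hf : MemL2loc f) :
    AEStronglyMeasurable f volume := hf.locallyIntegrable.aestronglyMeasurable

theorem ae_eq_zero_of_l2norm {f : R3 → ℝ} (hf : MemL2loc f) (h : ∀ R, l2norm R f = 0) :
    f =ᵐ[volume] 0 := by
  have h1 : ∀ n : ℕ, ∀ᵐ x ∂volume, x ∈ Metric.ball (0 : R3) n → f x = 0 := by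
    intro n
    rw [← ae_restrict_iff' measurableSet_ball]
    have := eLpNorm_eq_ofReal_l2norm hf n
    rw [h, ENNReal.ofReal_zero, eLpNorm_eq_zero_iff (hf n).1 (by norm_num)] at this
    exact this
  filter_upwards [ae_all_iff.2 h1] with x hx
  obtain ⟨n, hn⟩ := exists_nat_gt ‖x‖
  exact hx n (by simpa using hn)

/-- A geometric Cauchy rate on a ball yields convergence almost everywhere there, without passing to
a subsequence. Hence a single limit function, independent of the radius, serves all balls. -/
theorem exists_l2norm_limit {f : ℕ → R3 → ℝ} (hf : ∀ n, MemL2loc (f n))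
    (h : ∀ R : ℝ, ∃ (K : ℝ) (n₀ : ℕ), ∀ N ≥ n₀, ∀ n ≥ N, ∀ k ≥ N,
      l2norm R (fun x => f n x - f k x) ≤ K * (1 / 2) ^ N) :
    ∃ f₀, MemL2loc f₀ ∧ ∀ R, Tendsto (fun n => l2norm R (fun x => f n x - f₀ x)) atTop (𝓝 0) := by
  choose K n₀ hK using h
  -- The bounds must be summable and hold with strict inequality; the summand 1 provides strictness
  -- also when `K R = 0`. The shift by `n₀ R` discards the indices where the rate is not yet valid.
  set B : ℝ → ℕ → ℝ≥0∞ := fun R N => ENNReal.ofReal ((|K R| + 1) * (1 / 2) ^ (N + n₀ R)) with hB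
  have hBsum : ∀ R, ∑' N, B R N ≠ ⊤ := by
    intro R
    have hs : Summable fun N => (|K R| + 1) * (1 / 2 : ℝ) ^ (N + n₀ R) :=
      ((summable_nat_add_iff (n₀ R)).2 summable_geometric_two).mul_left _
    rw [← ENNReal.ofReal_tsum_of_nonneg (fun N => by positivity) hs]
    exact ENNReal.ofReal_ne_top
  have hcau : ∀ R, ∀ N n k : ℕ, N ≤ n → N ≤ k →
      eLpNorm (f (n + n₀ R) - f (k + n₀ R)) 2 (volume.restrict (Metric.ball (0 : R3) R)) <
        B R N := by
    intro R N n k hn hk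
    have h1 := hK R (N + n₀ R) (by omega) (n + n₀ R) (by omega) (k + n₀ R) (by omega)
    have h2 := eLpNorm_eq_ofReal_l2norm ((hf (n + n₀ R)).sub (hf (k + n₀ R))) R
    have h3 : f (n + n₀ R) - f (k + n₀ R) = fun x => f (n + n₀ R) x - f (k + n₀ R) x := rfl
    rw [h3, h2]
    have hp : (0 : ℝ) < (1 / 2) ^ (N + n₀ R) := by positivity
    refine (ENNReal.ofReal_lt_ofReal_iff (by positivity)).2 (h1.trans_lt ?_)
    gcongr
    linarith [le_abs_self (K R)]
  have hae : ∀ R : ℝ, ∀ᵐ x ∂(volume.restrict (Metric.ball (0 : R3) R)),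
      ∃ l, Tendsto (fun n => f n x) atTop (𝓝 l) := by
    intro R
    filter_upwards [Lp.ae_tendsto_of_cauchy_eLpNorm (f := fun n => f (n + n₀ R))
      (fun n => (hf (n + n₀ R) R).1) (by norm_num) (hBsum R) (hcau R)] with x hx
    obtain ⟨l, hl⟩ := hx
    exact ⟨l, (tendsto_add_atTop_iff_nat (f := fun n => f n x) (n₀ R)).1 hl⟩
  have hae' : ∀ᵐ x ∂(volume : Measure R3), ∃ l, Tendsto (fun n => f n x) atTop (𝓝 l) := by
    have h1 : ∀ n : ℕ, ∀ᵐ x ∂(volume : Measure R3), x ∈ Metric.ball (0 : R3) n →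
        ∃ l, Tendsto (fun n => f n x) atTop (𝓝 l) := fun n =>
      (ae_restrict_iff' measurableSet_ball).1 (hae n)
    filter_upwards [ae_all_iff.2 h1] with x hx
    obtain ⟨n, hn⟩ := exists_nat_gt ‖x‖
    exact hx n (by simpa using hn)
  obtain ⟨f₀, hm, hlim⟩ :=
    exists_stronglyMeasurable_limit_of_tendsto_ae (fun n => (hf n).aestronglyMeasurable) hae'
  have ht : ∀ R, Tendsto (fun n => eLpNorm (f (n + n₀ R) - f₀) 2
      (volume.restrict (Metric.ball (0 : R3) R))) atTop (𝓝 0) := by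
    intro R
    refine Lp.cauchy_tendsto_of_tendsto (f := fun n => f (n + n₀ R))
      (fun n => (hf (n + n₀ R) R).1) f₀ (hBsum R) (hcau R) ?_
    filter_upwards [ae_restrict_of_ae hlim] with x hx
    exact (tendsto_add_atTop_iff_nat (f := fun n => f n x) (n₀ R)).2 hx
  refine ⟨f₀, fun R => Lp.memLp_of_cauchy_tendsto (by norm_num) (fun n => hf (n + n₀ R) R) f₀
    hm.aestronglyMeasurable (ht R), fun R => ?_⟩
  have := (ENNReal.tendsto_toReal ENNReal.zero_ne_top).comp (ht R)
  rw [ENNReal.toReal_zero] at this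
  exact (tendsto_add_atTop_iff_nat (f := fun n => l2norm R (fun x => f n x - f₀ x)) (n₀ R)).1 this

/-- A sequence of curves in `L²_loc` that is geometrically Cauchy, locally uniformly in time. -/
def FastCauchy (f : ℕ → ℝ → R3 → ℝ) : Prop :=
  ∀ R T : ℝ, ∃ (K : ℝ) (n₀ : ℕ), ∀ t, |t| ≤ T → ∀ N ≥ n₀, ∀ n ≥ N, ∀ k ≥ N,
    l2norm R (fun x => f n t x - f k t x) ≤ K * (1 / 2) ^ N

/-- Geometric convergence in `L²_loc`, locally uniformly in time. -/
def FastTendsto (f : ℕ → ℝ → R3 → ℝ) (f₀ : ℝ → R3 → ℝ) : Prop :=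
  ∀ R T : ℝ, ∃ (K : ℝ) (n₀ : ℕ), ∀ t, |t| ≤ T → ∀ N ≥ n₀,
    l2norm R (fun x => f N t x - f₀ t x) ≤ K * (1 / 2) ^ N

theorem tendsto_const_mul_half_pow (K : ℝ) :
    Tendsto (fun N : ℕ => K * (1 / 2 : ℝ) ^ N) atTop (𝓝 0) := by
  simpa using (tendsto_pow_atTop_nhds_zero_of_lt_one (by norm_num) (by norm_num :
    (1 / 2 : ℝ) < 1)).const_mul K

/-- The limit is taken separately at each time. The rate is uniform for bounded times, so continuity
in time passes to the limit as for a uniform limit of continuous functions. -/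
theorem FastCauchy.exists_limit {f : ℕ → ℝ → R3 → ℝ} (hf : ∀ n, L2Cont (f n))
    (h : FastCauchy f) : ∃ f₀, L2Cont f₀ ∧ FastTendsto f f₀ := by
  have h1 : ∀ t : ℝ, ∃ f₀, MemL2loc f₀ ∧
      ∀ R, Tendsto (fun n => l2norm R (fun x => f n t x - f₀ x)) atTop (𝓝 0) := fun t =>
    exists_l2norm_limit (fun n => (hf n).mem t) fun R => by
      obtain ⟨K, n₀, hK⟩ := h R |t|
      exact ⟨K, n₀, hK t le_rfl⟩
  choose f₀ hmem hlim using h1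
  have hfast : FastTendsto f f₀ := by
    intro R T
    obtain ⟨K, n₀, hK⟩ := h R T
    refine ⟨K, n₀, fun t ht N hN => ?_⟩
    have hl := ((hlim t R).const_add (K * (1 / 2) ^ N))
    rw [add_zero] at hl
    refine ge_of_tendsto hl ?_
    filter_upwards [eventually_ge_atTop N] with k hk
    exact (l2norm_triangle ((hf N).mem t) ((hf k).mem t) (hmem t) R).trans
      (by gcongr; exact hK t ht N hN N le_rfl k hk)
  refine ⟨f₀, ⟨hmem, fun t R => ?_⟩, hfast⟩
  obtain ⟨K, n₀, hK⟩ := hfast R (|t| + 1)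
  rw [Metric.tendsto_nhds]
  intro ε hε
  obtain ⟨N, hN⟩ := (((tendsto_const_mul_half_pow K).eventually (gt_mem_nhds
    (show (0 : ℝ) < ε / 3 by positivity))).and (eventually_ge_atTop n₀)).exists
  filter_upwards [((hf N).tendsto t R).eventually (gt_mem_nhds (show (0 : ℝ) < ε / 3 by positivity)),
    Metric.ball_mem_nhds t one_pos] with s hs hst
  rw [Real.dist_eq, sub_zero, abs_of_nonneg (l2norm_nonneg _ _)]
  have hs' : |s| ≤ |t| + 1 := by
    rw [Metric.mem_ball, Real.dist_eq] at hst
    linarith [abs_sub_abs_le_abs_sub s t]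
  have a1 := hK s hs' N hN.2
  have a2 := hK t (by linarith) N hN.2
  have a3 := l2norm_triangle (hmem s) ((hf N).mem s) (hmem t) R
  have a4 := l2norm_triangle ((hf N).mem s) ((hf N).mem t) (hmem t) R
  rw [l2norm_sub_comm] at a1
  linarith [hN.1]

theorem FastTendsto.tendsto {f : ℕ → ℝ → R3 → ℝ} {f₀ : ℝ → R3 → ℝ} (h : FastTendsto f f₀)
    (t R : ℝ) : Tendsto (fun n => l2norm R (fun x => f n t x - f₀ t x)) atTop (𝓝 0) := by
  obtain ⟨K, n₀, hK⟩ := h R |t|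
  refine squeeze_zero' (Eventually.of_forall fun _ => l2norm_nonneg _ _) ?_
    (tendsto_const_mul_half_pow K)
  filter_upwards [eventually_ge_atTop n₀] with N hN using hK t le_rfl N hN

/-- By Cauchy–Schwarz on the support of `ψ`. Locally uniform convergence of the pairings is what
permits time derivatives to be passed to the limit. -/
theorem FastTendsto.tendstoLocallyUniformlyOn {f : ℕ → ℝ → R3 → ℝ} {f₀ : ℝ → R3 → ℝ}
    (h : FastTendsto f f₀) (hf : ∀ n, L2Cont (f n)) (hf₀ : L2Cont f₀) {ψ : R3 → ℝ}
    (hψ : IsTest ψ) :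
    TendstoLocallyUniformlyOn (fun n t => ∫ x, f n t x * ψ x) (fun t => ∫ x, f₀ t x * ψ x)
      atTop Set.univ := by
  obtain ⟨R, hR, h0⟩ := exists_radius_of_hasCompactSupport hψ.supp
  rw [Metric.tendstoLocallyUniformlyOn_iff]
  intro ε hε t _
  obtain ⟨K, n₀, hK⟩ := h R (|t| + 1)
  refine ⟨Metric.ball t 1, mem_nhdsWithin_of_mem_nhds (Metric.ball_mem_nhds t one_pos), ?_⟩
  filter_upwards [(tendsto_const_mul_half_pow (K * l2norm R ψ)).eventually (gt_mem_nhds hε),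
    eventually_ge_atTop n₀] with N hN1 hN2 s hs
  have hs' : |s| ≤ |t| + 1 := by
    rw [Metric.mem_ball, Real.dist_eq] at hs
    linarith [abs_sub_abs_le_abs_sub s t]
  rw [dist_comm, Real.dist_eq, ← integral_sub (((hf N).mem s).integrable_mul_test hψ)
    ((hf₀.mem s).integrable_mul_test hψ)]
  have := abs_integral_mul_le (((hf N).mem s).sub (hf₀.mem s)) hψ.memL2loc h0
  simp only [sub_mul] at this
  refine this.trans_lt (lt_of_le_of_lt ?_ hN1)
  have h2 := mul_le_mul_of_nonneg_right (hK s hs' N hN2) (l2norm_nonneg R ψ)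
  linarith

theorem IsWeakPd.unique {i : Fin 3} {u g g' : R3 → ℝ} (h : IsWeakPd i u g) (h' : IsWeakPd i u g')
    (hg : MemL2loc g) (hg' : MemL2loc g') : g =ᵐ[volume] g' := by
  refine (ae_eq_zero_of_integral_contDiff_smul_eq_zero
    (hg.locallyIntegrable.sub hg'.locallyIntegrable) fun ψ h1 h2 => ?_).mono
      fun x hx => sub_eq_zero.1 hx
  have hψ : IsTest ψ := ⟨h1, h2⟩
  have e := (h ψ hψ).symm.trans (h' ψ hψ)
  simp only [Pi.sub_apply, smul_eq_mul, mul_comm (ψ _), sub_mul]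
  rw [integral_sub (hg.integrable_mul_test hψ) (hg'.integrable_mul_test hψ)]
  linarith

theorem IsTest.isWeakPd {f : R3 → ℝ} (hf : IsTest f) (i : Fin 3) :
    IsWeakPd i f (FieldParticle.pd i f) := fun ψ hψ =>
  integral_mul_fderiv_eq_neg_fderiv_mul_of_integrable (μ := (volume : Measure R3))
    ((hf.pd i).memL2loc.integrable_mul_test hψ) (hf.memL2loc.integrable_mul_test (hψ.pd i))
    (hf.memL2loc.integrable_mul_test hψ) (fun x _ => hf.smooth.differentiable (by simp) x)
    (fun x _ => hψ.smooth.differentiable (by simp) x)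

/-- The cutoff is one near every point of the ball, so multiplication by it changes neither values
nor derivatives there. -/
theorem exists_cutoff (R : ℝ) :
    ∃ χ, IsTest χ ∧ ∀ x ∈ Metric.ball (0 : R3) R, ∀ᶠ y in 𝓝 x, χ y = 1 := by
  let χ : ContDiffBump (0 : R3) := ⟨|R| + 1, |R| + 2, by positivity, by linarith⟩
  refine ⟨χ, ⟨χ.contDiff, χ.hasCompactSupport⟩, fun x hx => ?_⟩
  filter_upwards [Metric.isOpen_ball.mem_nhds hx] with y hy
  refine χ.one_of_mem_closedBall
    (Metric.ball_subset_closedBall (Metric.ball_subset_ball ?_ hy))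
  change R ≤ |R| + 1
  linarith [le_abs_self R]

/-- Test functions are dense in `L²_loc`. -/
theorem exists_isTest_l2norm_sub_le {f : R3 → ℝ} (hf : MemL2loc f) (R : ℝ) {δ : ℝ} (hδ : 0 < δ) :
    ∃ f', IsTest f' ∧ l2norm R (fun x => f' x - f x) ≤ δ := by
  obtain ⟨ε, hε, h1⟩ := exists_l2norm_conv_sub_le hf R hδ
  obtain ⟨η, hη⟩ := exists_isMollifier hε
  obtain ⟨χ, hχ, h1χ⟩ := exists_cutoff R
  refine ⟨fun x => χ x * conv f η x,
    ⟨hχ.smooth.mul (contDiff_conv hf hη.test), hχ.supp.mul_right⟩, ?_⟩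
  rw [l2norm_congr_on (g := fun x => conv f η x - f x) fun x hx => by
    simp [(h1χ x hx).self_of_nhds]]
  exact h1 ε le_rfl η hη

/-- Test functions are dense in `H¹_loc`. -/
theorem exists_isTest_approx {f : R3 → ℝ} {γ : Fin 3 → R3 → ℝ} (hf : MemL2loc f)
    (hγ : ∀ i, MemL2loc (γ i)) (hw : ∀ i, IsWeakPd i f (γ i)) (R : ℝ) {δ : ℝ} (hδ : 0 < δ) :
    ∃ f', IsTest f' ∧ l2norm R (fun x => f' x - f x) ≤ δ ∧
      ∀ i, l2norm R (fun x => pd i f' x - γ i x) ≤ δ := by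
  obtain ⟨ε₁, hε₁, h1⟩ := exists_l2norm_conv_sub_le hf R hδ
  choose ε₂ hε₂ h2 using fun i => exists_l2norm_conv_sub_le (hγ i) R hδ
  obtain ⟨ε, hε, hεle, hεle'⟩ : ∃ ε > 0, ε ≤ ε₁ ∧ ∀ i, ε ≤ ε₂ i := by
    refine ⟨min ε₁ (min (ε₂ 0) (min (ε₂ 1) (ε₂ 2))), ?_, min_le_left _ _, fun i => ?_⟩
    · have := hε₂ 0
      have := hε₂ 1
      have := hε₂ 2
      positivity
    · fin_cases i <;> simp
  obtain ⟨η, hη⟩ := exists_isMollifier hε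
  obtain ⟨χ, hχ', h1χ⟩ := exists_cutoff R
  have hχ : ∀ x ∈ Metric.ball (0 : R3) R, ∀ᶠ y in 𝓝 x, χ y * conv f η y = conv f η y :=
    fun x hx => (h1χ x hx).mono fun y hy => by rw [hy, one_mul]
  refine ⟨fun x => χ x * conv f η x, 
    ⟨hχ'.smooth.mul (contDiff_conv hf hη.test), hχ'.supp.mul_right⟩, ?_,
    fun i => ?_⟩
  · rw [l2norm_congr_on (g := fun x => conv f η x - f x) fun x hx => by
      exact congrArg (· - f x) (hχ x hx).self_of_nhds]
    exact h1 ε hεle η hη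
  · rw [l2norm_congr_on (g := fun x => conv (γ i) η x - γ i x) fun x hx => by
      have e : pd i (fun x => χ x * conv f η x) x = pd i (conv f η) x := by
        rw [pd, pd, Filter.EventuallyEq.fderiv_eq (hχ x hx)]
      rw [e, pd_conv hf hη.test, conv_pd_of_isWeakPd (hw i) hη.test]]
    exact h2 i ε (hεle' i) η hη

end

section

/-! ### The Cauchy problem for the Klein–Gordon equation with data of finite local energy -/

/-- Solutions of the Klein–Gordon equation are stable under geometric convergence. -/
theorem IsKG.of_fastCauchy {m : ℝ} {F : ℝ → R3 → ℝ} {u v : ℕ → ℝ → R3 → ℝ}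
    {g : ℕ → Fin 3 → ℝ → R3 → ℝ} (h : ∀ n, IsKG m F (u n) (v n) (g n)) (hu : FastCauchy u)
    (hv : FastCauchy v) (hg : ∀ i, FastCauchy fun n => g n i) :
    ∃ u₀ v₀ g₀, IsKG m F u₀ v₀ g₀ ∧ FastTendsto u u₀ ∧ FastTendsto v v₀ := by
  obtain ⟨u₀, cu, lu⟩ := hu.exists_limit fun n => (h n).cu
  obtain ⟨v₀, cv, lv⟩ := hv.exists_limit fun n => (h n).cv
  choose g₀ cg lg using fun i => (hg i).exists_limit fun n => (h n).cg i
  have tu := fun {ψ : R3 → ℝ} (hψ : IsTest ψ) =>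
    lu.tendstoLocallyUniformlyOn (fun n => (h n).cu) cu hψ
  have tv := fun {ψ : R3 → ℝ} (hψ : IsTest ψ) =>
    lv.tendstoLocallyUniformlyOn (fun n => (h n).cv) cv hψ
  have tg := fun i {ψ : R3 → ℝ} (hψ : IsTest ψ) =>
    (lg i).tendstoLocallyUniformlyOn (fun n => (h n).cg i) (cg i) hψ
  refine ⟨u₀, v₀, g₀, ⟨(h 0).cF, cu, cv, cg, fun i t ψ hψ => ?_, fun ψ hψ t => ?_,
    fun ψ hψ t => ?_⟩, lu, lv⟩
  · have l1 := (tu (hψ.pd i)).tendsto_at (Set.mem_univ t)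
    have l2 := ((tg i hψ).tendsto_at (Set.mem_univ t)).neg
    exact tendsto_nhds_unique l1 (l2.congr fun n => ((h n).grad i t ψ hψ).symm)
  · exact hasDerivAt_of_tendstoLocallyUniformlyOn isOpen_univ (tv hψ)
      (Eventually.of_forall fun n s _ => (h n).du ψ hψ s)
      (fun s _ => (tu hψ).tendsto_at (Set.mem_univ s)) (Set.mem_univ t)
  · refine hasDerivAt_of_tendstoLocallyUniformlyOn isOpen_univ
      (f' := fun n t => (∫ x, u n t x * (Δ ψ x - m ^ 2 * ψ x)) - ∫ x, F t x * ψ x)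
      (g' := fun t => (∫ x, u₀ t x * (Δ ψ x - m ^ 2 * ψ x)) - ∫ x, F t x * ψ x) ?_
      (Eventually.of_forall fun n s _ => (h n).dv ψ hψ s)
      (fun s _ => (tv hψ).tendsto_at (Set.mem_univ s)) (Set.mem_univ t)
    -- The source term is the same for all n and drops out of the distances.
    have := tu (hψ.klein_gordon m)
    rw [Metric.tendstoLocallyUniformlyOn_iff] at this ⊢
    simpa only [dist_sub_right] using this

theorem l2norm_sub_le_of_approx {a : ℕ → R3 → ℝ} {b : R3 → ℝ} (ha : ∀ n, MemL2loc (a n))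
    (hb : MemL2loc b) (h : ∀ n : ℕ, l2norm n (fun x => a n x - b x) ≤ (1 / 2) ^ n) {R : ℝ}
    {N n k : ℕ} (hR : R ≤ N) (hn : N ≤ n) (hk : N ≤ k) :
    l2norm R (fun x => a n x - a k x) ≤ 2 * (1 / 2) ^ N := by
  have key : ∀ j, N ≤ j → l2norm R (fun x => a j x - b x) ≤ (1 / 2) ^ N := fun j hj =>
    (l2norm_mono ((ha j).sub hb) (hR.trans (Nat.cast_le.2 hj))).trans
      ((h j).trans (pow_le_pow_of_le_one (by norm_num) (by norm_num) hj))
  have := l2norm_triangle (ha n) hb (ha k) R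
  have h2 := key k hk
  rw [l2norm_sub_comm] at h2
  linarith [key n hn]

theorem ae_eq_of_l2norm_sub_le {a : ℕ → R3 → ℝ} {b c : R3 → ℝ} (ha : ∀ n, MemL2loc (a n))
    (hb : MemL2loc b) (hc : MemL2loc c)
    (h : ∀ n : ℕ, l2norm n (fun x => a n x - b x) ≤ (1 / 2) ^ n)
    (h' : ∀ R, Tendsto (fun n => l2norm R (fun x => a n x - c x)) atTop (𝓝 0)) :
    c =ᵐ[volume] b := by
  refine (ae_eq_zero_of_l2norm (hc.sub hb) fun R => ?_).mono fun x hx => sub_eq_zero.1 hx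
  refine le_antisymm ?_ (l2norm_nonneg _ _)
  have l1 : Tendsto (fun n : ℕ => l2norm R (fun x => a n x - c x) + (1 / 2 : ℝ) ^ n) atTop (𝓝 0) := by
    simpa using (h' R).add (tendsto_const_mul_half_pow 1)
  refine ge_of_tendsto l1 ?_
  obtain ⟨n₀, hn₀⟩ := exists_nat_ge R
  filter_upwards [eventually_ge_atTop n₀] with n hn
  have h1 := l2norm_triangle hc (ha n) hb R
  rw [l2norm_sub_comm c (a n)] at h1
  have h2 := (l2norm_mono ((ha n).sub hb) (hn₀.trans (Nat.cast_le.2 hn))).trans (h n)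
  linarith

theorem l2norm_sq_fst_le_energy (R : ℝ) (u v : R3 → ℝ) (g : Fin 3 → R3 → ℝ) :
    l2norm R u ^ 2 ≤ energy R u v g := by
  have : 0 ≤ ∑ i, l2norm R (g i) ^ 2 := Finset.sum_nonneg fun i _ => sq_nonneg _
  unfold energy
  linarith [sq_nonneg (l2norm R v)]

theorem l2norm_sq_snd_le_energy (R : ℝ) (u v : R3 → ℝ) (g : Fin 3 → R3 → ℝ) :
    l2norm R v ^ 2 ≤ energy R u v g := by
  have : 0 ≤ ∑ i, l2norm R (g i) ^ 2 := Finset.sum_nonneg fun i _ => sq_nonneg _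
  unfold energy
  linarith [sq_nonneg (l2norm R u)]

theorem l2norm_sq_grad_le_energy (R : ℝ) (u v : R3 → ℝ) (g : Fin 3 → R3 → ℝ) (i : Fin 3) :
    l2norm R (g i) ^ 2 ≤ energy R u v g := by
  have := Finset.single_le_sum (f := fun i => l2norm R (g i) ^ 2) (fun i _ => sq_nonneg _)
    (Finset.mem_univ i)
  unfold energy
  linarith [sq_nonneg (l2norm R u), sq_nonneg (l2norm R v)]

/-- The data are approximated by test functions with error 2⁻ⁿ on the ball of radius n. The
difference of two approximate solutions has no source, so its energy in |x| < R at time t is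
controlled by the differences of the data in |x| < R + |t|. The sequence is thus Cauchy on every
ball although nothing is known of the data at infinity. -/
theorem exists_isKG (m : ℝ) {f g : R3 → ℝ} {γ : Fin 3 → R3 → ℝ} (hf : MemL2loc f)
    (hg : MemL2loc g) (hγ : ∀ i, MemL2loc (γ i)) (hw : ∀ i, IsWeakPd i f (γ i))
    {h : Fin 3 → ℝ → ℝ} (hh : ∀ i, Continuous (h i)) {a : Fin 3 → R3 → ℝ}
    (ha : ∀ i, IsTest (a i)) :
    ∃ u v gr, IsKG m (fun t x => ∑ i, h i t * a i x) u v gr ∧ u 0 =ᵐ[volume] f ∧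
      v 0 =ᵐ[volume] g := by
  choose f' tf ef eγ using fun n : ℕ => exists_isTest_approx hf hγ hw n
    (show (0 : ℝ) < (1 / 2) ^ n by positivity)
  choose g' tg eg using fun n : ℕ => exists_isTest_l2norm_sub_le hg n
    (show (0 : ℝ) < (1 / 2) ^ n by positivity)
  choose u v gr hk hu0 hv0 using fun n => exists_isKG_of_isTest m (tf n) (tg n) hh ha
  -- The gradient component of a solution is an arbitrary representative; at time 0 it is identified
  -- by uniqueness of weak derivatives.
  have hgr0 : ∀ n i, gr n i 0 =ᵐ[volume] pd i (f' n) := fun n i =>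
    IsWeakPd.unique (u := f' n) (by simpa only [hu0] using (hk n).grad i 0) ((tf n).isWeakPd i)
      (((hk n).cg i).mem 0) ((tf n).pd i).memL2loc
  have key : ∀ R T : ℝ, ∃ (K : ℝ) (n₀ : ℕ), ∀ t, |t| ≤ T → ∀ N ≥ n₀, ∀ n ≥ N, ∀ k ≥ N,
      energy R (fun x => u n t x - u k t x) (fun x => v n t x - v k t x)
        (fun i x => gr n i t x - gr k i t x) ≤ (K * (1 / 2) ^ N) ^ 2 ∧ 0 ≤ K := by
    intro R T
    obtain ⟨n₀, hn₀⟩ := exists_nat_ge (R + T)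
    -- The initial energy of a difference has five terms (u, v and three partial derivatives), each
    -- at most (2 · 2⁻ᴺ)², hence the factor 20. The index `n₀` ensures that the ball of radius N
    -- contains the domain of dependence.
    refine ⟨√(20 * Real.exp ((2 + m ^ 2) * T)), n₀, fun t ht N hN n hn k hk' =>
      ⟨?_, Real.sqrt_nonneg _⟩⟩
    have hRN : R + |t| ≤ N := by
      have : (n₀ : ℝ) ≤ N := Nat.cast_le.2 hN
      linarith
    have e1 := ((hk n).sub (hk k)).energy_le_of_bound (t := t) (B := 0)
      (fun s _ r => by simp [l2norm_zero]) R
    simp only [mul_zero, add_zero, hu0, hv0] at e1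
    have e2 : energy (R + |t|) (fun x => f' n x - f' k x) (fun x => g' n x - g' k x)
        (fun i x => gr n i 0 x - gr k i 0 x) ≤ 20 * ((1 / 2) ^ N) ^ 2 := by
      unfold energy
      have b1 := l2norm_sub_le_of_approx (fun n => (tf n).memL2loc) hf ef hRN hn hk'
      have b2 := l2norm_sub_le_of_approx (fun n => (tg n).memL2loc) hg eg hRN hn hk'
      have b3 : ∀ i, l2norm (R + |t|) (fun x => gr n i 0 x - gr k i 0 x) ≤ 2 * (1 / 2) ^ N := by
        intro i
        refine (l2norm_congr ((hgr0 n i).sub (hgr0 k i)) (R + |t|)).trans_le ?_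
        exact l2norm_sub_le_of_approx (fun n => ((tf n).pd i).memL2loc) (hγ i)
          (fun n => eγ n i) hRN hn hk'
      have sq : ∀ {f : R3 → ℝ}, l2norm (R + |t|) f ≤ 2 * (1 / 2) ^ N →
          l2norm (R + |t|) f ^ 2 ≤ 4 * ((1 / 2) ^ N) ^ 2 := fun {f} hb =>
        (pow_le_pow_left₀ (l2norm_nonneg _ _) hb 2).trans_eq (by ring)
      have s3 := Finset.sum_le_sum fun i (_ : i ∈ Finset.univ) => sq (b3 i)
      simp only [Finset.sum_const, Finset.card_univ, Fintype.card_fin, nsmul_eq_mul] at s3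
      have := sq b1
      have := sq b2
      push_cast at s3
      linarith
    rw [mul_pow, Real.sq_sqrt (by positivity)]
    refine e1.trans ?_
    have e3 : Real.exp ((2 + m ^ 2) * |t|) ≤ Real.exp ((2 + m ^ 2) * T) := by gcongr
    calc _ ≤ Real.exp ((2 + m ^ 2) * T) * (20 * ((1 / 2) ^ N) ^ 2) :=
          mul_le_mul e3 e2 (energy_nonneg _ _ _ _) (Real.exp_nonneg _)
      _ = _ := by ring
  have fast : ∀ w : ℕ → ℝ → R3 → ℝ, (∀ R t n k,
      l2norm R (fun x => w n t x - w k t x) ^ 2 ≤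
        energy R (fun x => u n t x - u k t x) (fun x => v n t x - v k t x)
          (fun i x => gr n i t x - gr k i t x)) → FastCauchy w := by
    intro w hw R T
    obtain ⟨K, n₀, hK⟩ := key R T
    refine ⟨K, n₀, fun t ht N hN n hn k hk' => ?_⟩
    obtain ⟨h1, h2⟩ := hK t ht N hN n hn k hk'
    exact le_of_sq_le_sq ((hw R t n k).trans h1) (by positivity)
  obtain ⟨u₀, v₀, g₀, h₀, lu, lv⟩ := IsKG.of_fastCauchy hk
    (fast u fun R t n k => l2norm_sq_fst_le_energy _ _ _ _)
    (fast v fun R t n k => l2norm_sq_snd_le_energy _ _ _ _)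
    (fun i => fast (fun n => gr n i) fun R t n k =>
      l2norm_sq_grad_le_energy R (fun x => u n t x - u k t x) (fun x => v n t x - v k t x)
        (fun i x => gr n i t x - gr k i t x) i)
  refine ⟨u₀, v₀, g₀, h₀, ?_, ?_⟩
  · exact ae_eq_of_l2norm_sub_le (fun n => (tf n).memL2loc) hf (h₀.cu.mem 0) ef
      fun R => by simpa only [hu0] using lu.tendsto 0 R
  · exact ae_eq_of_l2norm_sub_le (fun n => (tg n).memL2loc) hg (h₀.cv.mem 0) eg
      fun R => by simpa only [hv0] using lv.tendsto 0 R

end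

section

/-! ### Causal integral equations -/

section picard

variable {V : Type*} [NormedAddCommGroup V] [NormedSpace ℝ V]

/-- The operator `z ↦ z₀ + ∫₀ᵗ B z`. -/
def picardMap (B : C(ℝ, V) → C(ℝ, V)) (z₀ : V) (z : C(ℝ, V)) : C(ℝ, V) :=
  ⟨fun t => z₀ + ∫ s in 0..t, B z s, continuous_const.add
    (intervalIntegral.continuous_primitive (fun _ _ => (B z).continuous.intervalIntegrable _ _) 0)⟩

/-- `B z t` depends in a Lipschitz way on the restriction of `z` to `[-|t|, |t|]`. -/
def CausalLipschitz (B : C(ℝ, V) → C(ℝ, V)) (M : ℝ → ℝ) : Prop :=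
  ∀ (T : ℝ) (z w : C(ℝ, V)) (t : ℝ), |t| ≤ T → ∀ c : ℝ, (∀ s, |s| ≤ |t| → ‖z s - w s‖ ≤ c) →
    ‖B z t - B w t‖ ≤ M T * c

theorem norm_picardMap_sub_le (B : C(ℝ, V) → C(ℝ, V)) (z₀ : V) (z w : C(ℝ, V)) (t : ℝ) :
    ‖picardMap B z₀ z t - picardMap B z₀ w t‖ ≤ ∫ s in Set.uIoc 0 t, ‖B z s - B w s‖ := by
  have : picardMap B z₀ z t - picardMap B z₀ w t = ∫ s in 0..t, (B z s - B w s) := by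
    rw [intervalIntegral.integral_sub ((B z).continuous.intervalIntegrable _ _)
      ((B w).continuous.intervalIntegrable _ _)]
    simp [picardMap]
  rw [this]
  exact intervalIntegral.norm_integral_le_integral_norm_uIoc

theorem abs_le_abs_of_mem_uIoc {s t : ℝ} (hs : s ∈ Set.uIoc 0 t) : |s| ≤ |t| := by
  rcases Set.mem_uIoc.1 hs with h | h
  · rw [abs_of_pos h.1]
    exact h.2.trans (le_abs_self t)
  · rw [abs_of_nonpos h.2]
    linarith [neg_le_abs t]

theorem integrableOn_uIoc_of_continuous {f : ℝ → ℝ} (hf : Continuous f) (a b : ℝ) :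
    IntegrableOn f (Set.uIoc a b) :=
  intervalIntegrable_iff.1 (hf.intervalIntegrable a b)

/-- Causality keeps the factor |s|^j inside the time integral, and each integration gains a factor
1/(j + 1). -/
theorem CausalLipschitz.norm_iterate_sub_le {B : C(ℝ, V) → C(ℝ, V)} {M : ℝ → ℝ}
    (hB : CausalLipschitz B M) {z₀ : V} {Z : ℕ → C(ℝ, V)}
    (hZ : ∀ j, Z (j + 1) = picardMap B z₀ (Z j)) {T C : ℝ} (hM : 0 ≤ M T)
    (hC : ∀ t, |t| ≤ T → ‖Z 1 t - Z 0 t‖ ≤ C) (j : ℕ) :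
    ∀ t, |t| ≤ T → ‖Z (j + 1) t - Z j t‖ ≤ C * ((M T * |t|) ^ j / j.factorial) := by
  induction j with
  | zero => simpa using hC
  | succ j ih =>
    intro t ht
    rw [hZ (j + 1)]
    nth_rw 2 [hZ j]
    have hC0 : 0 ≤ C := (norm_nonneg _).trans (hC t ht)
    have hb : ∀ s ∈ Set.uIoc 0 t, ‖B (Z (j + 1)) s - B (Z j) s‖ ≤
        M T * (C * (M T ^ j / j.factorial)) * |s - 0| ^ j := by
      intro s hs
      have hst := abs_le_abs_of_mem_uIoc hs
      refine (hB T _ _ s (hst.trans ht) (C * ((M T * |s|) ^ j / j.factorial)) fun r hr => ?_).trans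
        (le_of_eq (by rw [sub_zero]; ring))
      refine (ih r (hr.trans (hst.trans ht))).trans ?_
      gcongr
    refine (norm_picardMap_sub_le B z₀ _ _ t).trans ?_
    have c1 : Continuous fun s => ‖B (Z (j + 1)) s - B (Z j) s‖ := by fun_prop
    have c2 : Continuous fun s : ℝ => M T * (C * (M T ^ j / j.factorial)) * |s - 0| ^ j := by
      fun_prop
    refine (setIntegral_mono_on (integrableOn_uIoc_of_continuous c1 0 t)
      (integrableOn_uIoc_of_continuous c2 0 t) measurableSet_uIoc hb).trans (le_of_eq ?_)
    rw [integral_const_mul, integral_pow_abs_sub_uIoc, sub_zero, Nat.factorial_succ]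
    push_cast
    have := Nat.factorial_ne_zero j
    field_simp
    ring

/-- On every compact time set the differences of the Picard iterates are dominated by an exponential
series. They are therefore summable in the topology of locally uniform convergence, with no
smallness condition on the time. -/
theorem CausalLipschitz.exists_fixedPoint [CompleteSpace V] {B : C(ℝ, V) → C(ℝ, V)} {M : ℝ → ℝ}
    (hB : CausalLipschitz B M) (hM : ∀ T, 0 ≤ M T) (z₀ : V) :
    ∃ z : C(ℝ, V), ∀ t, z t = z₀ + ∫ s in 0..t, B z s := by
  let Z : ℕ → C(ℝ, V) := fun j => (picardMap B z₀)^[j] (ContinuousMap.const ℝ z₀)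
  have hZ : ∀ j, Z (j + 1) = picardMap B z₀ (Z j) := fun j => Function.iterate_succ_apply' _ _ _
  have hsum : Summable fun j => Z (j + 1) - Z j := by
    refine ContinuousMap.summable_of_locally_summable_norm fun K => ?_
    obtain ⟨T, hT0, hT⟩ := K.isCompact.isBounded.subset_closedBall_lt 0 (0 : ℝ)
    obtain ⟨C, hC⟩ := (isCompact_closedBall (0 : ℝ) T).exists_bound_of_continuousOn
      (f := fun t => Z 1 t - Z 0 t) (by fun_prop)
    have hC' : ∀ t, |t| ≤ T → ‖Z 1 t - Z 0 t‖ ≤ C := fun t ht => hC t (by simpa using ht)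
    have hC0 : 0 ≤ C := (norm_nonneg _).trans (hC' 0 (by simpa using hT0.le))
    refine Summable.of_nonneg_of_le (fun _ => norm_nonneg _) (fun j => ?_)
      ((Real.summable_pow_div_factorial (M T * T)).mul_left C)
    have hMT := hM T
    refine (ContinuousMap.norm_le _ (by positivity)).2 fun t => ?_
    have ht : |(t : ℝ)| ≤ T := by simpa using hT t.2
    refine (hB.norm_iterate_sub_le hZ hMT hC' j t ht).trans ?_
    gcongr
  have hlim : Tendsto Z atTop (𝓝 (Z 0 + ∑' j, (Z (j + 1) - Z j))) := by
    have := hsum.hasSum.tendsto_sum_nat.const_add (Z 0)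
    refine this.congr fun n => ?_
    rw [Finset.sum_range_sub, add_sub_cancel]
  set z := Z 0 + ∑' j, (Z (j + 1) - Z j) with hz
  have hunif := ContinuousMap.tendsto_iff_forall_isCompact_tendstoUniformlyOn.1 hlim
  refine ⟨z, fun t => ?_⟩
  have l1 : Tendsto (fun n => Z (n + 1) t) atTop (𝓝 (z t)) :=
    ((hunif _ (isCompact_singleton (x := t))).tendsto_at rfl).comp (tendsto_add_atTop_nat 1)
  have l2 : Tendsto (fun n => Z (n + 1) t) atTop (𝓝 (picardMap B z₀ z t)) := by
    rw [Metric.tendsto_nhds]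
    intro ε hε
    have hMt := hM |t|
    -- With this accuracy on [-|t|, |t|] the integrals up to time t differ by less than ε.
    have hpos : 0 < ε / (M |t| * |t| + 1) := by positivity
    filter_upwards [Metric.tendstoUniformlyOn_iff.1 (hunif _ (isCompact_closedBall 0 |t|)) _ hpos]
      with n hn
    rw [hZ, dist_eq_norm]
    have hb : ∀ s ∈ Set.uIoc 0 t, ‖B (Z n) s - B z s‖ ≤ M |t| * (ε / (M |t| * |t| + 1)) := by
      intro s hs
      have hst := abs_le_abs_of_mem_uIoc hs
      refine hB |t| _ _ s hst _ fun r hr => ?_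
      rw [← dist_eq_norm, dist_comm]
      exact (hn r (by simpa using hr.trans hst)).le
    have c1 : Continuous fun s => ‖B (Z n) s - B z s‖ := by fun_prop
    refine ((norm_picardMap_sub_le B z₀ _ _ t).trans (setIntegral_mono_on
      (integrableOn_uIoc_of_continuous c1 0 t)
      (integrableOn_uIoc_of_continuous continuous_const 0 t) measurableSet_uIoc hb)).trans_lt ?_
    rw [setIntegral_const, Set.uIoc, measureReal_def, Real.volume_Ioc, smul_eq_mul,
      max_sub_min_eq_abs, sub_zero, ENNReal.toReal_ofReal (abs_nonneg t)]
    rw [← mul_assoc, mul_comm |t|, mul_div_assoc', div_lt_iff₀ (by positivity)]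
    nlinarith
  exact tendsto_nhds_unique l1 l2

theorem hasDerivAt_of_eq_integral [CompleteSpace V] {z b : ℝ → V} {z₀ : V} (hb : Continuous b)
    (h : ∀ t, z t = z₀ + ∫ s in 0..t, b s) (t : ℝ) : HasDerivAt z (b t) t := by
  rw [funext h]
  exact (intervalIntegral.integral_hasDerivAt_right (hb.intervalIntegrable _ _)
    hb.stronglyMeasurable.stronglyMeasurableAtFilter hb.continuousAt).const_add _

end picard

end

section

/-! ### The coupling terms -/

/-- The source `q(t) · ∇ρ` of the field equation. -/
def source (ρ : R3 → ℝ) (q : ℝ → R3) (t : ℝ) (x : R3) : ℝ := ∑ i, q t i * pd i ρ x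

/-- The force `∫ u ∇ρ` exerted by the field on the particle. -/
def force (ρ u : R3 → ℝ) : R3 := ∫ x, u x • ∇ ρ x

/-- A bound for the coupling with `∇ρ`. -/
def couplingBound (ρ : R3 → ℝ) : ℝ := ∑ i, (eLpNorm (pd i ρ) 2 volume).toReal

theorem couplingBound_nonneg (ρ : R3 → ℝ) : 0 ≤ couplingBound ρ :=
  Finset.sum_nonneg fun _ _ => ENNReal.toReal_nonneg

variable {ρ : R3 → ℝ}

theorem sum_l2norm_pd_le (hρ : IsTest ρ) (R : ℝ) : ∑ i, l2norm R (pd i ρ) ≤ couplingBound ρ :=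
  Finset.sum_le_sum fun i _ => ENNReal.toReal_mono
    ((hρ.pd i).continuous.memLp_of_hasCompactSupport (hρ.pd i).supp).2.ne
    (eLpNorm_mono_measure _ Measure.restrict_le_self)

theorem source_sub (q q' : ℝ → R3) (t : ℝ) (x : R3) :
    source ρ q t x - source ρ q' t x = source ρ (fun s => q s - q' s) t x := by
  simp [source, ← Finset.sum_sub_distrib, sub_mul]

theorem abs_apply_le_norm (q : R3) (i : Fin 3) : |q i| ≤ ‖q‖ := PiLp.norm_apply_le q i

theorem l2norm_source_le (hρ : IsTest ρ) (q : ℝ → R3) (t R : ℝ) :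
    l2norm R (source ρ q t) ≤ ‖q t‖ * couplingBound ρ := by
  have h0 := fun i => (hρ.pd i).memL2loc.const_mul (q t i)
  have h1 : l2norm R (source ρ q t) ≤ ∑ i, l2norm R (fun x => q t i * pd i ρ x) := by
    have e : source ρ q t = fun x => q t 0 * pd 0 ρ x + q t 1 * pd 1 ρ x + q t 2 * pd 2 ρ x := by
      ext x; simp [source, Fin.sum_univ_three]
    rw [e, Fin.sum_univ_three]
    exact (l2norm_add_le ((h0 0).add (h0 1)) (h0 2) R).trans
      (by gcongr; exact l2norm_add_le (h0 0) (h0 1) R)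
  refine h1.trans ?_
  refine le_trans ?_ (mul_le_mul_of_nonneg_left (sum_l2norm_pd_le hρ R) (norm_nonneg _))
  rw [Finset.mul_sum]
  refine Finset.sum_le_sum fun i _ => ?_
  rw [l2norm_const_mul]
  exact mul_le_mul_of_nonneg_right (abs_apply_le_norm _ _) (l2norm_nonneg _ _)

theorem integrable_force {u : R3 → ℝ} (hu : MemL2loc u) (hρ : IsTest ρ) :
    Integrable (fun x => u x • ∇ ρ x) := integrable_smul_grad hu hρ.smooth hρ.supp

theorem force_apply {u : R3 → ℝ} (hu : MemL2loc u) (hρ : IsTest ρ) (i : Fin 3) :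
    force ρ u i = ∫ x, u x * pd i ρ x := by
  have := ((EuclideanSpace.proj i : R3 →L[ℝ] ℝ).integral_comp_comm (integrable_force hu hρ)).symm
  simpa [force, gradient_apply] using this

theorem force_sub {u v : R3 → ℝ} (hu : MemL2loc u) (hv : MemL2loc v) (hρ : IsTest ρ) :
    force ρ (fun x => u x - v x) = force ρ u - force ρ v := by
  rw [force, force, force, ← integral_sub (integrable_force hu hρ) (integrable_force hv hρ)]
  simp only [sub_smul]

theorem force_congr {u v : R3 → ℝ} (h : u =ᵐ[volume] v) : force ρ u = force ρ v :=
  integral_congr_ae (h.mono fun x hx => by simp only [hx])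

theorem norm_le_sum_abs (q : R3) : ‖q‖ ≤ ∑ i, |q i| := by
  rw [EuclideanSpace.norm_eq]
  refine Real.sqrt_le_iff.2 ⟨Finset.sum_nonneg fun _ _ => abs_nonneg _, ?_⟩
  simp only [Fin.sum_univ_three, Real.norm_eq_abs]
  have := abs_nonneg (q 0)
  have := abs_nonneg (q 1)
  have := abs_nonneg (q 2)
  nlinarith [mul_nonneg (abs_nonneg (q 0)) (abs_nonneg (q 1)),
    mul_nonneg (abs_nonneg (q 0)) (abs_nonneg (q 2)),
    mul_nonneg (abs_nonneg (q 1)) (abs_nonneg (q 2))]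

/-- The particle feels the field only on the support of ∇ρ, so a local norm of the field suffices.
-/
theorem norm_force_le {u : R3 → ℝ} (hu : MemL2loc u) (hρ : IsTest ρ) {R : ℝ}
    (hR : ∀ i x, R ≤ ‖x‖ → pd i ρ x = 0) : ‖force ρ u‖ ≤ l2norm R u * couplingBound ρ := by
  refine (norm_le_sum_abs _).trans ?_
  refine le_trans ?_ (mul_le_mul_of_nonneg_left (sum_l2norm_pd_le hρ R) (l2norm_nonneg _ _))
  rw [Finset.mul_sum]
  refine Finset.sum_le_sum fun i _ => ?_
  rw [force_apply hu hρ]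
  exact abs_integral_mul_le hu (hρ.pd i).memL2loc (hR i)

theorem exists_radius_pd (hρ : IsTest ρ) : ∃ R : ℝ, ∀ i x, R ≤ ‖x‖ → pd i ρ x = 0 := by
  choose R _ hR using fun i => exists_radius_of_hasCompactSupport (hρ.pd i).supp
  refine ⟨∑ i, R i, fun i x hx => hR i x (le_trans ?_ hx)⟩
  exact Finset.single_le_sum (f := R) (fun j _ => (by assumption : ∀ i, 0 < R i) j |>.le)
    (Finset.mem_univ i)

theorem continuous_force {u : ℝ → R3 → ℝ} (hu : L2Cont u) (hρ : IsTest ρ) :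
    Continuous fun t => force ρ (u t) := by
  obtain ⟨R, hR⟩ := exists_radius_pd hρ
  rw [continuous_iff_continuousAt]
  intro t
  rw [ContinuousAt, tendsto_iff_norm_sub_tendsto_zero]
  refine squeeze_zero (fun _ => norm_nonneg _) (fun s => ?_)
    (by simpa using (hu.tendsto t R).mul_const (couplingBound ρ))
  rw [← force_sub (hu.mem s) (hu.mem t) hρ]
  exact norm_force_le ((hu.mem s).sub (hu.mem t)) hρ hR

theorem IsWeakPd.ae_eq_zero {i : Fin 3} {u g : R3 → ℝ} (h : IsWeakPd i u g) (hg : MemL2loc g)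
    (hu : u =ᵐ[volume] 0) : g =ᵐ[volume] 0 := by
  refine IsWeakPd.unique (u := u) h (g' := fun _ => 0) (fun ψ _ => ?_) hg MemL2loc.zero
  rw [integral_eq_zero_of_ae (hu.mono fun x hx => by simp [hx])]
  simp

/-- The gradient term vanishes too, since a weak derivative of the zero function is zero. -/
theorem IsKG.energy_zero_of_ae {m : ℝ} {F u v : ℝ → R3 → ℝ} {g : Fin 3 → ℝ → R3 → ℝ}
    (h : IsKG m F u v g) (hu : u 0 =ᵐ[volume] 0) (hv : v 0 =ᵐ[volume] 0) (R : ℝ) :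
    energy R (u 0) (v 0) (fun i => g i 0) = 0 := by
  have hg := fun i => (h.grad i 0).ae_eq_zero ((h.cg i).mem 0) hu
  have z : l2norm R (0 : R3 → ℝ) = 0 := l2norm_zero R
  simp [energy, l2norm_congr hu, l2norm_congr hv, fun i => l2norm_congr (hg i) R, z]

/-! ### Existence for the coupled system -/

/-- Solutions of the coupled system, in terms of the components of the fields and their weak
partial derivatives. -/
structure IsCoupled {d : ℕ} (m : Fin d → ℝ) (ω₀ : ℝ) (ρ : Fin d → R3 → ℝ) (u v : Fin d → ℝ → R3 → ℝ)
    (g : Fin d → Fin 3 → ℝ → R3 → ℝ) (q p : ℝ → R3) : Prop where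
  field : ∀ n, IsKG (m n) (source (ρ n) q) (u n) (v n) (g n)
  dq : ∀ t, HasDerivAt q (p t) t
  dp : ∀ t, HasDerivAt p (-(ω₀ ^ 2) • q t - ∑ n, force (ρ n) (u n t)) t

/-- The difference of the two fields starts from zero and is driven by (q - q')·∇ρ, so the energy
inequality bounds it through the trajectories up to time |t| alone. The coupling bound enters twice,
once through the source and once through the force. -/
theorem norm_force_sub_le {m : ℝ} (hρ : IsTest ρ) {R₀ : ℝ}
    (hR₀ : ∀ i x, R₀ ≤ ‖x‖ → pd i ρ x = 0) {q q' : ℝ → R3} {u v u' v' : ℝ → R3 → ℝ}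
    {g g' : Fin 3 → ℝ → R3 → ℝ} (h : IsKG m (source ρ q) u v g)
    (h' : IsKG m (source ρ q') u' v' g') (hu : u 0 =ᵐ[volume] u' 0) (hv : v 0 =ᵐ[volume] v' 0)
    {T t c : ℝ} (ht : |t| ≤ T) (hc : ∀ s, |s| ≤ |t| → ‖q s - q' s‖ ≤ c) :
    ‖force ρ (u t) - force ρ (u' t)‖ ≤
      √(Real.exp ((2 + m ^ 2) * T) * T) * couplingBound ρ ^ 2 * c := by
  have hc0 : 0 ≤ c := (norm_nonneg _).trans (hc t le_rfl)
  have hT : 0 ≤ T := (abs_nonneg t).trans ht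
  have hd := h.sub h'
  have hΛ := couplingBound_nonneg ρ
  have e1 := hd.energy_le_of_bound (t := t) (B := (c * couplingBound ρ) ^ 2) (fun s hs r => by
    simp only [source_sub]
    refine pow_le_pow_left₀ (l2norm_nonneg _ _) ((l2norm_source_le hρ _ _ _).trans ?_) 2
    gcongr
    exact hc s hs) R₀
  rw [hd.energy_zero_of_ae (hu.mono fun x hx => by simp [hx]) (hv.mono fun x hx => by simp [hx]),
    zero_add] at e1
  have e2 : l2norm R₀ (fun x => u t x - u' t x) ^ 2 ≤
      (√(Real.exp ((2 + m ^ 2) * T) * T) * (c * couplingBound ρ)) ^ 2 := by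
    rw [mul_pow, Real.sq_sqrt (by positivity)]
    refine (l2norm_sq_fst_le_energy _ _ _ _).trans (e1.trans ?_)
    rw [← mul_assoc]
    gcongr
  have e3 := le_of_sq_le_sq e2 (by positivity)
  rw [← force_sub (h.cu.mem t) (h'.cu.mem t) hρ]
  refine (norm_force_le ((h.cu.mem t).sub (h'.cu.mem t)) hρ hR₀).trans ?_
  refine (mul_le_mul_of_nonneg_right e3 hΛ).trans (le_of_eq (by ring))

/-- The field equations are solved first, for every continuous trajectory, which leaves a causal
integral equation for (q, p) alone. A fixed point together with the field that it generates solves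
the full system. -/
theorem exists_isCoupled {d : ℕ} (m : Fin d → ℝ) (ω₀ : ℝ) {ρ : Fin d → R3 → ℝ}
    (hρ : ∀ n, IsTest (ρ n)) {f g : Fin d → R3 → ℝ} {γ : Fin d → Fin 3 → R3 → ℝ} (q₀ p₀ : R3)
    (hf : ∀ n, MemL2loc (f n)) (hg : ∀ n, MemL2loc (g n)) (hγ : ∀ n i, MemL2loc (γ n i))
    (hw : ∀ n i, IsWeakPd i (f n) (γ n i)) :
    ∃ u v gr q p, IsCoupled m ω₀ ρ u v gr q p ∧ (∀ n, u n 0 =ᵐ[volume] f n) ∧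
      (∀ n, v n 0 =ᵐ[volume] g n) ∧ q 0 = q₀ ∧ p 0 = p₀ := by
  have hex : ∀ (n : Fin d) (q : C(ℝ, R3)), ∃ u v gr, IsKG (m n) (source (ρ n) q) u v gr ∧
      u 0 =ᵐ[volume] f n ∧ v 0 =ᵐ[volume] g n := fun n q =>
    exists_isKG (m n) (hf n) (hg n) (hγ n) (hw n) (h := fun i t => q t i)
      (fun i => by fun_prop) fun i => (hρ n).pd i
  choose u v gr hk hu hv using hex
  choose R₀ hR₀ using fun n => exists_radius_pd (hρ n)
  let B : C(ℝ, R3 × R3) → C(ℝ, R3 × R3) := fun z =>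
    ⟨fun t => ((z t).2, -(ω₀ ^ 2) • (z t).1 -
      ∑ n, force (ρ n) (u n (ContinuousMap.fst.comp z) t)), by
        have := fun n => continuous_force (hk n (ContinuousMap.fst.comp z)).cu (hρ n)
        fun_prop⟩
  -- The summand 1 accounts for q̇ = p, ω₀² for the restoring force, and the sum for the forces
  -- exerted by the fields.
  let M : ℝ → ℝ := fun T => 1 + ω₀ ^ 2 +
    ∑ n, √(Real.exp ((2 + m n ^ 2) * T) * T) * couplingBound (ρ n) ^ 2
  have hM0 : ∀ T, 0 ≤ ∑ n, √(Real.exp ((2 + m n ^ 2) * T) * T) * couplingBound (ρ n) ^ 2 :=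
    fun T => Finset.sum_nonneg fun n _ => by positivity
  have hB : CausalLipschitz B M := by
    intro T z w t ht c hc
    have hc0 : 0 ≤ c := (norm_nonneg _).trans (hc t le_rfl)
    have hMc : M T * c = c + ω₀ ^ 2 * c +
        (∑ n, √(Real.exp ((2 + m n ^ 2) * T) * T) * couplingBound (ρ n) ^ 2) * c := by
      simp only [M]
      ring
    have h1 : ∀ s, |s| ≤ |t| → ‖(z s).1 - (w s).1‖ ≤ c := fun s hs =>
      (norm_fst_le (z s - w s)).trans (hc s hs)
    have h2 : ‖(z t).2 - (w t).2‖ ≤ c := (norm_snd_le (z t - w t)).trans (hc t le_rfl)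
    have h3 := fun n => norm_force_sub_le (hρ n) (hR₀ n) (hk n (ContinuousMap.fst.comp z))
      (hk n (ContinuousMap.fst.comp w)) ((hu n _).trans (hu n _).symm)
      ((hv n _).trans (hv n _).symm) ht h1
    refine norm_prod_le_iff.2 ⟨?_, ?_⟩
    · refine h2.trans ?_
      have := mul_nonneg (hM0 T) hc0
      have := mul_nonneg (sq_nonneg ω₀) hc0
      rw [hMc]
      linarith
    · have e : (B z t - B w t).2 = -(ω₀ ^ 2) • ((z t).1 - (w t).1) -
          ∑ n, (force (ρ n) (u n (ContinuousMap.fst.comp z) t) -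
            force (ρ n) (u n (ContinuousMap.fst.comp w) t)) := by
        simp only [B, Prod.snd_sub, ContinuousMap.coe_mk, Finset.sum_sub_distrib, smul_sub]
        abel
      rw [e]
      refine (norm_sub_le _ _).trans ?_
      have h4 := (norm_sum_le Finset.univ fun n =>
        (force (ρ n) (u n (ContinuousMap.fst.comp z) t) -
            force (ρ n) (u n (ContinuousMap.fst.comp w) t))).trans
        (Finset.sum_le_sum fun n _ => h3 n)
      rw [← Finset.sum_mul] at h4
      have h5 : ‖-(ω₀ ^ 2) • ((z t).1 - (w t).1)‖ ≤ ω₀ ^ 2 * c := by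
        rw [norm_smul, norm_neg, Real.norm_eq_abs, abs_of_nonneg (sq_nonneg ω₀)]
        gcongr
        exact h1 t le_rfl
      rw [hMc]
      linarith
  obtain ⟨z, hz⟩ := hB.exists_fixedPoint (fun T => by have := hM0 T; positivity) (q₀, p₀)
  have hz0 : z 0 = (q₀, p₀) := by simpa using hz 0
  have hd := fun t => hasDerivAt_of_eq_integral (B z).continuous hz t
  exact ⟨fun n => u n (ContinuousMap.fst.comp z), fun n => v n (ContinuousMap.fst.comp z),
    fun n => gr n (ContinuousMap.fst.comp z), fun t => (z t).1, fun t => (z t).2,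
    ⟨fun n => hk n (ContinuousMap.fst.comp z), fun t => (hd t).fst, fun t => (hd t).snd⟩, fun n => hu n _, fun n => hv n _,
    by simp [hz0], by simp [hz0]⟩

end

section

/-! ### The energy estimate for the coupled system -/

/-- Grönwall's lemma: e^{-ks} Q(s) is nonincreasing. -/
theorem le_exp_mul_of_deriv_le {Q Q' : ℝ → ℝ} {k t : ℝ} (ht : 0 ≤ t)
    (h : ∀ s, HasDerivAt Q (Q' s) s) (hle : ∀ s ∈ Set.Icc 0 t, Q' s ≤ k * Q s) :
    Q t ≤ Real.exp (k * t) * Q 0 := by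
  have hd : ∀ s, HasDerivAt (fun s => Real.exp (-k * s) * Q s)
      (Real.exp (-k * s) * (Q' s - k * Q s)) s := by
    intro s
    have h1 : HasDerivAt (fun s => Real.exp (-k * s)) (Real.exp (-k * s) * (-k)) s := by
      simpa using ((hasDerivAt_id s).const_mul (-k)).exp
    exact (h1.mul (h s)).congr_deriv (by ring)
  have ha : AntitoneOn (fun s => Real.exp (-k * s) * Q s) (Set.Icc 0 t) := by
    refine antitoneOn_of_deriv_nonpos (convex_Icc 0 t)
      (fun s _ => (hd s).continuousAt.continuousWithinAt)
      (fun s _ => (hd s).differentiableAt.differentiableWithinAt) fun s hs => ?_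
    rw [(hd s).deriv]
    refine mul_nonpos_of_nonneg_of_nonpos (Real.exp_nonneg _) ?_
    linarith [hle s (interior_subset hs)]
  have := ha (Set.left_mem_Icc.2 ht) (Set.right_mem_Icc.2 ht) ht
  simp only [mul_zero, Real.exp_zero, one_mul, neg_mul, Real.exp_neg] at this
  rwa [inv_mul_le_iff₀ (Real.exp_pos _)] at this

variable {d : ℕ} {m : Fin d → ℝ} {ω₀ : ℝ} {ρ : Fin d → R3 → ℝ} {u v : Fin d → ℝ → R3 → ℝ}
  {g : Fin d → Fin 3 → ℝ → R3 → ℝ} {q p : ℝ → R3}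

/-- The local energy of the coupled system. -/
def coupledEnergy (R : ℝ) (u v : Fin d → R3 → ℝ) (g : Fin d → Fin 3 → R3 → ℝ) (q p : R3) : ℝ :=
  (∑ n, energy R (u n) (v n) (g n)) + ‖q‖ ^ 2 + ‖p‖ ^ 2

theorem IsCoupled.reverse (h : IsCoupled m ω₀ ρ u v g q p) :
    IsCoupled m ω₀ ρ (fun n t => u n (-t)) (fun n t x => -v n (-t) x) (fun n i t => g n i (-t))
      (fun t => q (-t)) (fun t => -p (-t)) := by
  refine ⟨fun n => (h.field n).reverse, fun t => ?_, fun t => ?_⟩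
  · exact ((h.dq (-t)).scomp t (hasDerivAt_neg t)).congr_deriv (by simp)
  · exact ((h.dp (-t)).scomp t (hasDerivAt_neg t)).neg.congr_deriv (by
      rw [neg_one_smul, neg_neg])

theorem IsCoupled.sub (hρ : ∀ n, IsTest (ρ n)) {u' v' : Fin d → ℝ → R3 → ℝ}
    {g' : Fin d → Fin 3 → ℝ → R3 → ℝ} {q' p' : ℝ → R3} (h : IsCoupled m ω₀ ρ u v g q p)
    (h' : IsCoupled m ω₀ ρ u' v' g' q' p') :
    IsCoupled m ω₀ ρ (fun n t x => u n t x - u' n t x) (fun n t x => v n t x - v' n t x)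
      (fun n i t x => g n i t x - g' n i t x) (fun t => q t - q' t) (fun t => p t - p' t) := by
  refine ⟨fun n => ?_, fun t => (h.dq t).sub (h'.dq t), fun t => ?_⟩
  · simpa only [source_sub] using (h.field n).sub (h'.field n)
  · refine ((h.dp t).sub (h'.dp t)).congr_deriv ?_
    simp only [force_sub ((h.field _).cu.mem t) ((h'.field _).cu.mem t) (hρ _),
      Finset.sum_sub_distrib, smul_sub]
    abel

/-- The growth factor of the local energy over the times `|t| ≤ T`. -/
def growthFactor (m : Fin d → ℝ) (ω₀ : ℝ) (ρ : Fin d → R3 → ℝ) (T : ℝ) : ℝ :=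
  let K := Real.exp ((2 + ∑ n, m n ^ 2) * T)
  let Λ := ∑ n, couplingBound (ρ n) ^ 2
  (1 + K * (1 + d * Λ)) * Real.exp ((2 + ω₀ ^ 2 + d + Λ * K + Λ * K * (d * Λ)) * T)

theorem growthFactor_nonneg (m : Fin d → ℝ) (ω₀ : ℝ) (ρ : Fin d → R3 → ℝ) (T : ℝ) :
    0 ≤ growthFactor m ω₀ ρ T := by
  have : 0 ≤ ∑ n, couplingBound (ρ n) ^ 2 := Finset.sum_nonneg fun n _ => sq_nonneg _
  unfold growthFactor
  positivity

/-- The field energy e is controlled by its initial value and the history I of ‖q‖², while the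
derivative of the particle energy P is controlled by P and e. Since R covers the support of ∇ρ, the
force at every time involves only the field energy on the same ball of radius R, and the argument
closes on that ball with data from radius R + t. -/
theorem IsCoupled.energy_le_of_nonneg (hρ : ∀ n, IsTest (ρ n)) (h : IsCoupled m ω₀ ρ u v g q p)
    {R : ℝ} (hR : ∀ n i x, R ≤ ‖x‖ → pd i (ρ n) x = 0) {t T : ℝ} (ht : 0 ≤ t) (htT : t ≤ T) :
    coupledEnergy R (fun n => u n t) (fun n => v n t) (fun n i => g n i t) (q t) (p t) ≤
      growthFactor m ω₀ ρ T * coupledEnergy (R + t) (fun n => u n 0) (fun n => v n 0)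
        (fun n i => g n i 0) (q 0) (p 0) := by
  set K := Real.exp ((2 + ∑ n, m n ^ 2) * T) with hK
  set Λ := ∑ n, couplingBound (ρ n) ^ 2 with hΛ
  set e : ℝ → ℝ := fun s => ∑ n, energy R (u n s) (v n s) (fun i => g n i s) with he
  set e₀ := ∑ n, energy (R + t) (u n 0) (v n 0) (fun i => g n i 0) with he₀
  set P : ℝ → ℝ := fun s => ‖q s‖ ^ 2 + ‖p s‖ ^ 2 with hP
  set I : ℝ → ℝ := fun s => ∫ r in 0..s, ‖q r‖ ^ 2 with hI
  have hT : 0 ≤ T := ht.trans htT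
  have hK0 : 0 ≤ K := Real.exp_nonneg _
  have hΛ0 : 0 ≤ Λ := Finset.sum_nonneg fun n _ => sq_nonneg _
  have hΛn : ∀ n, couplingBound (ρ n) ^ 2 ≤ Λ := fun n =>
    Finset.single_le_sum (f := fun n => couplingBound (ρ n) ^ 2) (fun _ _ => sq_nonneg _)
      (Finset.mem_univ n)
  have he₀0 : 0 ≤ e₀ := Finset.sum_nonneg fun n _ => energy_nonneg _ _ _ _
  have cq : Continuous q := continuous_iff_continuousAt.2 fun s => (h.dq s).continuousAt
  have cp : Continuous p := continuous_iff_continuousAt.2 fun s => (h.dp s).continuousAt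
  have hI0 : ∀ s ∈ Set.Icc 0 t, 0 ≤ I s := fun s hs =>
    intervalIntegral.integral_nonneg hs.1 fun r _ => sq_nonneg _
  -- Here K dominates the exponential factors of all components up to time T, and the factor d
  -- arises because the source of each component is bounded with the same Λ.
  have hfield : ∀ s ∈ Set.Icc 0 t, e s ≤ K * (e₀ + d * Λ * I s) := by
    intro s hs
    have h1 : ∀ n, energy R (u n s) (v n s) (fun i => g n i s) ≤
        K * (energy (R + t) (u n 0) (v n 0) (fun i => g n i 0) + Λ * I s) := by
      intro n
      have hf := h.field n
      have b1 := hf.energy_le hs.1 (β := fun r => Λ * ‖q r‖ ^ 2) (by fun_prop) (fun r _ R' => by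
        refine (pow_le_pow_left₀ (l2norm_nonneg _ _) (l2norm_source_le (hρ n) q r R') 2).trans ?_
        rw [mul_pow, mul_comm]
        exact mul_le_mul_of_nonneg_right (hΛn n) (sq_nonneg _)) R
      rw [intervalIntegral.integral_const_mul] at b1
      refine b1.trans ?_
      have hE0 := energy_nonneg (R + s) (u n 0) (v n 0) (fun i => g n i 0)
      have hE := energy_mono (hf.cu.mem 0) (hf.cv.mem 0) (fun i => (hf.cg i).mem 0)
        (show R + s ≤ R + t by linarith [hs.2])
      have hexp : Real.exp ((2 + m n ^ 2) * s) ≤ K := by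
        refine Real.exp_le_exp.2 (mul_le_mul ?_ (hs.2.trans htT) hs.1 ?_)
        · have := Finset.single_le_sum (f := fun n => m n ^ 2) (fun _ _ => sq_nonneg _)
            (Finset.mem_univ n)
          linarith
        · have : 0 ≤ ∑ n, m n ^ 2 := Finset.sum_nonneg fun _ _ => sq_nonneg _
          positivity
      have := hI0 s hs
      exact mul_le_mul hexp (by simp only [hI]; linarith) (by positivity) hK0
    refine (Finset.sum_le_sum fun n _ => h1 n).trans (le_of_eq ?_)
    rw [← Finset.mul_sum, Finset.sum_add_distrib]
    simp only [Finset.sum_const, Finset.card_univ, Fintype.card_fin, nsmul_eq_mul]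
    ring
  have hforce : ∀ s n, ‖force (ρ n) (u n s)‖ ^ 2 ≤
      Λ * energy R (u n s) (v n s) (fun i => g n i s) := by
    intro s n
    refine (pow_le_pow_left₀ (norm_nonneg _)
      (norm_force_le ((h.field n).cu.mem s) (hρ n) (hR n)) 2).trans ?_
    rw [mul_pow, mul_comm]
    exact mul_le_mul (hΛn n) (l2norm_sq_fst_le_energy _ _ _ _) (sq_nonneg _) hΛ0
  set P' : ℝ → ℝ := fun s => 2 * inner ℝ (q s) (p s) +
    2 * inner ℝ (p s) (-(ω₀ ^ 2) • q s - ∑ n, force (ρ n) (u n s)) with hP'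
  have hdP : ∀ s, HasDerivAt P (P' s) s := fun s => (h.dq s).norm_sq.add (h.dp s).norm_sq
  -- The terms 2⟨q, p⟩ and -2ω₀²⟨p, q⟩ contribute P and ω₀² P. Each of the d forces contributes at
  -- most P plus Λ times the energy of its component.
  have hP'le : ∀ s, P' s ≤ (1 + ω₀ ^ 2 + d) * P s + Λ * e s := by
    intro s
    have i1 : |inner ℝ (q s) (p s)| ≤ P s / 2 := by
      refine (abs_real_inner_le_norm _ _).trans ?_
      simp only [hP]
      nlinarith [sq_nonneg (‖q s‖ - ‖p s‖)]
    have i2 : ∀ n, -(2 * inner ℝ (p s) (force (ρ n) (u n s))) ≤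
        P s + Λ * energy R (u n s) (v n s) (fun i => g n i s) := by
      intro n
      have a1 := abs_real_inner_le_norm (p s) (force (ρ n) (u n s))
      have a2 := hforce s n
      simp only [hP]
      nlinarith [sq_nonneg (‖p s‖ - ‖force (ρ n) (u n s)‖), sq_nonneg ‖q s‖,
        neg_abs_le (inner ℝ (p s) (force (ρ n) (u n s)))]
    have i3 := Finset.sum_le_sum fun n (_ : n ∈ Finset.univ) => i2 n
    rw [Finset.sum_neg_distrib, ← Finset.mul_sum, Finset.sum_add_distrib, ← Finset.mul_sum] at i3
    simp only [Finset.sum_const, Finset.card_univ, Fintype.card_fin, nsmul_eq_mul] at i3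
    simp only [hP', inner_sub_right, inner_smul_right, inner_sum]
    rw [real_inner_comm (q s) (p s)]
    rw [abs_le] at i1
    have i4 := mul_le_mul_of_nonneg_left i1.1 (sq_nonneg ω₀)
    simp only [he]
    nlinarith
  -- Adding I and the constant e₀ to P removes the memory from the inequality: the bound for e
  -- involves only these quantities, and I' = ‖q‖² ≤ P.
  have hdQ : ∀ s, HasDerivAt (fun s => P s + I s + e₀) (P' s + ‖q s‖ ^ 2) s := by
    intro s
    have cc : Continuous fun r => ‖q r‖ ^ 2 := by fun_prop
    exact ((hdP s).add (intervalIntegral.integral_hasDerivAt_right (cc.intervalIntegrable _ _)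
      cc.stronglyMeasurable.stronglyMeasurableAtFilter cc.continuousAt)).add_const _
  -- The rate is the sum of the coefficients: 2 + ω₀² + d for P (one unit from I'), Λ K for e₀ and Λ
  -- K d Λ for I.
  set k := 2 + ω₀ ^ 2 + d + Λ * K + Λ * K * (d * Λ) with hk
  have hQ := le_exp_mul_of_deriv_le ht hdQ (k := k) fun s hs => by
    have a1 := hP'le s
    have a2 := mul_le_mul_of_nonneg_left (hfield s hs) hΛ0
    have a3 : ‖q s‖ ^ 2 ≤ P s := le_add_of_nonneg_right (sq_nonneg _)
    have a4 : 0 ≤ P s := by positivity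
    have a5 := hI0 s hs
    have b1 : 0 ≤ (2 + ω₀ ^ 2 + d) * (I s + e₀) := by positivity
    have b2 : 0 ≤ Λ * K * (P s + I s) := by positivity
    have b3 : 0 ≤ Λ * K * (d * Λ) * (P s + e₀) := by positivity
    rw [hk]
    linear_combination a1 + a2 + a3 + b1 + b2 + b3
  have hI00 : I 0 = 0 := by simp [hI]
  rw [hI00, add_zero] at hQ
  have hE0 : coupledEnergy (R + t) (fun n => u n 0) (fun n => v n 0) (fun n i => g n i 0) (q 0)
      (p 0) = P 0 + e₀ := by
    simp only [coupledEnergy, hP, he₀]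
    ring
  have hP0 : 0 ≤ P 0 := by positivity
  have hk0 : 0 ≤ k := by positivity
  have hQ' : P t + I t + e₀ ≤ Real.exp (k * T) * (P 0 + e₀) := hQ.trans (by gcongr)
  have hEt : coupledEnergy R (fun n => u n t) (fun n => v n t) (fun n i => g n i t) (q t)
      (p t) = e t + P t := by
    simp only [coupledEnergy, hP, he]
    ring
  rw [hE0, hEt]
  have a1 := hfield t (Set.right_mem_Icc.2 ht)
  have a2 := hI0 t (Set.right_mem_Icc.2 ht)
  have a3 : 0 ≤ P t := by positivity
  calc e t + P t ≤ (1 + K * (1 + d * Λ)) * (P t + I t + e₀) := by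
        have b1 : 0 ≤ K * (1 + d * Λ) * P t := by positivity
        have b2 : 0 ≤ I t + K * I t := by positivity
        have b3 : 0 ≤ e₀ + K * (d * Λ) * e₀ := by positivity
        linear_combination a1 + b1 + b2 + b3
    _ ≤ (1 + K * (1 + d * Λ)) * (Real.exp (k * T) * (P 0 + e₀)) := by gcongr
    _ = growthFactor m ω₀ ρ T * (P 0 + e₀) := by
        simp only [growthFactor, ← hK, ← hΛ, ← hk]
        ring

theorem IsCoupled.energy_le (hρ : ∀ n, IsTest (ρ n)) (h : IsCoupled m ω₀ ρ u v g q p)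
    {R : ℝ} (hR : ∀ n i x, R ≤ ‖x‖ → pd i (ρ n) x = 0) {t T : ℝ} (ht : |t| ≤ T) :
    coupledEnergy R (fun n => u n t) (fun n => v n t) (fun n i => g n i t) (q t) (p t) ≤
      growthFactor m ω₀ ρ T * coupledEnergy (R + |t|) (fun n => u n 0) (fun n => v n 0)
        (fun n i => g n i 0) (q 0) (p 0) := by
  rcases le_total 0 t with h0 | h0
  · rw [abs_of_nonneg h0] at ht ⊢
    exact h.energy_le_of_nonneg hρ hR h0 ht
  · rw [abs_of_nonpos h0] at ht ⊢
    have := h.reverse.energy_le_of_nonneg hρ hR (neg_nonneg.2 h0) ht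
    simpa [coupledEnergy, energy, l2norm_neg] using this

end

section

/-! ### Components of the states -/

theorem isWeakGrad_iff {u : R3 → ℝ} {g : R3 → R3} (hu : MemL2loc u) (hg : MemL2loc g) :
    IsWeakGrad u g ↔ ∀ i, IsWeakPd i u (fun x => g x i) := by
  have e1 : ∀ {ψ}, IsTest ψ → ∀ i, (∫ x, u x • ∇ ψ x) i = ∫ x, u x * pd i ψ x := fun hψ i =>
    force_apply hu hψ i
  have e2 : ∀ {ψ}, IsTest ψ → ∀ i, (∫ x, ψ x • g x) i = ∫ x, g x i * ψ x := fun {ψ} hψ i => by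
    have := ((EuclideanSpace.proj i : R3 →L[ℝ] ℝ).integral_comp_comm
      (integrable_smul_of_test hg hψ.smooth hψ.supp)).symm
    simpa [mul_comm (ψ _)] using this
  constructor
  · intro h i ψ hψ
    rw [← e1 hψ i, ← e2 hψ i, h ψ hψ.smooth hψ.supp]
    rfl
  · intro h ψ h1 h2
    ext i
    have := h i ψ ⟨h1, h2⟩
    rw [← e1 ⟨h1, h2⟩ i, ← e2 ⟨h1, h2⟩ i] at this
    simpa using this

theorem MemL2loc.apply {g : R3 → R3} (hg : MemL2loc g) (i : Fin 3) : MemL2loc (fun x => g x i) :=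
  fun R => (hg R).eval_piLp i

theorem energy_congr {u v u' v' : R3 → ℝ} {g g' : Fin 3 → R3 → ℝ} (hu : u =ᵐ[volume] u')
    (hv : v =ᵐ[volume] v') (hg : ∀ i, g i =ᵐ[volume] g' i) (R : ℝ) :
    energy R u v g = energy R u' v' g' := by
  simp [energy, l2norm_congr hu, l2norm_congr hv, fun i => l2norm_congr (hg i) R]

variable {d : ℕ}

theorem coupledEnergy_congr {u v u' v' : Fin d → R3 → ℝ} {g g' : Fin d → Fin 3 → R3 → ℝ}
    (hu : ∀ n, u n =ᵐ[volume] u' n) (hv : ∀ n, v n =ᵐ[volume] v' n)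
    (hg : ∀ n i, g n i =ᵐ[volume] g' n i) (R : ℝ) (q p : R3) :
    coupledEnergy R u v g q p = coupledEnergy R u' v' g' q p := by
  simp only [coupledEnergy, fun n => energy_congr (hu n) (hv n) (hg n) R]

namespace PhaseSpace

theorem memL2loc_gradPhi_apply (Y : PhaseSpace d) (n : Fin d) (i : Fin 3) :
    MemL2loc (fun x => Y.gradPhi n x i) := (Y.memL2loc_gradPhi n).apply i

theorem isWeakPd_phi (Y : PhaseSpace d) (n : Fin d) (i : Fin 3) :
    IsWeakPd i (Y.phi n) (fun x => Y.gradPhi n x i) :=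
  (isWeakGrad_iff (Y.memL2loc_phi n) (Y.memL2loc_gradPhi n)).1 (isWeakGrad_weakGrad _) i

theorem localEnergy_eq (R : ℝ) (Y : PhaseSpace d) :
    localEnergy R Y = coupledEnergy R Y.phi Y.mom (fun n i x => Y.gradPhi n x i) Y.pos Y.imp := by
  rw [localEnergy, coupledEnergy, integral_finsetSum]
  · congr 2
    refine Finset.sum_congr rfl fun n _ => ?_
    rw [energy_eq_integral (Y.memL2loc_phi n) (Y.memL2loc_mom n) (Y.memL2loc_gradPhi_apply n)]
    simp only [density, EuclideanSpace.real_norm_sq_eq]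
  · intro n _
    exact (((Y.memL2loc_phi n).integrableOn_sq R).add
      ((Y.memL2loc_gradPhi n R).integrable_norm_pow (by norm_num))).add
      ((Y.memL2loc_mom n).integrableOn_sq R)

theorem phi_sub (Y Z : PhaseSpace d) (n : Fin d) :
    (Y - Z).phi n =ᵐ[volume] fun x => Y.phi n x - Z.phi n x := AEEqFun.coeFn_sub _ _

theorem mom_sub (Y Z : PhaseSpace d) (n : Fin d) :
    (Y - Z).mom n =ᵐ[volume] fun x => Y.mom n x - Z.mom n x := AEEqFun.coeFn_sub _ _

theorem gradPhi_sub (Y Z : PhaseSpace d) (n : Fin d) (i : Fin 3) :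
    (fun x => (Y - Z).gradPhi n x i) =ᵐ[volume] fun x => Y.gradPhi n x i - Z.gradPhi n x i := by
  have h := gradPhi_add Y ((-1 : ℝ) • Z) n
  rw [neg_one_smul, ← sub_eq_add_neg] at h
  have h' := gradPhi_smul (-1) Z n
  rw [neg_one_smul] at h'
  filter_upwards [h, h'] with x hx hx'
  rw [hx, Pi.add_apply, hx']
  simp [sub_eq_add_neg]

theorem localEnergy_sub (R : ℝ) (Y Z : PhaseSpace d) :
    localEnergy R (Y - Z) = coupledEnergy R (fun n x => Y.phi n x - Z.phi n x)
      (fun n x => Y.mom n x - Z.mom n x) (fun n i x => Y.gradPhi n x i - Z.gradPhi n x i)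
      (Y.pos - Z.pos) (Y.imp - Z.imp) := by
  rw [localEnergy_eq]
  exact coupledEnergy_congr (phi_sub Y Z) (mom_sub Y Z) (gradPhi_sub Y Z) R _ _

theorem localEnergy_mono {r R : ℝ} (h : r ≤ R) (Y : PhaseSpace d) :
    localEnergy r Y ≤ localEnergy R Y := by
  simp only [localEnergy_eq, coupledEnergy]
  gcongr with n
  exact energy_mono (Y.memL2loc_phi n) (Y.memL2loc_mom n) (Y.memL2loc_gradPhi_apply n) h

/-- The gradients need not be compared, since they are determined by the fields. -/
theorem ext_of_ae {Y Z : PhaseSpace d} (h1 : ∀ n, Y.phi n =ᵐ[volume] Z.phi n)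
    (h2 : ∀ n, Y.mom n =ᵐ[volume] Z.mom n) (h3 : Y.pos = Z.pos) (h4 : Y.imp = Z.imp) : Y = Z :=
  Prod.ext (funext fun n => Subtype.ext (AEEqFun.ext (h1 n)))
    (Prod.ext (funext fun n => Subtype.ext (AEEqFun.ext (h2 n))) (Prod.ext h3 h4))

theorem energy_le_localEnergy_sub (R : ℝ) (Y Z : PhaseSpace d) (n : Fin d) :
    energy R (fun x => Y.phi n x - Z.phi n x) (fun x => Y.mom n x - Z.mom n x)
      (fun i x => Y.gradPhi n x i - Z.gradPhi n x i) ≤ localEnergy R (Y - Z) := by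
  rw [localEnergy_sub, coupledEnergy]
  have := Finset.single_le_sum (f := fun n => energy R (fun x => Y.phi n x - Z.phi n x)
    (fun x => Y.mom n x - Z.mom n x) (fun i x => Y.gradPhi n x i - Z.gradPhi n x i))
    (fun _ _ => energy_nonneg _ _ _ _) (Finset.mem_univ n)
  linarith [sq_nonneg ‖Y.pos - Z.pos‖, sq_nonneg ‖Y.imp - Z.imp‖]

/-- Large radii suffice by monotonicity; this matters because the energy estimate is available only
for balls that cover the support of ∇ρ. -/
theorem eq_of_localEnergy_sub {Y Z : PhaseSpace d} {R₀ : ℝ}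
    (h : ∀ R, R₀ ≤ R → localEnergy R (Y - Z) = 0) : Y = Z := by
  have h' : ∀ R, localEnergy R (Y - Z) = 0 := fun R =>
    le_antisymm ((localEnergy_mono (le_max_left R R₀) _).trans_eq (h _ (le_max_right _ _)))
      (localEnergy_nonneg _ _)
  have e : ∀ n R, energy R (fun x => Y.phi n x - Z.phi n x) (fun x => Y.mom n x - Z.mom n x)
      (fun i x => Y.gradPhi n x i - Z.gradPhi n x i) ≤ 0 := fun n R =>
    (energy_le_localEnergy_sub R Y Z n).trans_eq (h' R)
  have zero : ∀ {f : R3 → ℝ} {R : ℝ}, l2norm R f ^ 2 ≤ 0 → l2norm R f = 0 := fun hf =>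
    pow_eq_zero_iff two_ne_zero |>.1 (le_antisymm hf (sq_nonneg _))
  have hvec : ‖Y.pos - Z.pos‖ ^ 2 + ‖Y.imp - Z.imp‖ ^ 2 ≤ 0 := by
    have := h' 0
    rw [localEnergy_sub, coupledEnergy] at this
    have := Finset.sum_nonneg fun n (_ : n ∈ Finset.univ) => energy_nonneg 0
      (fun x => Y.phi n x - Z.phi n x) (fun x => Y.mom n x - Z.mom n x)
      (fun i x => Y.gradPhi n x i - Z.gradPhi n x i)
    linarith
  refine ext_of_ae (fun n => ?_) (fun n => ?_) ?_ ?_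
  · refine (ae_eq_zero_of_l2norm ((Y.memL2loc_phi n).sub (Z.memL2loc_phi n)) fun R =>
      zero ((l2norm_sq_fst_le_energy _ _ _ _).trans (e n R))).mono fun x hx => sub_eq_zero.1 hx
  · refine (ae_eq_zero_of_l2norm ((Y.memL2loc_mom n).sub (Z.memL2loc_mom n)) fun R =>
      zero ((l2norm_sq_snd_le_energy _ _ _ _).trans (e n R))).mono fun x hx => sub_eq_zero.1 hx
  · rw [← sub_eq_zero, ← norm_eq_zero, ← sq_eq_zero_iff]
    nlinarith [sq_nonneg ‖Y.pos - Z.pos‖, sq_nonneg ‖Y.imp - Z.imp‖]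
  · rw [← sub_eq_zero, ← norm_eq_zero, ← sq_eq_zero_iff]
    nlinarith [sq_nonneg ‖Y.pos - Z.pos‖, sq_nonneg ‖Y.imp - Z.imp‖]

theorem tendsto_iff {ι : Type*} {l : Filter ι} {Y : ι → PhaseSpace d} {Z : PhaseSpace d} :
    Tendsto Y l (𝓝 Z) ↔ ∀ R, 0 < R → Tendsto (fun s => localEnergy R (Y s - Z)) l (𝓝 0) := by
  rw [(withSeminorms d).tendsto_nhds]
  constructor
  · intro h R hR
    have h1 : Tendsto (fun s => √(localEnergy R (Y s - Z))) l (𝓝 0) := by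
      rw [Metric.tendsto_nhds]
      intro ε hε
      filter_upwards [h ⟨R, hR⟩ ε hε] with s hs
      rw [Real.dist_eq, sub_zero, abs_of_nonneg (Real.sqrt_nonneg _)]
      exact hs
    have h2 := h1.pow 2
    simp only [Real.sq_sqrt (localEnergy_nonneg _ _)] at h2
    simpa using h2
  · intro h R ε hε
    have h1 := (h R R.2).sqrt
    rw [Real.sqrt_zero] at h1
    exact h1.eventually (gt_mem_nhds hε)

/-- States with prescribed components. -/
theorem exists_components {u v : Fin d → R3 → ℝ} {g : Fin d → Fin 3 → R3 → ℝ} (q p : R3)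
    (hu : ∀ n, MemL2loc (u n)) (hv : ∀ n, MemL2loc (v n)) (hg : ∀ n i, MemL2loc (g n i))
    (hw : ∀ n i, IsWeakPd i (u n) (g n i)) :
    ∃ Y : PhaseSpace d, (∀ n, Y.phi n =ᵐ[volume] u n) ∧ (∀ n, Y.mom n =ᵐ[volume] v n) ∧
      (∀ n i, (fun x => Y.gradPhi n x i) =ᵐ[volume] g n i) ∧ Y.pos = q ∧ Y.imp = p := by
  set G : Fin d → R3 → R3 := fun n x => WithLp.toLp 2 fun i => g n i x with hG
  have mG : ∀ n, MemL2loc (G n) := fun n R => MemLp.of_eval_piLp fun i => hg n i R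
  have wG : ∀ n, IsWeakGrad (u n) (G n) := fun n => (isWeakGrad_iff (hu n) (mG n)).2 (hw n)
  have eu := fun n => AEEqFun.coeFn_mk (u n) (hu n).aestronglyMeasurable
  have ev := fun n => AEEqFun.coeFn_mk (v n) (hv n).aestronglyMeasurable
  have aG := fun n => (mG n).locallyIntegrable.aestronglyMeasurable
  have eG := fun n => AEEqFun.coeFn_mk (G n) (aG n)
  let φ : Fin d → H1loc := fun n => ⟨AEEqFun.mk (u n) (hu n).aestronglyMeasurable,
    (hu n).congr (eu n).symm, AEEqFun.mk (G n) (aG n), (mG n).congr (eG n).symm,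
    (wG n).congr (eu n).symm (eG n).symm⟩
  let π : Fin d → L2loc := fun n => ⟨AEEqFun.mk (v n) (hv n).aestronglyMeasurable,
    (hv n).congr (ev n).symm⟩
  refine ⟨(φ, π, q, p), eu, ev, fun n i => ?_, rfl, rfl⟩
  -- The weak gradient attached to a state is a chosen representative, so it agrees with the
  -- prescribed one only by uniqueness and almost everywhere.
  have := weakGrad_eq (u := φ n) (mG n) ((wG n).congr (eu n).symm EventuallyEq.rfl)
  filter_upwards [this] with x hx
  exact congrArg (fun y : R3 => y i) hx

end PhaseSpace

/-! ### Solutions of the coupled system in the phase space -/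

theorem isTest_of_couplingCondition {ρ : Fin d → R3 → ℝ} {Rρ : ℝ} (h : CouplingCondition ρ Rρ)
    (n : Fin d) : IsTest (ρ n) :=
  ⟨h.smooth n, HasCompactSupport.intro (isCompact_closedBall 0 Rρ) fun x hx =>
    h.vanish n x (by simpa using (not_le.1 (by simpa using hx : ¬ ‖x‖ ≤ Rρ)).le)⟩

/-- Because Rρ < R is strict, ρ vanishes in a whole neighbourhood of x, and with it the derivative.
-/
theorem pd_eq_zero_of_couplingCondition {ρ : Fin d → R3 → ℝ} {Rρ : ℝ}
    (h : CouplingCondition ρ Rρ) {R : ℝ} (hR : Rρ < R) (n : Fin d) (i : Fin 3) (x : R3)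
    (hx : R ≤ ‖x‖) : pd i (ρ n) x = 0 := by
  have : ρ n =ᶠ[𝓝 x] fun _ => 0 := by
    filter_upwards [continuous_norm.continuousAt.eventually (lt_mem_nhds (hR.trans_le hx))] with y hy
    exact h.vanish n y hy.le
  simp [pd, this.fderiv_eq]

theorem inner_gradient_eq_source (ρ : R3 → ℝ) (q : ℝ → R3) (t : ℝ) (x : R3) :
    inner ℝ (q t) (∇ ρ x) = source ρ q t x := by
  rw [PiLp.inner_apply]
  simp only [gradient_apply, source, RCLike.inner_apply, conj_trivial, mul_comm]

theorem continuous_source {ρ : R3 → ℝ} (hρ : IsTest ρ) {q : ℝ → R3} (hq : Continuous q) :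
    L2Cont (source ρ q) := by
  have h := fun i => (L2Cont.const (hρ.pd i).memL2loc).smul (c := fun t => q t i) (by fun_prop)
  have e : source ρ q = fun t x => q t 0 * pd 0 ρ x + q t 1 * pd 1 ρ x + q t 2 * pd 2 ρ x := by
    ext t x
    simp [source, Fin.sum_univ_three]
  rw [e]
  exact ((h 0).add (h 1)).add (h 2)

section solutions

variable {m : Fin d → ℝ} {ω₀ : ℝ} {ρ : Fin d → R3 → ℝ}

theorem l2Cont_of_energy_tendsto {f : ℝ → R3 → ℝ} (hf : ∀ t, MemL2loc (f t)) {E : ℝ → ℝ → ℝ → ℝ}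
    (hE : ∀ R t, 0 < R → Tendsto (E R t) (𝓝 t) (𝓝 0))
    (h : ∀ R t s, l2norm R (fun x => f s x - f t x) ^ 2 ≤ E R t s) : L2Cont f := by
  refine ⟨hf, fun t R => ?_⟩
  -- The topology supplies only seminorms of positive radius; the maximum with 1 also covers R ≤ 0.
  have h1 := (hE (max R 1) t (by positivity)).sqrt
  rw [Real.sqrt_zero] at h1
  refine squeeze_zero (fun _ => l2norm_nonneg _ _) (fun s => ?_) h1
  exact (l2norm_mono ((hf s).sub (hf t)) (le_max_left R 1)).trans
    (Real.le_sqrt_of_sq_le (h _ t s))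

theorem IsSolution.isCoupled (hρ : ∀ n, IsTest (ρ n)) {Y : ℝ → PhaseSpace d}
    (h : IsSolution m ω₀ ρ Y) (hY : Continuous Y) :
    IsCoupled m ω₀ ρ (fun n t => (Y t).phi n) (fun n t => (Y t).mom n)
      (fun n i t x => (Y t).gradPhi n x i) (fun t => (Y t).pos) (fun t => (Y t).imp) := by
  have hE : ∀ R t, 0 < R → Tendsto (fun s => PhaseSpace.localEnergy R (Y s - Y t)) (𝓝 t) (𝓝 0) :=
    fun R t hR => PhaseSpace.tendsto_iff.1 (hY.tendsto t) R hR
  have cq : Continuous fun t => (Y t).pos :=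
    continuous_iff_continuousAt.2 fun t => (h.pos_eq t).continuousAt
  refine ⟨fun n => ⟨continuous_source (hρ n) cq, ?_, ?_, fun i => ?_, fun i t =>
    (Y t).isWeakPd_phi n i, fun ψ hψ t => h.phi_eq n ψ hψ.smooth hψ.supp t, fun ψ hψ t => ?_⟩,
    h.pos_eq, h.imp_eq⟩
  · exact l2Cont_of_energy_tendsto (fun t => (Y t).memL2loc_phi n) hE fun R t s =>
      (l2norm_sq_fst_le_energy _ _ _ _).trans (PhaseSpace.energy_le_localEnergy_sub R (Y s) (Y t) n)
  · exact l2Cont_of_energy_tendsto (fun t => (Y t).memL2loc_mom n) hE fun R t s =>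
      (l2norm_sq_snd_le_energy _ _ _ _).trans (PhaseSpace.energy_le_localEnergy_sub R (Y s) (Y t) n)
  · exact l2Cont_of_energy_tendsto (fun t => (Y t).memL2loc_gradPhi_apply n i) hE fun R t s =>
      (l2norm_sq_grad_le_energy R (fun x => (Y s).phi n x - (Y t).phi n x)
        (fun x => (Y s).mom n x - (Y t).mom n x)
        (fun i x => (Y s).gradPhi n x i - (Y t).gradPhi n x i) i).trans
        (PhaseSpace.energy_le_localEnergy_sub R (Y s) (Y t) n)
  · have := h.mom_eq n ψ hψ.smooth hψ.supp t
    simpa only [inner_gradient_eq_source (ρ n) fun t => (Y t).pos] using this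

theorem IsCoupled.exists_isSolution {u v : Fin d → ℝ → R3 → ℝ}
    {g : Fin d → Fin 3 → ℝ → R3 → ℝ} {q p : ℝ → R3} (h : IsCoupled m ω₀ ρ u v g q p) :
    ∃ Y : C(ℝ, PhaseSpace d), IsSolution m ω₀ ρ Y ∧ (∀ n, (Y 0).phi n =ᵐ[volume] u n 0) ∧
      (∀ n, (Y 0).mom n =ᵐ[volume] v n 0) ∧ (Y 0).pos = q 0 ∧ (Y 0).imp = p 0 := by
  choose Y hu hv hg hq hp using fun t => PhaseSpace.exists_components (q t) (p t)
    (fun n => (h.field n).cu.mem t) (fun n => (h.field n).cv.mem t)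
    (fun n i => ((h.field n).cg i).mem t) fun n i => (h.field n).grad i t
  have cq : Continuous q := continuous_iff_continuousAt.2 fun s => (h.dq s).continuousAt
  have cp : Continuous p := continuous_iff_continuousAt.2 fun s => (h.dp s).continuousAt
  have cY : Continuous Y := by
    rw [continuous_iff_continuousAt]
    intro t
    refine PhaseSpace.tendsto_iff.2 fun R _ => ?_
    -- Continuity in the phase space reduces to that of the components: the local energy of the
    -- increment is a finite sum of squared norms.
    have e : ∀ s, PhaseSpace.localEnergy R (Y s - Y t) =
        (∑ n, (l2norm R (fun x => u n s x - u n t x) ^ 2 +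
          ∑ i, l2norm R (fun x => g n i s x - g n i t x) ^ 2 +
          l2norm R (fun x => v n s x - v n t x) ^ 2)) + ‖q s - q t‖ ^ 2 + ‖p s - p t‖ ^ 2 := by
      intro s
      rw [PhaseSpace.localEnergy_sub, hq, hp, hq, hp]
      exact coupledEnergy_congr (fun n => (hu s n).sub (hu t n)) (fun n => (hv s n).sub (hv t n))
        (fun n i => (hg s n i).sub (hg t n i)) R _ _
    simp only [e]
    have vec : ∀ {f : ℝ → R3}, Continuous f → Tendsto (fun s => ‖f s - f t‖ ^ 2) (𝓝 t) (𝓝 0) :=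
      fun {f} hf => by
        have : Continuous fun s => ‖f s - f t‖ ^ 2 := by fun_prop
        simpa using this.tendsto t
    have l2 : ∀ {f : ℝ → R3 → ℝ}, L2Cont f →
        Tendsto (fun s => l2norm R (fun x => f s x - f t x) ^ 2) (𝓝 t) (𝓝 0) := fun hf => by
      simpa using (hf.tendsto t R).pow 2
    have hsum : Tendsto (fun s => ∑ n, (l2norm R (fun x => u n s x - u n t x) ^ 2 +
          ∑ i, l2norm R (fun x => g n i s x - g n i t x) ^ 2 +
          l2norm R (fun x => v n s x - v n t x) ^ 2)) (𝓝 t) (𝓝 0) := by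
      have := tendsto_finsetSum (Finset.univ : Finset (Fin d)) fun n _ =>
        ((l2 (h.field n).cu).add (tendsto_finsetSum (Finset.univ : Finset (Fin 3))
          fun i _ => l2 ((h.field n).cg i))).add (l2 (h.field n).cv)
      simpa using this
    simpa using (hsum.add (vec cq)).add (vec cp)
  have cong : ∀ {f f' : R3 → ℝ}, f =ᵐ[volume] f' → ∀ ψ : R3 → ℝ,
      ∫ x, f x * ψ x = ∫ x, f' x * ψ x := fun hf ψ => integral_congr_ae (hf.mono fun x hx => by simp only [hx])
  refine ⟨⟨Y, cY⟩, ⟨fun n ψ h1 h2 t => ?_, fun n ψ h1 h2 t => ?_, fun t => ?_, fun t => ?_⟩, hu 0,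
    hv 0, hq 0, hp 0⟩
  · simpa only [ContinuousMap.coe_mk, fun s => cong (hu s n) ψ, fun s => cong (hv s n) ψ] using
      (h.field n).du ψ ⟨h1, h2⟩ t
  · have := (h.field n).dv ψ ⟨h1, h2⟩ t
    simpa only [ContinuousMap.coe_mk, fun s => cong (hu s n) fun x => Δ ψ x - m n ^ 2 * ψ x,
      fun s => cong (hv s n) ψ, hq, inner_gradient_eq_source (ρ n) q] using this
  · simpa only [ContinuousMap.coe_mk, hq, hp] using h.dq t
  · have := h.dp t
    simp only [fun n => force_congr (ρ := ρ n) (hu t n).symm] at this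
    simp only [force] at this
    simpa only [ContinuousMap.coe_mk, hq, hp] using this

theorem exists_isSolution (m : Fin d → ℝ) (ω₀ : ℝ) (hρ : ∀ n, IsTest (ρ n)) (Y₀ : PhaseSpace d) :
    ∃ Y : C(ℝ, PhaseSpace d), IsSolution m ω₀ ρ Y ∧ Y 0 = Y₀ := by
  obtain ⟨u, v, g, q, p, h, hu, hv, hq, hp⟩ := exists_isCoupled m ω₀ hρ Y₀.pos Y₀.imp
    Y₀.memL2loc_phi Y₀.memL2loc_mom Y₀.memL2loc_gradPhi_apply Y₀.isWeakPd_phi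
  obtain ⟨Y, hY, hu', hv', hq', hp'⟩ := h.exists_isSolution
  exact ⟨Y, hY, PhaseSpace.ext_of_ae (fun n => (hu' n).trans (hu n))
    (fun n => (hv' n).trans (hv n)) (hq'.trans hq) (hp'.trans hp)⟩

theorem IsSolution.localEnergy_le (hρ : ∀ n, IsTest (ρ n)) {R : ℝ}
    (hR : ∀ n i x, R ≤ ‖x‖ → pd i (ρ n) x = 0) {Y : C(ℝ, PhaseSpace d)}
    (h : IsSolution m ω₀ ρ Y) {t T : ℝ} (ht : |t| ≤ T) :
    (Y t).localEnergy R ≤ growthFactor m ω₀ ρ T * (Y 0).localEnergy (R + |t|) := by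
  rw [PhaseSpace.localEnergy_eq, PhaseSpace.localEnergy_eq]
  exact (h.isCoupled hρ Y.continuous).energy_le hρ hR ht

theorem IsSolution.localEnergy_sub_le (hρ : ∀ n, IsTest (ρ n)) {R : ℝ}
    (hR : ∀ n i x, R ≤ ‖x‖ → pd i (ρ n) x = 0) {Y Z : C(ℝ, PhaseSpace d)}
    (hY : IsSolution m ω₀ ρ Y) (hZ : IsSolution m ω₀ ρ Z) {t T : ℝ} (ht : |t| ≤ T) :
    (Y t - Z t).localEnergy R ≤ growthFactor m ω₀ ρ T * (Y 0 - Z 0).localEnergy (R + |t|) := by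
  rw [PhaseSpace.localEnergy_sub, PhaseSpace.localEnergy_sub]
  exact ((hY.isCoupled hρ Y.continuous).sub hρ (hZ.isCoupled hρ Z.continuous)).energy_le hρ hR ht

/-- The difference of two solutions has vanishing initial energy on every ball, so its energy
vanishes on all sufficiently large balls at each time. -/
theorem IsSolution.unique (hρ : ∀ n, IsTest (ρ n)) {R₀ : ℝ}
    (hR₀ : ∀ n i x, R₀ ≤ ‖x‖ → pd i (ρ n) x = 0) {Y Z : C(ℝ, PhaseSpace d)}
    (hY : IsSolution m ω₀ ρ Y) (hZ : IsSolution m ω₀ ρ Z) (h0 : Y 0 = Z 0) : Y = Z := by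
  ext1 t
  refine PhaseSpace.eq_of_localEnergy_sub (R₀ := R₀) fun R hR =>
    le_antisymm ?_ (PhaseSpace.localEnergy_nonneg _ _)
  have := hY.localEnergy_sub_le hρ (fun n i x hx => hR₀ n i x (hR.trans hx)) hZ (le_refl |t|)
  have z : PhaseSpace.localEnergy (R + |t|) (Y 0 - Z 0) = 0 := by
    rw [PhaseSpace.localEnergy_sub, h0]
    simp [coupledEnergy, energy, l2norm_zero]
  rwa [z, mul_zero] at this

end solutions

end

end FieldParticle

end

/-! ### The Cauchy problem and its propagator. -/

theorem proposition2p3 {d : ℕ} (m : Fin d → ℝ) (hm : ∀ n, 0 ≤ m n) (ω : ℝ) (hω : 0 < ω)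
    (ρ : Fin d → FieldParticle.R3 → ℝ) (Rρ : ℝ)
    (hA1' : FieldParticle.StabilityCondition m ω ρ)
    (hA2 : FieldParticle.CouplingCondition ρ Rρ) :
    (∀ Y₀ : FieldParticle.PhaseSpace d,
      ∃! Y : C(ℝ, FieldParticle.PhaseSpace d), FieldParticle.IsSolution m ω ρ Y ∧ Y 0 = Y₀) ∧
    ∃ U : ℝ → FieldParticle.PhaseSpace d → FieldParticle.PhaseSpace d,
      (∀ (Y₀ : FieldParticle.PhaseSpace d) (Y : C(ℝ, FieldParticle.PhaseSpace d)),
        FieldParticle.IsSolution m ω ρ Y → Y 0 = Y₀ → ∀ t : ℝ, U t Y₀ = Y t) ∧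
      (∀ t : ℝ, Continuous (U t)) ∧
      ∃ C : ℝ → ℝ, ∀ R : ℝ, Rρ < R → ∀ T : ℝ, 0 < T → ∀ Y₀ : FieldParticle.PhaseSpace d,
        ∀ t : ℝ, |t| ≤ T →
          (U t Y₀).localEnergy R ≤ C T * Y₀.localEnergy (R + T) := by
  have hρ := FieldParticle.isTest_of_couplingCondition hA2
  have hR : ∀ {R : ℝ}, Rρ < R → ∀ n i x, R ≤ ‖x‖ → FieldParticle.pd i (ρ n) x = 0 :=
    fun h => FieldParticle.pd_eq_zero_of_couplingCondition hA2 h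
  have huniq : ∀ Y Z : C(ℝ, FieldParticle.PhaseSpace d), FieldParticle.IsSolution m ω ρ Y →
      FieldParticle.IsSolution m ω ρ Z → Y 0 = Z 0 → Y = Z := fun Y Z hY hZ h0 =>
    FieldParticle.IsSolution.unique hρ (hR (lt_add_one Rρ)) hY hZ h0
  choose W hW hW0 using fun Y₀ => FieldParticle.exists_isSolution m ω hρ Y₀
  refine ⟨fun Y₀ => ⟨W Y₀, ⟨hW Y₀, hW0 Y₀⟩, fun Z hZ =>
    huniq _ _ hZ.1 (hW Y₀) (hZ.2.trans (hW0 Y₀).symm)⟩, fun t Y₀ => W Y₀ t,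
    fun Y₀ Y hY h0 t => DFunLike.congr_fun (huniq _ _ (hW Y₀) hY ((hW0 Y₀).trans h0.symm)) t, fun t => ?_,
    FieldParticle.growthFactor m ω ρ, fun R hRR T _ Y₀ t ht => ?_⟩
  · rw [continuous_iff_continuousAt]
    intro Y₀
    -- Continuity follows from the energy estimate for the difference of two solutions. The radius
    -- is first raised above Rρ, where that estimate holds.
    refine FieldParticle.PhaseSpace.tendsto_iff.2 fun R hR0 => ?_
    have hRpos : 0 < max R (Rρ + 1) + |t| := by
      have := le_max_left R (Rρ + 1)
      have := abs_nonneg t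
      linarith
    have hlim := (FieldParticle.PhaseSpace.tendsto_iff.1 (Filter.tendsto_id (x := nhds Y₀)) _
      hRpos).const_mul (FieldParticle.growthFactor m ω ρ |t|)
    rw [mul_zero] at hlim
    refine squeeze_zero (fun _ => FieldParticle.PhaseSpace.localEnergy_nonneg _ _)
      (fun Z₀ => ?_) hlim
    refine (FieldParticle.PhaseSpace.localEnergy_mono (le_max_left R (Rρ + 1)) _).trans ?_
    have := (hW Z₀).localEnergy_sub_le hρ (hR ((lt_add_one Rρ).trans_le (le_max_right R _)))
      (hW Y₀) (le_refl |t|)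
    rwa [hW0, hW0] at this
  -- The estimate gives the initial energy on radius R + |t|, which is enlarged to R + T because |t|
  -- ≤ T.
  · refine ((hW Y₀).localEnergy_le hρ (hR hRR) ht).trans ?_
    rw [hW0]
    exact mul_le_mul_of_nonneg_left (FieldParticle.PhaseSpace.localEnergy_mono (by linarith) _)
      (FieldParticle.growthFactor_nonneg m ω ρ T)
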